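/- Let $\Omega\subset\mathbb{R}^2$ be a nonempty bounded open set, let $K>1$ and $S_1,S_2\in[1/K,K]$, and put $\sigma_1=\operatorname{diag}(1/K,1/S_1)$, $\sigma_2=\operatorname{diag}(K,S_2)$. For $1\le p<\infty$ let $L^p_{\rm weak}(\Omega;\mathbb{R}^2)$ be the set of measurable $f:\Omega\to\mathbb{R}^2$ with $\sup_{t>0}t^p\,|\{x\in\Omega:|f(x)|>t\}|<\infty$. Then there exist coefficients $\sigma_n\in L^\infty(\Omega;\{\sigma_1,\sigma_2\})$ (measurable, with values in $\{\sigma_1,\sigma_2\}$ almost everywhere), exponents $p_n\in\left[1,\frac{2K}{K+1}\right]$ and functions $u_n\in W^{1,1}(\Omega;\mathbb{R})$, $n\in\mathbb{N}$, such that for every $n$ $$\operatorname{div}(\sigma_n\nabla u_n)=0\ \text{ in }\Omega\text{ in the sense of distributions},\qquad u_n=x_1\ \text{ on }\partial\Omega,\ \text{ i.e. } u_n-x_1\in W^{1,1}_0(\Omega),$$ $$\nabla u_n\in L^{p_n}_{\rm weak}(\Omega;\mathbb{R}^2),\qquad \nabla u_n\notin L^{\frac{2K}{K+1}}(\Omega;\mathbb{R}^2),$$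 and $p_n\to\frac{2K}{K+1}$ as $n\to\infty$. In particular $u_n\in W^{1,q}(\Omega;\mathbb{R})$ for every $1\le q<p_n$, but $\int_\Omega|\nabla u_n|^{\frac{2K}{K+1}}\,dx=\infty$. (Here $W^{1,1}_0(\Omega)$ is the closure of $C_c^\infty(\Omega)$ in $W^{1,1}(\Omega)$.) -/

import Mathlib

open MeasureTheory Filter Topology
open scoped ENNReal

noncomputable section

namespace TwoPhase

/-- The Euclidean plane. -/
abbrev Plane : Type := EuclideanSpace ℝ (Fin 2)

/-- The test functions `C_c^∞(Ω)`. -/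
def IsTestFunction (Ω : Set Plane) (φ : Plane → ℝ) : Prop :=
  ContDiff ℝ ((⊤ : ℕ∞) : WithTop ℕ∞) φ ∧ HasCompactSupport φ ∧ tsupport φ ⊆ Ω

/-- `g` is the weak (distributional) gradient of `u` in the open set `Ω`; both are locally
integrable functions in `Ω`. Values outside `Ω` play no role. -/
def HasWeakGradient (Ω : Set Plane) (u : Plane → ℝ) (g : Plane → Plane) : Prop :=
  LocallyIntegrableOn u Ω volume ∧ LocallyIntegrableOn g Ω volume ∧
    ∀ φ : Plane → ℝ, IsTestFunction Ω φ →
      ∫ x in Ω, u x • gradient φ x = - ∫ x in Ω, φ x • g x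

/-- `u ∈ W^{1,q}(Ω)`, for `1 ≤ q`. -/
def MemW1 (Ω : Set Plane) (q : ℝ) (u : Plane → ℝ) : Prop :=
  MemLp u (ENNReal.ofReal q) (volume.restrict Ω) ∧
    ∃ g : Plane → Plane, HasWeakGradient Ω u g ∧ MemLp g (ENNReal.ofReal q) (volume.restrict Ω)

/-- `w ∈ W^{1,1}_0(Ω)`: `w` is a limit of test functions in the norm of `W^{1,1}(Ω)`. -/
def MemW11Zero (Ω : Set Plane) (w : Plane → ℝ) : Prop :=
  MemW1 Ω 1 w ∧
    ∃ h : Plane → Plane, HasWeakGradient Ω w h ∧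
      ∃ φ : ℕ → Plane → ℝ, (∀ k, IsTestFunction Ω (φ k)) ∧
        Tendsto (fun k => eLpNorm (fun x => w x - φ k x) 1 (volume.restrict Ω)) atTop (𝓝 0) ∧
        Tendsto (fun k => eLpNorm (fun x => h x - gradient (φ k) x) 1 (volume.restrict Ω))
          atTop (𝓝 0)

/-- The coefficient `σ` belongs to `L^∞(Ω; {σ₁, σ₂})`. -/
def IsTwoPhase (Ω : Set Plane) (σ₁ σ₂ : Matrix (Fin 2) (Fin 2) ℝ)
    (σ : Plane → Matrix (Fin 2) (Fin 2) ℝ) : Prop :=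
  (∀ i j, AEMeasurable (fun x => σ x i j) (volume.restrict Ω)) ∧
    ∀ᵐ x ∂(volume.restrict Ω), σ x = σ₁ ∨ σ x = σ₂

/-- `u ∈ W^{1,1}(Ω)` solves `div (σ ∇u) = 0` in `Ω` in the sense of distributions. -/
def IsDistributionalSolution (Ω : Set Plane) (σ : Plane → Matrix (Fin 2) (Fin 2) ℝ)
    (u : Plane → ℝ) : Prop :=
  MemW1 Ω 1 u ∧
    ∃ g : Plane → Plane, HasWeakGradient Ω u g ∧
      ∀ φ : Plane → ℝ, IsTestFunction Ω φ →
        Integrable (fun x => inner ℝ (Matrix.toEuclideanLin (σ x) (g x)) (gradient φ x))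
          (volume.restrict Ω) ∧
        ∫ x in Ω, inner ℝ (Matrix.toEuclideanLin (σ x) (g x)) (gradient φ x) = 0

/-- The quasinorm `[f]_p = (sup_{t > 0} t ^ p |{x ∈ Ω : |f x| > t}|) ^ (1 / p)`. -/
def weakLpQuasinorm (Ω : Set Plane) (p : ℝ) (f : Plane → Plane) : ℝ≥0∞ :=
  (⨆ t : Set.Ioi (0 : ℝ),
    ENNReal.ofReal ((t : ℝ) ^ p) * volume.restrict Ω {x | (t : ℝ) < ‖f x‖}) ^ (1 / p)

/-- `f ∈ L^p_weak(Ω; ℝ²)`. -/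
def MemWeakLp (Ω : Set Plane) (p : ℝ) (f : Plane → Plane) : Prop :=
  AEStronglyMeasurable f (volume.restrict Ω) ∧ weakLpQuasinorm Ω p f < ∞

end TwoPhase

end

noncomputable section

namespace TwoPhase

/-! Look for `u = ∂₁w` with a scalar potential `w`, and put `m = S₂`. Then `∇u = (w₁₁, w₁₂)`, and
the field `(-m w₂₂, m w₁₂)` is divergence free for every `w`, being `m` times the rotated gradient
of `∂₂w`. So `u` solves the equation as soon as `σ∇u` equals this field, which is a pointwise
condition on the triple `(w₁₁, w₁₂, m w₂₂)`. For `σ₂` it says `m w₂₂ = -K w₁₁`; for `σ₁` it holds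
when `w₁₂ = 0` and `K m w₂₂ = -w₁₁`. The union of these two sets is `phaseSet K`, and the problem
becomes a differential inclusion for second derivatives. The boundary condition is built in by
taking `w` to be a quadratic polynomial with `∂₁` equal to `x₁`, plus a test function.

A value `A` of the triple can be replaced, by a small oscillation in a direction `n`, with the
values `A + x q` and `A - y q`, where `q` comes from `n ⊗ n` and the volume fractions are `y / (x +
y)` and `x / (x + y)` (`exists_local_lamination`). From a point on one ray of `stairSet ρ`, one such
splitting puts one end into `phaseSet K` and the other on the opposite ray, `ρ` times larger and
with fraction `keep K ρ`. The `p`-th moment of the part not yet solved is thus multiplied by `keep K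
ρ * ρ ^ p`. The logarithm of this factor vanishes at `ρ = 1` and has derivative `p - 2K/(K+1)`
there. Hence for `p < 2K/(K+1)` some `ρ > 1` makes the factor less than one (`exists_logKeep_neg`),
whereas at the critical exponent the factor exceeds one for every `ρ > 1` (`logKeep_critical_pos`).
Values off the rays are led to them by at most two preliminary splittings. The functionals `cost`
and `gain` record the decay and the growth (`exists_split`).

Doing this in finitely many small balls that nearly fill `Ω` is one step (`exists_step`). Iterating
(`exists_sequence`) gives potentials whose second derivatives converge geometrically in `L^p`,
approach `phaseSet K`, and have critical energies tending to infinity.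

The blow-up must survive the limit. By convexity the energy of the limit is at least the energy at
stage `k` plus a linear term. Integration by parts bounds this term by the later oscillation of
`∂₁w` times a quantity known at stage `k`, and that oscillation is chosen small in advance
(`lintegral_eq_top_of_tendsto`). This yields one solution for each `p` below the critical exponent
(`exists_solution`), with gradient in `L^p` itself and so in weak `L^p`; the theorem takes a
sequence of such `p`. -/

/-! ### Partial derivatives, test functions and integration by parts -/

/-- Smooth real functions on the plane. -/
abbrev Smooth (f : Plane → ℝ) : Prop := ContDiff ℝ ((⊤ : ℕ∞) : WithTop ℕ∞) f

/-- The partial derivative in the direction of the `i`-th coordinate vector. -/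
def pd (i : Fin 2) (f : Plane → ℝ) (x : Plane) : ℝ := fderiv ℝ f x (EuclideanSpace.single i 1)

lemma Smooth.differentiable {f : Plane → ℝ} (hf : Smooth f) : Differentiable ℝ f :=
  ContDiff.differentiable hf (by simp)

lemma Smooth.pd {f : Plane → ℝ} (hf : Smooth f) (i : Fin 2) : Smooth (pd i f) := by
  have h : ContDiff ℝ ((⊤ : ℕ∞) : WithTop ℕ∞) (fderiv ℝ f) := hf.fderiv_right (by simp)
  exact h.clm_apply contDiff_const

lemma pd_add {f g : Plane → ℝ} (hf : Differentiable ℝ f) (hg : Differentiable ℝ g) (i : Fin 2) :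
    pd i (fun x => f x + g x) = fun x => pd i f x + pd i g x := by
  ext x
  simp only [pd]
  rw [fderiv_fun_add (hf x) (hg x)]
  simp

lemma pd_sub {f g : Plane → ℝ} (hf : Differentiable ℝ f) (hg : Differentiable ℝ g) (i : Fin 2) :
    pd i (fun x => f x - g x) = fun x => pd i f x - pd i g x := by
  ext x
  simp only [pd]
  rw [fderiv_fun_sub (hf x) (hg x)]
  simp

lemma pd_mul {f g : Plane → ℝ} (hf : Differentiable ℝ f) (hg : Differentiable ℝ g) (i : Fin 2) :
    pd i (fun x => f x * g x) = fun x => pd i f x * g x + f x * pd i g x := by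
  ext x
  simp only [pd]
  rw [fderiv_fun_mul (hf x) (hg x)]
  simp
  ring

lemma pd_const (c : ℝ) (i : Fin 2) : pd i (fun _ => c) = fun _ => 0 := by
  ext x
  simp [pd]

lemma pd_sum {ι : Type*} (s : Finset ι) {f : ι → Plane → ℝ} (hf : ∀ k ∈ s, Differentiable ℝ (f k))
    (i : Fin 2) : pd i (fun x => ∑ k ∈ s, f k x) = fun x => ∑ k ∈ s, pd i (f k) x := by
  ext x
  simp only [pd]
  rw [fderiv_fun_sum (fun k hk => hf k hk x)]
  simp

lemma pd_comm {f : Plane → ℝ} (hf : Smooth f) (i j : Fin 2) : pd i (pd j f) = pd j (pd i f) := by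
  have hd : Differentiable ℝ (fderiv ℝ f) :=
    (hf.fderiv_right (m := ((⊤ : ℕ∞) : WithTop ℕ∞)) (by simp)).differentiable (by simp)
  have key : ∀ (k l : Fin 2) (x : Plane), pd k (pd l f) x =
      fderiv ℝ (fderiv ℝ f) x (EuclideanSpace.single k 1) (EuclideanSpace.single l 1) := by
    intro k l x
    have : pd l f = fun y => fderiv ℝ f y (EuclideanSpace.single l 1) := rfl
    rw [this]
    simp only [pd]
    rw [fderiv_clm_apply (hd x) (differentiableAt_const _)]
    simp
  ext x
  rw [key, key]
  exact (hf.contDiffAt.isSymmSndFDerivAt (by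
    rw [minSmoothness_of_isRCLikeNormedField]
    exact WithTop.coe_le_coe.2 le_top)).eq _ _

lemma gradient_apply (f : Plane → ℝ) (x : Plane) (i : Fin 2) : gradient f x i = pd i f x := by
  have h : inner ℝ (gradient f x) (EuclideanSpace.single i (1 : ℝ)) = pd i f x := by
    simp only [gradient, pd, InnerProductSpace.toDual_symm_apply]
  rw [← h, EuclideanSpace.inner_single_right]
  simp

lemma norm_fderiv_le (f : Plane → ℝ) (x : Plane) : ‖fderiv ℝ f x‖ ≤ |pd 0 f x| + |pd 1 f x| := by
  refine ContinuousLinearMap.opNorm_le_bound _ (by positivity) fun v => ?_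
  have hv : v = v 0 • EuclideanSpace.single (0 : Fin 2) (1 : ℝ) +
      v 1 • EuclideanSpace.single (1 : Fin 2) (1 : ℝ) := by
    ext i
    fin_cases i <;> simp
  have h0 : |v 0| ≤ ‖v‖ := by simpa using PiLp.norm_apply_le v 0
  have h1 : |v 1| ≤ ‖v‖ := by simpa using PiLp.norm_apply_le v 1
  have : fderiv ℝ f x v = v 0 * pd 0 f x + v 1 * pd 1 f x := by
    conv_lhs => rw [hv]
    simp [pd]
  rw [this, Real.norm_eq_abs]
  calc |v 0 * pd 0 f x + v 1 * pd 1 f x| ≤ |v 0| * |pd 0 f x| + |v 1| * |pd 1 f x| := by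
        rw [← abs_mul, ← abs_mul]; exact abs_add_le _ _
    _ ≤ ‖v‖ * |pd 0 f x| + ‖v‖ * |pd 1 f x| := by gcongr
    _ = _ := by ring

lemma tsupport_pd_subset (f : Plane → ℝ) (i : Fin 2) : tsupport (pd i f) ⊆ tsupport f :=
  closure_minimal (fun x hx => by
    by_contra h
    exact hx (by simp [pd, fderiv_of_notMem_tsupport ℝ h])) (isClosed_tsupport f)

lemma pd_eq_zero_of_notMem {f : Plane → ℝ} {x : Plane} (h : x ∉ tsupport f) (i : Fin 2) :
    pd i f x = 0 := by simp [pd, fderiv_of_notMem_tsupport ℝ h]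

lemma hasCompactSupport_pd {f : Plane → ℝ} (hf : HasCompactSupport f) (i : Fin 2) :
    HasCompactSupport (pd i f) :=
  hf.mono' (subset_tsupport _ |>.trans (tsupport_pd_subset f i))

lemma IsTestFunction.pd {Ω : Set Plane} {f : Plane → ℝ} (hf : IsTestFunction Ω f) (i : Fin 2) :
    IsTestFunction Ω (pd i f) :=
  ⟨Smooth.pd hf.1 i, hasCompactSupport_pd hf.2.1 i, (tsupport_pd_subset f i).trans hf.2.2⟩

lemma IsTestFunction.zero (Ω : Set Plane) : IsTestFunction Ω (fun _ => 0) := by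
  refine ⟨contDiff_const, HasCompactSupport.zero, ?_⟩
  have : tsupport (fun _ : Plane => (0 : ℝ)) = ∅ := by simp
  simp [this]

lemma IsTestFunction.add {Ω : Set Plane} {f g : Plane → ℝ} (hf : IsTestFunction Ω f)
    (hg : IsTestFunction Ω g) : IsTestFunction Ω (fun x => f x + g x) :=
  ⟨hf.1.add hg.1, hf.2.1.add hg.2.1, (tsupport_add f g).trans (Set.union_subset hf.2.2 hg.2.2)⟩

lemma IsTestFunction.sum {Ω : Set Plane} {ι : Type*} (s : Finset ι) {f : ι → Plane → ℝ}
    (hf : ∀ k ∈ s, IsTestFunction Ω (f k)) : IsTestFunction Ω (fun x => ∑ k ∈ s, f k x) := by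
  classical
  induction s using Finset.induction_on with
  | empty => simpa using IsTestFunction.zero Ω
  | insert a s ha ih =>
    simp only [Finset.sum_insert ha]
    exact (hf a (by simp)).add (ih fun k hk => hf k (by simp [hk]))

/-- Integration by parts against a compactly supported function. -/
lemma integral_mul_pd {f g : Plane → ℝ} (hf : ContDiff ℝ 1 f) (hg : ContDiff ℝ 1 g)
    (hc : HasCompactSupport g) (i : Fin 2) :
    ∫ x, f x * pd i g x = - ∫ x, pd i f x * g x := by
  have cf : Continuous (pd i f) := (hf.continuous_fderiv (by simp)).clm_apply continuous_const
  have cg : Continuous (pd i g) := (hg.continuous_fderiv (by simp)).clm_apply continuous_const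
  refine integral_mul_fderiv_eq_neg_fderiv_mul_of_integrable ?_ ?_ ?_ ?_ ?_
  · exact (cf.mul hg.continuous).integrable_of_hasCompactSupport hc.mul_left
  · exact (hf.continuous.mul cg).integrable_of_hasCompactSupport (hasCompactSupport_pd hc i).mul_left
  · exact (hf.continuous.mul hg.continuous).integrable_of_hasCompactSupport hc.mul_left
  · exact fun x _ => (hf.differentiable (by simp)) x
  · exact fun x _ => (hg.differentiable (by simp)) x

lemma integral_pd_eq_zero {g : Plane → ℝ} (hg : ContDiff ℝ 1 g) (hc : HasCompactSupport g)
    (i : Fin 2) : ∫ x, pd i g x = 0 := by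
  have := integral_mul_pd (f := fun _ => (1 : ℝ)) contDiff_const hg hc i
  simpa [pd_const] using this

lemma hasFDerivAt_coord (i : Fin 2) (x : Plane) :
    HasFDerivAt (fun y : Plane => y i) (EuclideanSpace.proj i : Plane →L[ℝ] ℝ) x :=
  (EuclideanSpace.proj i : Plane →L[ℝ] ℝ).hasFDerivAt

lemma smooth_coord (i : Fin 2) : Smooth (fun y : Plane => y i) :=
  (EuclideanSpace.proj i : Plane →L[ℝ] ℝ).contDiff

/-- Derivative of a function of one linear form. -/
lemma pd_comp_linear {g : ℝ → ℝ} (hg : Differentiable ℝ g) (n c : Fin 2 → ℝ) (i : Fin 2) :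
    pd i (fun x : Plane => g (n 0 * (x 0 - c 0) + n 1 * (x 1 - c 1))) =
      fun x => n i * deriv g (n 0 * (x 0 - c 0) + n 1 * (x 1 - c 1)) := by
  ext x
  have h1 : HasFDerivAt (fun x : Plane => n 0 * (x 0 - c 0) + n 1 * (x 1 - c 1))
      (n 0 • (EuclideanSpace.proj 0 : Plane →L[ℝ] ℝ) + n 1 • (EuclideanSpace.proj 1 : Plane →L[ℝ] ℝ))
      x :=
    (((hasFDerivAt_coord 0 x).sub_const _).const_mul _).add
      (((hasFDerivAt_coord 1 x).sub_const _).const_mul _)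
  have h2 := ((hg (n 0 * (x 0 - c 0) + n 1 * (x 1 - c 1))).hasDerivAt).comp_hasFDerivAt x h1
  simp only [pd]
  erw [h2.fderiv]
  fin_cases i <;> simp [mul_comm]

lemma pd_comp_scale {g : Plane → ℝ} (hg : Differentiable ℝ g) (s : ℝ) (x₀ : Plane) (i : Fin 2) :
    pd i (fun x => g (s • (x - x₀))) = fun x => s * pd i g (s • (x - x₀)) := by
  ext x
  have h1 : HasFDerivAt (fun x : Plane => s • (x - x₀)) (s • ContinuousLinearMap.id ℝ Plane) x :=
    ((hasFDerivAt_id x).sub_const _).const_smul s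
  have h2 := (hg (s • (x - x₀))).hasFDerivAt.comp x h1
  simp only [pd]
  erw [h2.fderiv]
  simp

/-! ### Quadratic polynomials and the triple of second derivatives -/

/-- A general quadratic polynomial, expanded at `x₀`. -/
def quad (x₀ : Plane) (e c₀ c₁ a b d : ℝ) (x : Plane) : ℝ :=
  e + c₀ * (x 0 - x₀ 0) + c₁ * (x 1 - x₀ 1) + a / 2 * (x 0 - x₀ 0) ^ 2
    + b * ((x 0 - x₀ 0) * (x 1 - x₀ 1)) + d / 2 * (x 1 - x₀ 1) ^ 2

lemma hasFDerivAt_quad (x₀ : Plane) (e c₀ c₁ a b d : ℝ) (x : Plane) :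
    HasFDerivAt (quad x₀ e c₀ c₁ a b d)
      ((c₀ + a * (x 0 - x₀ 0) + b * (x 1 - x₀ 1)) • (EuclideanSpace.proj 0 : Plane →L[ℝ] ℝ)
       + (c₁ + b * (x 0 - x₀ 0) + d * (x 1 - x₀ 1)) • (EuclideanSpace.proj 1 : Plane →L[ℝ] ℝ)) x := by
  have h0 := (hasFDerivAt_coord 0 x).sub_const (x₀ 0)
  have h1 := (hasFDerivAt_coord 1 x).sub_const (x₀ 1)
  have := (((((h0.const_mul c₀).const_add e).add (h1.const_mul c₁)).add
    ((h0.pow 2).const_mul (a / 2))).add ((h0.mul h1).const_mul b)).add ((h1.pow 2).const_mul (d / 2))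
  refine this.congr_fderiv ?_
  ext v
  simp
  ring

lemma smooth_quad (x₀ : Plane) (e c₀ c₁ a b d : ℝ) : Smooth (quad x₀ e c₀ c₁ a b d) := by
  have h0 := smooth_coord 0
  have h1 := smooth_coord 1
  unfold quad Smooth
  fun_prop

lemma pd_zero_quad (x₀ : Plane) (e c₀ c₁ a b d : ℝ) :
    pd 0 (quad x₀ e c₀ c₁ a b d) = quad x₀ c₀ a b 0 0 0 := by
  ext x
  simp only [pd, (hasFDerivAt_quad x₀ e c₀ c₁ a b d x).fderiv]
  simp [quad]

lemma pd_one_quad (x₀ : Plane) (e c₀ c₁ a b d : ℝ) :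
    pd 1 (quad x₀ e c₀ c₁ a b d) = quad x₀ c₁ b d 0 0 0 := by
  ext x
  simp only [pd, (hasFDerivAt_quad x₀ e c₀ c₁ a b d x).fderiv]
  simp [quad]

/-- The second derivatives `(w₁₁, w₁₂, m w₂₂)`. -/
def hess (m : ℝ) (w : Plane → ℝ) (x : Plane) : ℝ × ℝ × ℝ :=
  (pd 0 (pd 0 w) x, pd 1 (pd 0 w) x, m * pd 1 (pd 1 w) x)

lemma continuous_hess {m : ℝ} {w : Plane → ℝ} (hw : Smooth w) : Continuous (hess m w) :=
  ((hw.pd 0).pd 0).continuous.prodMk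
    (((hw.pd 0).pd 1).continuous.prodMk (continuous_const.mul ((hw.pd 1).pd 1).continuous))

lemma hess_add {m : ℝ} {f g : Plane → ℝ} (hf : Smooth f) (hg : Smooth g) :
    hess m (fun x => f x + g x) = fun x => hess m f x + hess m g x := by
  ext1 x
  simp only [hess, pd_add hf.differentiable hg.differentiable,
    pd_add (hf.pd 0).differentiable (hg.pd 0).differentiable,
    pd_add (hf.pd 1).differentiable (hg.pd 1).differentiable, Prod.mk_add_mk]
  ring_nf

lemma hess_sum {m : ℝ} {ι : Type*} (s : Finset ι) {f : ι → Plane → ℝ}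
    (hf : ∀ k ∈ s, Smooth (f k)) :
    hess m (fun x => ∑ k ∈ s, f k x) = fun x => ∑ k ∈ s, hess m (f k) x := by
  ext1 x
  simp only [hess, pd_sum s (fun k hk => (hf k hk).differentiable),
    pd_sum s (fun k hk => ((hf k hk).pd 0).differentiable),
    pd_sum s (fun k hk => ((hf k hk).pd 1).differentiable)]
  refine Prod.ext ?_ (Prod.ext ?_ ?_) <;> simp [Prod.fst_sum, Prod.snd_sum, Finset.mul_sum]

lemma hess_quad (m : ℝ) (x₀ : Plane) (e c₀ c₁ a b d : ℝ) (x : Plane) :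
    hess m (quad x₀ e c₀ c₁ a b d) x = (a, b, m * d) := by
  simp [hess, pd_zero_quad, pd_one_quad, quad]

lemma hess_eq_zero_of_notMem {m : ℝ} {f : Plane → ℝ} {x : Plane} (h : x ∉ tsupport f) :
    hess m f x = 0 := by
  have h' : ∀ i, x ∉ tsupport (pd i f) := fun i hx => h (tsupport_pd_subset f i hx)
  simp [hess, pd_eq_zero_of_notMem (h' 0), pd_eq_zero_of_notMem (h' 1)]

/-! ### Oscillating functions of one variable -/

/-- A smooth `1`-periodic profile which is close to the indicator of `|s| < l / 2`. -/
def pulse (l : ℝ) (j : ℕ) (s : ℝ) : ℝ :=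
  Real.smoothTransition ((Real.cos (2 * Real.pi * s) - Real.cos (Real.pi * l)) * (j + 1))

lemma contDiff_pulse (l : ℝ) (j : ℕ) : ContDiff ℝ ((⊤ : ℕ∞) : WithTop ℕ∞) (pulse l j) := by
  unfold pulse
  have h : ContDiff ℝ ((⊤ : ℕ∞) : WithTop ℕ∞) Real.cos := Real.contDiff_cos
  exact Real.smoothTransition.contDiff.comp
    (((h.comp (contDiff_const.mul contDiff_id)).sub contDiff_const).mul contDiff_const)

lemma pulse_nonneg (l : ℝ) (j : ℕ) (s : ℝ) : 0 ≤ pulse l j s := Real.smoothTransition.nonneg _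

lemma pulse_le_one (l : ℝ) (j : ℕ) (s : ℝ) : pulse l j s ≤ 1 := Real.smoothTransition.le_one _

lemma pulse_periodic (l : ℝ) (j : ℕ) : Function.Periodic (pulse l j) 1 := by
  intro s
  have : 2 * Real.pi * (s + 1) = 2 * Real.pi * s + 2 * Real.pi := by ring
  simp [pulse, this]

lemma cos_lt_cos_iff_abs {l s : ℝ} (hl : 0 < l) (hl1 : l < 1) (hs : |s| ≤ 1 / 2) :
    Real.cos (Real.pi * l) < Real.cos (2 * Real.pi * s) ↔ |s| < l / 2 := by
  have hpi := Real.pi_pos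
  have e : Real.cos (2 * Real.pi * s) = Real.cos (2 * Real.pi * |s|) := by
    rw [← Real.cos_abs, abs_mul, abs_of_pos (by positivity : 0 < 2 * Real.pi)]
  rw [e, Real.strictAntiOn_cos.lt_iff_gt ⟨by positivity, by nlinarith⟩
    ⟨by positivity, by nlinarith⟩]
  constructor <;> intro h <;> nlinarith

/-- On the centred period the profile converges pointwise to the indicator of an interval of length
`l`, and dominated convergence applies. -/
lemma tendsto_integral_pulse {l : ℝ} (hl : 0 < l) (hl1 : l < 1) :
    Tendsto (fun j => ∫ s in (0 : ℝ)..1, pulse l j s) atTop (𝓝 l) := by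
  have hshift : ∀ j, ∫ s in (0 : ℝ)..1, pulse l j s = ∫ s in (-(1 / 2) : ℝ)..(1 / 2), pulse l j s := by
    intro j
    have := (pulse_periodic l j).intervalIntegral_add_eq (0 : ℝ) (-(1 / 2))
    norm_num at this ⊢
    exact this
  simp_rw [hshift]
  have hlim : ∫ s in (-(1 / 2) : ℝ)..(1 / 2), (Set.Ioo (-(l / 2)) (l / 2)).indicator (fun _ => (1 : ℝ)) s
      = l := by
    rw [intervalIntegral.integral_of_le (by norm_num), integral_indicator measurableSet_Ioo,
      Measure.restrict_restrict measurableSet_Ioo, Set.inter_eq_left.2]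
    · simp; linarith
    · intro s hs; exact ⟨by linarith [hs.1], by linarith [hs.2]⟩
  refine Tendsto.mono_right ?_ (le_of_eq (congrArg 𝓝 hlim))
  refine intervalIntegral.tendsto_integral_filter_of_dominated_convergence (fun _ => 1) ?_ ?_ ?_ ?_
  · exact Eventually.of_forall fun j => (contDiff_pulse l j).continuous.aestronglyMeasurable
  · refine Eventually.of_forall fun j => Eventually.of_forall fun s _ => ?_
    rw [Real.norm_eq_abs, abs_of_nonneg (pulse_nonneg l j s)]
    exact pulse_le_one l j s
  · simp
  · refine Eventually.of_forall fun s hs => ?_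
    rw [Set.uIoc_of_le (by norm_num)] at hs
    have habs : |s| ≤ 1 / 2 := abs_le.2 ⟨hs.1.le, hs.2⟩
    by_cases h : |s| < l / 2
    · have hm : s ∈ Set.Ioo (-(l / 2)) (l / 2) := abs_lt.1 h
      rw [Set.indicator_of_mem hm]
      have hpos := sub_pos.2 ((cos_lt_cos_iff_abs hl hl1 habs).2 h)
      refine tendsto_const_nhds.congr' ?_
      obtain ⟨N, hN⟩ := exists_nat_gt (Real.cos (2 * Real.pi * s) - Real.cos (Real.pi * l))⁻¹
      filter_upwards [eventually_ge_atTop N] with j hj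
      symm
      apply Real.smoothTransition.one_of_one_le
      have : (N : ℝ) ≤ j := by exact_mod_cast hj
      calc (1 : ℝ) = (Real.cos (2 * Real.pi * s) - Real.cos (Real.pi * l)) *
            (Real.cos (2 * Real.pi * s) - Real.cos (Real.pi * l))⁻¹ := by
              rw [mul_inv_cancel₀ hpos.ne']
        _ ≤ _ := by gcongr; linarith
    · have hm : s ∉ Set.Ioo (-(l / 2)) (l / 2) := fun hm => h (abs_lt.2 hm)
      rw [Set.indicator_of_notMem hm]
      refine tendsto_const_nhds.congr fun j => ?_
      symm
      apply Real.smoothTransition.zero_of_nonpos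
      have : Real.cos (2 * Real.pi * s) - Real.cos (Real.pi * l) ≤ 0 := by
        by_contra hc
        exact h ((cos_lt_cos_iff_abs hl hl1 habs).1 (by linarith))
      exact mul_nonpos_of_nonpos_of_nonneg this (by positivity)

/-- Once the mean is subtracted the primitive is itself periodic, so it is determined by the
fractional part of `t`. The bound does not depend on `t`, which is what makes rescaled oscillations
small. -/
lemma abs_integral_sub_mean_le {f : ℝ → ℝ} (hf : Continuous f) (hp : Function.Periodic f 1)
    (h0 : ∀ s, 0 ≤ f s) (h1 : ∀ s, f s ≤ 1) (t : ℝ) :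
    |∫ s in (0 : ℝ)..t, (f s - ∫ r in (0 : ℝ)..1, f r)| ≤ 1 := by
  set M := ∫ r in (0 : ℝ)..1, f r with hM
  have hi : ∀ a b, IntervalIntegrable (fun s => f s - M) volume a b := fun a b =>
    (hf.sub continuous_const).intervalIntegrable a b
  have hM0 : 0 ≤ M := intervalIntegral.integral_nonneg (by norm_num) fun s _ => h0 s
  have hM1 : M ≤ 1 := by
    have := intervalIntegral.integral_mono_on (by norm_num : (0 : ℝ) ≤ 1)
      (hf.intervalIntegrable 0 1)
      (continuous_const.intervalIntegrable 0 1 : IntervalIntegrable (fun _ => (1 : ℝ)) volume 0 1)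
      (fun s _ => h1 s)
    simpa using this
  have hzero : ∫ s in (0 : ℝ)..1, (f s - M) = 0 := by
    rw [intervalIntegral.integral_sub (hf.intervalIntegrable 0 1) (by simp)]
    simp [hM]
  have hper : Function.Periodic (fun t => ∫ s in (0 : ℝ)..t, (f s - M)) 1 := by
    intro t
    have hp' : Function.Periodic (fun s => f s - M) 1 := fun s => by simp [hp s]
    have := hp'.intervalIntegral_add_eq t 0
    simp only [zero_add] at this
    rw [hzero] at this
    show ∫ s in (0 : ℝ)..(t + 1), (f s - M) = ∫ s in (0 : ℝ)..t, (f s - M)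
    rw [← intervalIntegral.integral_add_adjacent_intervals (hi 0 t) (hi t (t + 1)), this, add_zero]
  have hfr : ∫ s in (0 : ℝ)..t, (f s - M) = ∫ s in (0 : ℝ)..(Int.fract t), (f s - M) := by
    have := hper.sub_zsmul_eq (x := t) ⌊t⌋
    simp only [zsmul_eq_mul, mul_one] at this
    rw [← this, Int.fract]
  rw [hfr]
  have := intervalIntegral.norm_integral_le_of_norm_le_const (a := 0) (b := Int.fract t) (C := 1)
    (f := fun s => f s - M) (fun s _ => by
      rw [Real.norm_eq_abs, abs_le]; constructor <;> linarith [h0 s, h1 s])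
  rw [Real.norm_eq_abs] at this
  refine this.trans ?_
  rw [sub_zero, abs_of_nonneg (Int.fract_nonneg t)]
  linarith [Int.fract_lt_one t]

/-- A smooth function of one variable that is small in `C¹` and whose second derivative takes,
up to a set of small measure, only two prescribed values of opposite signs. -/
lemma exists_oscillation (ν : Measure ℝ) [IsFiniteMeasure ν] {x y : ℝ} (hxy : 0 < x * y)
    {ε : ℝ} (hε : 0 < ε) :
    ∃ g : ℝ → ℝ, ContDiff ℝ ((⊤ : ℕ∞) : WithTop ℕ∞) g ∧ (∀ t, |t| ≤ 1 → |g t| ≤ ε) ∧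
      (∀ t, |t| ≤ 1 → |deriv g t| ≤ ε) ∧ (∀ t, |deriv (deriv g) t| ≤ max |x| |y|) ∧
      ν {t | deriv (deriv g) t ≠ x ∧ deriv (deriv g) t ≠ -y} ≤ ENNReal.ofReal ε := by
  have hx : x ≠ 0 := by rintro rfl; simp at hxy
  have hb : x + y ≠ 0 := by
    intro h
    have : y = -x := by linarith
    rw [this] at hxy
    nlinarith [sq_nonneg x]
  -- The second derivative will be `β * (pulse - l)`: it equals `x` where the pulse is one and `-y`
  -- where the pulse is zero, and it has mean nearly zero because the mean of the pulse is close to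
  -- `l`.
  set β := x + y with hβ
  set l := y / β with hl
  have hl0 : 0 < l := by
    have : l = (x * y + y ^ 2) / β ^ 2 := by rw [hl]; field_simp; rw [hβ]
    rw [this]; positivity
  have hl1 : l < 1 := by
    have : 1 - l = (x * y + x ^ 2) / β ^ 2 := by rw [hl]; field_simp; rw [hβ]; ring
    have h2 : 0 < 1 - l := by rw [this]; positivity
    linarith
  have hβl : β * l = y := by rw [hl]; field_simp
  -- The period of the oscillation: the periodic part of the first derivative is at most `|β| τ = ε
  -- / 2`.
  set τ := ε / (2 * |β|) with hτ
  have hβpos : 0 < |β| := abs_pos.2 hb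
  have hτpos : 0 < τ := by positivity
  -- choice of the sharpness of the profile
  obtain ⟨j, hj1, hj2⟩ : ∃ j : ℕ, |(∫ s in (0 : ℝ)..1, pulse l j s) - l| < ε / (2 * |β|) ∧
      ν {t | pulse l j (t / τ) ≠ 1 ∧ pulse l j (t / τ) ≠ 0} < ENNReal.ofReal ε := by
    have e1 : ∀ᶠ j in atTop, |(∫ s in (0 : ℝ)..1, pulse l j s) - l| < ε / (2 * |β|) := by
      have := (Metric.tendsto_nhds.1 (tendsto_integral_pulse hl0 hl1)) (ε / (2 * |β|))
        (by positivity)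
      simpa [Real.dist_eq] using this
    -- The transition zone of the profile. It decreases to the empty set as `j` grows, so its
    -- measure tends to zero for any finite `ν`; the period is already fixed here.
    let U : ℕ → Set ℝ := fun j => {t | 0 < Real.cos (2 * Real.pi * (t / τ)) - Real.cos (Real.pi * l) ∧
      (Real.cos (2 * Real.pi * (t / τ)) - Real.cos (Real.pi * l)) * (j + 1) < 1}
    have hcont : Continuous fun t : ℝ => Real.cos (2 * Real.pi * (t / τ)) - Real.cos (Real.pi * l) := by
      fun_prop
    have hUm : ∀ j, MeasurableSet (U j) := fun j =>
      ((isOpen_lt continuous_const hcont).inter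
        (isOpen_lt (hcont.mul continuous_const) continuous_const)).measurableSet
    have hUa : Antitone U := by
      intro i j hij t ht
      refine ⟨ht.1, lt_of_le_of_lt ?_ ht.2⟩
      have : (i : ℝ) ≤ j := by exact_mod_cast hij
      have := ht.1
      gcongr
    have hUe : ⋂ j, U j = ∅ := by
      ext t
      simp only [Set.mem_iInter, Set.mem_empty_iff_false, iff_false, not_forall]
      by_cases h : 0 < Real.cos (2 * Real.pi * (t / τ)) - Real.cos (Real.pi * l)
      · obtain ⟨N, hN⟩ := exists_nat_gt (Real.cos (2 * Real.pi * (t / τ)) - Real.cos (Real.pi * l))⁻¹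
        refine ⟨N, fun hU => ?_⟩
        have := hU.2
        rw [inv_lt_iff_one_lt_mul₀ h] at hN
        nlinarith
      · exact ⟨0, fun hU => h hU.1⟩
    have e2 : Tendsto (fun j => ν (U j)) atTop (𝓝 0) := by
      have := tendsto_measure_iInter_atTop (μ := ν) (fun j => (hUm j).nullMeasurableSet) hUa
        ⟨0, measure_ne_top _ _⟩
      rwa [hUe, measure_empty] at this
    have e3 : ∀ᶠ j in atTop, ν (U j) < ENNReal.ofReal ε :=
      e2.eventually_lt_const (by simpa using hε)
    obtain ⟨j, h1, h2⟩ := (e1.and e3).exists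
    refine ⟨j, h1, lt_of_le_of_lt (measure_mono ?_) h2⟩
    rintro t ⟨ht1, ht0⟩
    constructor
    · by_contra hc
      apply ht0
      apply Real.smoothTransition.zero_of_nonpos
      exact mul_nonpos_of_nonpos_of_nonneg (by linarith) (by positivity)
    · by_contra hc
      exact ht1 (Real.smoothTransition.one_of_one_le (by linarith))
  set M := ∫ s in (0 : ℝ)..1, pulse l j s with hM
  have hpc : Continuous (pulse l j) := (contDiff_pulse l j).continuous
  -- The linear term corrects the mean `M` of the actual profile to the ideal mean `l`. This keeps
  -- the two values of the derivative exact, at the price of a drift that is at most `ε / 2` for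
  -- `|t| ≤ 1`.
  let G : ℝ → ℝ := fun t =>
    β * τ * (∫ s in (0 : ℝ)..(t / τ), (pulse l j s - M)) + β * (M - l) * t
  have hG : ∀ t, HasDerivAt G (β * (pulse l j (t / τ) - l)) t := by
    intro t
    have h1 : HasDerivAt (fun t => ∫ s in (0 : ℝ)..t, (pulse l j s - M)) (pulse l j (t / τ) - M)
        (t / τ) :=
      (hpc.sub continuous_const).integral_hasStrictDerivAt 0 (t / τ) |>.hasDerivAt
    have h2 : HasDerivAt (fun t : ℝ => t / τ) (1 / τ) t := (hasDerivAt_id t).div_const τ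
    have h3 := ((h1.comp t h2).const_mul (β * τ)).add ((hasDerivAt_id t).const_mul (β * (M - l)))
    refine h3.congr_deriv ?_
    field_simp
    ring
  have hGc : Continuous G := continuous_iff_continuousAt.2 fun t => (hG t).continuousAt
  have hg : ∀ t, HasDerivAt (fun t => ∫ s in (0 : ℝ)..t, G s) (G t) t := fun t =>
    (hGc.integral_hasStrictDerivAt 0 t).hasDerivAt
  have hdg : deriv (fun t => ∫ s in (0 : ℝ)..t, G s) = G := funext fun t => (hg t).deriv
  have hdG : deriv G = fun t => β * (pulse l j (t / τ) - l) := funext fun t => (hG t).deriv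
  have hGb : ∀ t, |t| ≤ 1 → |G t| ≤ ε := by
    intro t ht
    have h1 := abs_integral_sub_mean_le hpc (pulse_periodic l j) (pulse_nonneg l j)
      (pulse_le_one l j) (t / τ)
    calc |G t| ≤ |β * τ * (∫ s in (0 : ℝ)..(t / τ), (pulse l j s - M))| + |β * (M - l) * t| :=
          abs_add_le _ _
      _ = |β| * τ * |∫ s in (0 : ℝ)..(t / τ), (pulse l j s - M)| + |β| * |M - l| * |t| := by
          rw [abs_mul, abs_mul, abs_mul, abs_mul, abs_of_pos hτpos]
      _ ≤ |β| * τ * 1 + |β| * (ε / (2 * |β|)) * 1 := by gcongr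
      _ = ε := by rw [hτ]; field_simp; ring
  refine ⟨fun t => ∫ s in (0 : ℝ)..t, G s, ?_, ?_, ?_, ?_, ?_⟩
  · rw [contDiff_infty_iff_deriv]
    refine ⟨fun t => (hg t).differentiableAt, ?_⟩
    rw [hdg, contDiff_infty_iff_deriv]
    refine ⟨fun t => (hG t).differentiableAt, ?_⟩
    rw [hdG]
    exact contDiff_const.mul
      (((contDiff_pulse l j).comp (contDiff_id.div_const τ)).sub contDiff_const)
  · intro t ht
    have := intervalIntegral.norm_integral_le_of_norm_le_const (a := 0) (b := t) (C := ε)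
      (f := G) (fun s hs => hGb s (by
        have h := Set.uIoc_subset_uIcc hs
        rw [Set.mem_uIcc] at h
        rw [abs_le] at ht ⊢
        rcases h with h | h <;> constructor <;> linarith))
    rw [Real.norm_eq_abs, sub_zero] at this
    nlinarith
  · rw [hdg]; exact hGb
  · rw [hdg, hdG]
    intro t
    have h0 := pulse_nonneg l j (t / τ)
    have h1 := pulse_le_one l j (t / τ)
    set z := pulse l j (t / τ)
    have : β * (z - l) = z * x + (1 - z) * (-y) := by rw [mul_sub, hβl, hβ]; ring
    show |β * (z - l)| ≤ _
    rw [this]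
    calc |z * x + (1 - z) * (-y)| ≤ |z * x| + |(1 - z) * (-y)| := abs_add_le _ _
      _ = z * |x| + (1 - z) * |y| := by
          rw [abs_mul, abs_mul, abs_neg, abs_of_nonneg h0, abs_of_nonneg (by linarith : 0 ≤ 1 - z)]
      _ ≤ z * max |x| |y| + (1 - z) * max |x| |y| := by
          have : 0 ≤ 1 - z := by linarith
          gcongr
          · exact le_max_left _ _
          · exact le_max_right _ _
      _ = _ := by ring
  · rw [hdg, hdG]
    refine (measure_mono ?_).trans hj2.le
    rintro t ⟨h1, h2⟩
    refine ⟨fun h => h1 ?_, fun h => h2 ?_⟩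
    · simp only [h]; rw [mul_sub, hβl, hβ]; ring
    · simp only [h]; rw [mul_sub, hβl]; ring

/-! ### Cutoff functions and second order Taylor remainders -/

/-- Cutoff functions for concentric balls, with derivative bounds that scale with the radius. -/
lemma exists_cutoff {s : ℝ} (hs : 0 < s) (hs1 : s < 1) :
    ∃ C : ℝ, 0 ≤ C ∧ ∀ (x₀ : Plane) (r : ℝ), 0 < r → ∃ χ : Plane → ℝ, Smooth χ ∧
      (∀ z, 0 ≤ χ z) ∧ (∀ z, χ z ≤ 1) ∧ (∀ z ∈ Metric.closedBall x₀ (s * r), χ z = 1) ∧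
      tsupport χ ⊆ Metric.ball x₀ r ∧ (∀ i z, |pd i χ z| ≤ C / r) ∧
      (∀ i j z, |pd i (pd j χ) z| ≤ C / r ^ 2) := by
  -- One fixed bump is rescaled to every ball, so `C` depends only on `s`. The outer radius is less
  -- than one to keep the closed support inside the open ball.
  let b : ContDiffBump (0 : Plane) := ⟨s, (s + 1) / 2, hs, by linarith⟩
  have hb : Smooth b := b.contDiff
  have bound : ∀ f : Plane → ℝ, Smooth f → HasCompactSupport f → ∃ C, 0 ≤ C ∧ ∀ z, |f z| ≤ C := by
    intro f hf hc
    obtain ⟨C, hC⟩ := hf.continuous.bounded_above_of_compact_support hc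
    exact ⟨C, (norm_nonneg _).trans (hC 0), hC⟩
  have hc : HasCompactSupport b := b.hasCompactSupport
  choose C1 h1 h1' using fun i => bound (pd i b) (hb.pd i) (hasCompactSupport_pd hc i)
  choose C2 h2 h2' using fun i j => bound (pd i (pd j b)) ((hb.pd j).pd i)
    (hasCompactSupport_pd (hasCompactSupport_pd hc j) i)
  refine ⟨∑ i, C1 i + ∑ i, ∑ j, C2 i j, add_nonneg (Finset.sum_nonneg fun i _ => h1 i)
    (Finset.sum_nonneg fun i _ => Finset.sum_nonneg fun j _ => h2 i j), ?_⟩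
  intro x₀ r hr
  have hl1 : ∀ i, C1 i ≤ ∑ i, C1 i + ∑ i, ∑ j, C2 i j := fun i =>
    (Finset.single_le_sum (fun i _ => h1 i) (Finset.mem_univ i)).trans
      (le_add_of_nonneg_right (Finset.sum_nonneg fun i _ => Finset.sum_nonneg fun j _ => h2 i j))
  have hl2 : ∀ i j, C2 i j ≤ ∑ i, C1 i + ∑ i, ∑ j, C2 i j := fun i j =>
    ((Finset.single_le_sum (f := fun j => C2 i j) (fun j _ => h2 i j) (Finset.mem_univ j)).trans
      (Finset.single_le_sum (f := fun i => ∑ j, C2 i j)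
        (fun i _ => Finset.sum_nonneg fun j _ => h2 i j) (Finset.mem_univ i))).trans
      (le_add_of_nonneg_left (Finset.sum_nonneg fun i _ => h1 i))
  have e1 : ∀ i, pd i (fun x => b (r⁻¹ • (x - x₀))) = fun x => r⁻¹ * pd i b (r⁻¹ • (x - x₀)) :=
    fun i => pd_comp_scale hb.differentiable _ _ i
  have hsc : Smooth (fun x : Plane => b (r⁻¹ • (x - x₀))) :=
    hb.comp ((contDiff_id.sub contDiff_const).const_smul _)
  have e2 : ∀ i j, pd i (pd j (fun x => b (r⁻¹ • (x - x₀)))) =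
      fun x => r⁻¹ * (r⁻¹ * pd i (pd j b) (r⁻¹ • (x - x₀))) := by
    intro i j
    rw [e1 j, pd_mul (differentiable_const _) _ i, pd_const,
      pd_comp_scale (hb.pd j).differentiable _ _ i]
    · ext x; simp
    · have hlin : Differentiable ℝ fun x : Plane => r⁻¹ • (x - x₀) := by fun_prop
      exact (hb.pd j).differentiable.comp hlin
  have hn : ∀ z : Plane, ‖r⁻¹ • (z - x₀)‖ = dist z x₀ / r := by
    intro z
    rw [norm_smul, Real.norm_eq_abs, abs_of_pos (inv_pos.2 hr), dist_eq_norm]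
    field_simp
  refine ⟨fun x => b (r⁻¹ • (x - x₀)), hsc, fun z => b.nonneg, fun z => b.le_one, ?_, ?_, ?_, ?_⟩
  · intro z hz
    apply b.one_of_mem_closedBall
    rw [mem_closedBall_zero_iff, hn, div_le_iff₀ hr]
    exact hz
  · have : tsupport (fun x => b (r⁻¹ • (x - x₀))) ⊆ Metric.closedBall x₀ ((s + 1) / 2 * r) := by
      refine closure_minimal ?_ Metric.isClosed_closedBall
      intro z hz
      have hz' : r⁻¹ • (z - x₀) ∈ Function.support b := hz
      rw [b.support_eq, mem_ball_zero_iff, hn, div_lt_iff₀ hr] at hz'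
      exact hz'.le
    exact this.trans (Metric.closedBall_subset_ball (by nlinarith))
  · intro i z
    rw [e1 i]
    simp only [abs_mul, abs_of_pos (inv_pos.2 hr)]
    rw [div_eq_inv_mul]
    have := (h1' i (r⁻¹ • (z - x₀))).trans (hl1 i)
    have := inv_pos.2 hr
    gcongr
  · intro i j z
    rw [e2 i j]
    simp only [abs_mul, abs_of_pos (inv_pos.2 hr)]
    rw [div_eq_inv_mul, ← mul_assoc, ← inv_pow, sq]
    have := (h2' i j (r⁻¹ • (z - x₀))).trans (hl2 i j)
    have := inv_pos.2 hr
    gcongr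

lemma abs_le_of_pd_le {f : Plane → ℝ} (hf : Smooth f) {x₀ : Plane} {r c : ℝ} (h0 : f x₀ = 0)
    (hc : ∀ i, ∀ z ∈ Metric.ball x₀ r, |pd i f z| ≤ c) {z : Plane} (hz : z ∈ Metric.ball x₀ r) :
    |f z| ≤ 2 * c * r := by
  have hr : 0 < r := Metric.pos_of_mem_ball hz
  have hx : x₀ ∈ Metric.ball x₀ r := Metric.mem_ball_self hr
  have hcn : 0 ≤ c := (abs_nonneg _).trans (hc 0 x₀ hx)
  have := (convex_ball x₀ r).norm_image_sub_le_of_norm_fderiv_le (𝕜 := ℝ) (f := f) (C := 2 * c)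
    (fun y _ => hf.differentiable y)
    (fun y hy => (norm_fderiv_le f y).trans (by linarith [hc 0 y hy, hc 1 y hy])) hx hz
  rw [h0, sub_zero, Real.norm_eq_abs, ← dist_eq_norm] at this
  have hd : dist z x₀ ≤ r := (Metric.mem_ball.1 hz).le
  exact this.trans (by gcongr)

/-- A smooth function whose derivatives up to order two vanish at a point is small nearby. -/
lemma exists_radius_of_flat {f : Plane → ℝ} (hf : Smooth f) {x₀ : Plane} (h0 : f x₀ = 0)
    (h1 : ∀ i, pd i f x₀ = 0) (h2 : ∀ i j, pd i (pd j f) x₀ = 0) {ε : ℝ} (hε : 0 < ε) :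
    ∃ r₀ > 0, ∀ r, 0 < r → r < r₀ → ∀ z ∈ Metric.ball x₀ r,
      |f z| ≤ ε * r ^ 2 ∧ (∀ i, |pd i f z| ≤ ε * r) ∧ ∀ i j, |pd i (pd j f) z| ≤ ε := by
  -- Each of the two integrations from the centre costs a factor `2 * r`, hence the `4`.
  have ev : ∀ᶠ z in 𝓝 x₀, ∀ i j, |pd i (pd j f) z| < ε / 4 := by
    rw [eventually_all]; intro i
    rw [eventually_all]; intro j
    have hcont : ContinuousAt (fun z => |pd i (pd j f) z|) x₀ :=
      ((hf.pd j).pd i).continuous.abs.continuousAt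
    exact hcont.eventually_lt_const (by simp [h2, hε])
  obtain ⟨r₀, hr₀, hball⟩ := Metric.eventually_nhds_iff_ball.1 ev
  refine ⟨r₀, hr₀, fun r hr hrr z hz => ?_⟩
  have hsub : ∀ y ∈ Metric.ball x₀ r, y ∈ Metric.ball x₀ r₀ :=
    fun y hy => Metric.ball_subset_ball hrr.le hy
  have hp : ∀ i, ∀ y ∈ Metric.ball x₀ r, |pd i f y| ≤ ε / 2 * r := by
    intro i y hy
    have := abs_le_of_pd_le (hf.pd i) (h1 i) (c := ε / 4)
      (fun j y hy => (hball y (hsub y hy) j i).le) hy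
    linarith
  refine ⟨?_, fun i => (hp i z hz).trans (by nlinarith), fun i j => ?_⟩
  · have := abs_le_of_pd_le hf h0 hp hz
    linarith [this]
  · linarith [hball z (hsub z hz) i j]

/-- The second order Taylor polynomial. -/
def taylor (w : Plane → ℝ) (x₀ : Plane) : Plane → ℝ :=
  quad x₀ (w x₀) (pd 0 w x₀) (pd 1 w x₀) (pd 0 (pd 0 w) x₀) (pd 1 (pd 0 w) x₀) (pd 1 (pd 1 w) x₀)

lemma smooth_taylor (w : Plane → ℝ) (x₀ : Plane) : Smooth (taylor w x₀) := smooth_quad _ _ _ _ _ _ _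

lemma hess_taylor (m : ℝ) (w : Plane → ℝ) (x₀ x : Plane) :
    hess m (taylor w x₀) x = hess m w x₀ := by
  rw [taylor, hess_quad]; rfl

lemma exists_radius_taylor {w : Plane → ℝ} (hw : Smooth w) (x₀ : Plane) {ε : ℝ} (hε : 0 < ε) :
    ∃ r₀ > 0, ∀ r, 0 < r → r < r₀ → ∀ z ∈ Metric.ball x₀ r,
      |taylor w x₀ z - w z| ≤ ε * r ^ 2 ∧
      (∀ i, |pd i (fun z => taylor w x₀ z - w z) z| ≤ ε * r) ∧
      ∀ i j, |pd i (pd j (fun z => taylor w x₀ z - w z)) z| ≤ ε := by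
  have ht := smooth_taylor w x₀
  have e1 : ∀ i, pd i (fun z => taylor w x₀ z - w z) = fun z => pd i (taylor w x₀) z - pd i w z :=
    fun i => pd_sub ht.differentiable hw.differentiable i
  have e2 : ∀ i j, pd i (pd j (fun z => taylor w x₀ z - w z)) =
      fun z => pd i (pd j (taylor w x₀)) z - pd i (pd j w) z := by
    intro i j
    rw [e1 j, pd_sub (ht.pd j).differentiable (hw.pd j).differentiable i]
  refine exists_radius_of_flat (ht.sub hw) ?_ ?_ ?_ hε
  · simp [taylor, quad]
  · intro i
    rw [e1 i]
    fin_cases i <;> simp [taylor, pd_zero_quad, pd_one_quad, quad]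
  · intro i j
    rw [e2 i j]
    have hc := congrFun (pd_comm hw 0 1) x₀
    fin_cases i <;> fin_cases j <;> simp [taylor, pd_zero_quad, pd_one_quad, quad, hc]

/-! ### Volume fractions and the local lamination -/

/-- If `F` has mean zero on `Q` and is close to `x q` on `E` and to `-y q` on `E'`, which together
nearly fill `Q`, then `E` fills about the fraction `y / (x + y)` of `Q`. -/
lemma fraction_le_of_mean_zero {F : Plane → ℝ × ℝ × ℝ} {Q E E' : Set Plane}
    (hQ : MeasurableSet Q) (hE : MeasurableSet E) (hE' : MeasurableSet E') (hEQ : E ⊆ Q)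
    (hEQ' : E' ⊆ Q) (hd : Disjoint E E') (hfin : volume Q ≠ ∞) (hF : IntegrableOn F Q)
    (h0 : ∫ z in Q, F z = 0) {x y : ℝ} (hxy : 0 < x * y) {q : ℝ × ℝ × ℝ} (hq : q ≠ 0)
    {L ε δ : ℝ} (hL : ∀ z ∈ Q, ‖F z‖ ≤ L) (hε : 0 ≤ ε)
    (hFE : ∀ z ∈ E, ‖F z - x • q‖ ≤ ε) (hFE' : ∀ z ∈ E', ‖F z + y • q‖ ≤ ε)
    (hδ : volume.real (Q \ (E ∪ E')) ≤ δ * volume.real Q) (hL0 : 0 ≤ L) :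
    (y / (x + y) - (δ + (ε + L * δ) / (‖q‖ * |x + y|))) * volume.real Q ≤ volume.real E := by
  have hb : x + y ≠ 0 := by
    intro h
    have : y = -x := by linarith
    rw [this] at hxy
    nlinarith [sq_nonneg x]
  have hqpos : 0 < ‖q‖ := norm_pos_iff.2 hq
  have hbpos : 0 < |x + y| := abs_pos.2 hb
  have finE : volume E ≠ ∞ := ne_top_of_le_ne_top hfin (measure_mono hEQ)
  have finE' : volume E' ≠ ∞ := ne_top_of_le_ne_top hfin (measure_mono hEQ')
  set V := volume.real Q with hV
  set b := volume.real E with hbdef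
  set c := volume.real E' with hcdef
  set R := Q \ (E ∪ E') with hR
  have hRm : MeasurableSet R := hQ.diff (hE.union hE')
  have hsum : b + c + volume.real R = V := by
    have h1 : volume.real (E ∪ E') = b + c := measureReal_union hd hE' finE finE'
    have h2 := measureReal_sdiff_add_inter (μ := volume) (s := Q) (t := E ∪ E') (hE.union hE') hfin
    rw [Set.inter_eq_right.2 (Set.union_subset hEQ hEQ'), h1] at h2
    linarith
  have hint : ∫ z in Q, F z = (∫ z in E, F z) + (∫ z in E', F z) + ∫ z in R, F z := by
    have hQe : Q = (E ∪ E') ∪ R := by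
      rw [hR, Set.union_sdiff_cancel (Set.union_subset hEQ hEQ')]
    have hdR : Disjoint (E ∪ E') R := Set.disjoint_sdiff_right
    rw [hQe] at hF ⊢
    rw [setIntegral_union hdR hRm (hF.mono_set Set.subset_union_left)
      (hF.mono_set Set.subset_union_right), setIntegral_union hd hE'
      (hF.mono_set (Set.subset_union_left.trans Set.subset_union_left))
      (hF.mono_set (Set.subset_union_right.trans Set.subset_union_left))]
  have iE : IntegrableOn F E := hF.mono_set hEQ
  have iE' : IntegrableOn F E' := hF.mono_set hEQ'
  have i1 : ‖(∫ z in E, F z) - b • (x • q)‖ ≤ ε * b := by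
    have : (∫ z in E, F z) - b • (x • q) = ∫ z in E, (F z - x • q) := by
      rw [integral_sub iE (integrableOn_const finE)]
      simp [hbdef, Measure.real]
    rw [this]
    exact norm_setIntegral_le_of_norm_le_const finE.lt_top hFE
  have i2 : ‖(∫ z in E', F z) + c • (y • q)‖ ≤ ε * c := by
    have : (∫ z in E', F z) + c • (y • q) = ∫ z in E', (F z + y • q) := by
      rw [integral_add iE' (integrableOn_const finE')]
      simp [hcdef, Measure.real]
    rw [this]
    exact norm_setIntegral_le_of_norm_le_const finE'.lt_top hFE'
  have i3 : ‖∫ z in R, F z‖ ≤ L * volume.real R :=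
    norm_setIntegral_le_of_norm_le_const
      (ne_top_of_le_ne_top hfin (measure_mono Set.sdiff_subset)).lt_top
      (fun z hz => hL z hz.1)
  have hmain : |b * x - c * y| * ‖q‖ ≤ (ε + L * δ) * V := by
    have e : (b * x - c * y) • q = -(((∫ z in E, F z) - b • (x • q)) +
        ((∫ z in E', F z) + c • (y • q)) + ∫ z in R, F z) := by
      have := hint.symm.trans h0
      have h3 : ∫ z in R, F z = -(∫ z in E, F z) - ∫ z in E', F z := by
        rw [eq_sub_iff_add_eq, eq_neg_iff_add_eq_zero, ← this]; abel
      rw [h3, smul_smul, smul_smul, sub_smul]; abel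
    calc |b * x - c * y| * ‖q‖ = ‖(b * x - c * y) • q‖ := by rw [norm_smul, Real.norm_eq_abs]
      _ ≤ ε * b + ε * c + L * volume.real R := by
          rw [e, norm_neg]
          exact (norm_add_le _ _).trans (add_le_add ((norm_add_le _ _).trans (add_le_add i1 i2)) i3)
      _ ≤ ε * V + L * (δ * V) := by
          have hR0 : 0 ≤ volume.real R := measureReal_nonneg
          have : ε * b + ε * c ≤ ε * V := by nlinarith
          have : L * volume.real R ≤ L * (δ * V) := by gcongr
          linarith
      _ = _ := by ring
  -- This solves `b + c = V - volume.real R` for `b` in terms of `b * x - c * y`, which the zero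
  -- mean has shown to be small.
  have hb' : b = y / (x + y) * V - y / (x + y) * volume.real R + (b * x - c * y) / (x + y) := by
    have : c = V - volume.real R - b := by linarith
    rw [this]
    field_simp
    ring
  have hlam : 0 ≤ y / (x + y) ∧ y / (x + y) ≤ 1 := by
    have h1 : y / (x + y) = (x * y + y ^ 2) / (x + y) ^ 2 := by field_simp
    have h2 : 1 - y / (x + y) = (x * y + x ^ 2) / (x + y) ^ 2 := by field_simp; ring
    have h3 : 0 ≤ 1 - y / (x + y) := by rw [h2]; positivity
    exact ⟨by rw [h1]; positivity, by linarith⟩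
  have hq1 : |(b * x - c * y) / (x + y)| ≤ (ε + L * δ) / (‖q‖ * |x + y|) * V := by
    rw [abs_div, div_mul_eq_mul_div, div_le_div_iff₀ hbpos (by positivity)]
    calc |b * x - c * y| * (‖q‖ * |x + y|) = (|b * x - c * y| * ‖q‖) * |x + y| := by ring
      _ ≤ _ := by gcongr
  have hq2 := neg_le_of_abs_le hq1
  have hR0 : 0 ≤ volume.real R := measureReal_nonneg
  have hq3 : y / (x + y) * volume.real R ≤ δ * V := by nlinarith [hlam.1, hlam.2]
  rw [hb']
  nlinarith

/-- The second derivatives, in the sense of `hess`, of a function of `n 0 * x 0 + n 1 * x 1` with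
unit second derivative. -/
def rankOne (m : ℝ) (n : Fin 2 → ℝ) : ℝ × ℝ × ℝ := (n 0 ^ 2, n 0 * n 1, m * n 1 ^ 2)

/-- The product rule for second derivatives, with the terms of lower order as an error. -/
lemma abs_pd_pd_mul_sub_le {χ k : Plane → ℝ} (hχ : Smooth χ) (hk : Smooth k) {z : Plane}
    {C r ε : ℝ} (hr : 0 < r) (h1 : ∀ i, |pd i χ z| ≤ C / r)
    (h2 : ∀ i j, |pd i (pd j χ) z| ≤ C / r ^ 2) (k0 : |k z| ≤ ε * r ^ 2)
    (k1 : ∀ i, |pd i k z| ≤ ε * r) (i j : Fin 2) :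
    |pd i (pd j (fun z => χ z * k z)) z - χ z * pd i (pd j k) z| ≤ 3 * C * ε := by
  have e : pd i (pd j (fun z => χ z * k z)) z - χ z * pd i (pd j k) z =
      pd i (pd j χ) z * k z + pd j χ z * pd i k z + pd i χ z * pd j k z := by
    rw [pd_mul hχ.differentiable hk.differentiable j,
      pd_add (Smooth.differentiable ((hχ.pd j).mul hk)) (Smooth.differentiable (hχ.mul (hk.pd j))) i,
      pd_mul (hχ.pd j).differentiable hk.differentiable i,
      pd_mul hχ.differentiable (hk.pd j).differentiable i]
    ring
  have hC : 0 ≤ C / r := (abs_nonneg _).trans (h1 0)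
  have hC2 : 0 ≤ C / r ^ 2 := (abs_nonneg _).trans (h2 0 0)
  rw [e]
  calc _ ≤ |pd i (pd j χ) z| * |k z| + |pd j χ z| * |pd i k z| + |pd i χ z| * |pd j k z| := by
        simp only [← abs_mul]
        exact (abs_add_le _ _).trans (add_le_add_left (abs_add_le _ _) _)
    _ ≤ C / r ^ 2 * (ε * r ^ 2) + C / r * (ε * r) + C / r * (ε * r) := by
        gcongr
        · exact h2 i j
        · exact h1 j
        · exact k1 i
        · exact h1 i
        · exact k1 j
    _ = _ := by field_simp; ring

lemma norm_triple_le {a b c e : ℝ} (m : ℝ) (he : 0 ≤ e) (ha : |a| ≤ e) (hb : |b| ≤ e)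
    (hc : |c| ≤ e) : ‖((a, b, m * c) : ℝ × ℝ × ℝ)‖ ≤ (1 + |m|) * e := by
  have hm := abs_nonneg m
  simp only [Prod.norm_def, Real.norm_eq_abs, abs_mul, max_le_iff]
  refine ⟨by nlinarith, by nlinarith, ?_⟩
  have : |m| * |c| ≤ |m| * e := by gcongr
  nlinarith

lemma pd_pd_comp_linear {g : ℝ → ℝ} (hg : ContDiff ℝ ((⊤ : ℕ∞) : WithTop ℕ∞) g)
    (n c : Fin 2 → ℝ) (i j : Fin 2) :
    pd i (pd j (fun x : Plane => g (n 0 * (x 0 - c 0) + n 1 * (x 1 - c 1)))) =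
      fun x => n j * (n i * deriv (deriv g) (n 0 * (x 0 - c 0) + n 1 * (x 1 - c 1))) := by
  obtain ⟨h1, h2⟩ := contDiff_infty_iff_deriv.1 hg
  obtain ⟨h3, -⟩ := contDiff_infty_iff_deriv.1 h2
  rw [pd_comp_linear h1 n c j, pd_mul (differentiable_const _) _ i, pd_const,
    pd_comp_linear h3 n c i]
  · ext x; simp
  · have hlin : Differentiable ℝ fun x : Plane => n 0 * (x 0 - c 0) + n 1 * (x 1 - c 1) := by
      have h0 := (smooth_coord 0).differentiable
      have h1 := (smooth_coord 1).differentiable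
      fun_prop
    exact h3.comp hlin

/-- Derivatives of compactly supported functions integrate to zero. This alone fixes the volume
fractions of a lamination, so the level sets of the oscillation never have to be measured
separately. -/
lemma integral_hess_eq_zero {m : ℝ} {h : Plane → ℝ} (hh : Smooth h) (hc : HasCompactSupport h) :
    ∫ z, hess m h z = 0 := by
  have c1 : ∀ i, ContDiff ℝ 1 (pd i h) := fun i => (hh.pd i).of_le (by exact_mod_cast le_top)
  have z : ∀ i j, ∫ z, pd i (pd j h) z = 0 := fun i j =>
    integral_pd_eq_zero (c1 j) (hasCompactSupport_pd hc j) i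
  have hi : ∀ i j, Integrable (pd i (pd j h)) := fun i j =>
    ((hh.pd j).pd i).continuous.integrable_of_hasCompactSupport
      (hasCompactSupport_pd (hasCompactSupport_pd hc j) i)
  have : ∫ z, hess m h z = (∫ z, pd 0 (pd 0 h) z, ∫ z, pd 1 (pd 0 h) z, ∫ z, m * pd 1 (pd 1 h) z) := by
    simp only [hess]
    rw [integral_pair (hi 0 0) ((hi 1 0).prodMk ((hi 1 1).const_mul m)),
      integral_pair (hi 1 0) ((hi 1 1).const_mul m)]
  rw [this, integral_const_mul, z, z, z]
  simp

lemma volume_real_ball_ge (x₀ : Plane) {r s : ℝ} (hs : 0 < s) :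
    (1 - 2 * s) * volume.real (Metric.closedBall x₀ r) ≤ volume.real (Metric.ball x₀ ((1 - s) * r))
      := by
  rcases le_or_gt 1 s with h | h
  · have : (1 - 2 * s) * volume.real (Metric.closedBall x₀ r) ≤ 0 :=
      mul_nonpos_of_nonpos_of_nonneg (by linarith) measureReal_nonneg
    exact this.trans measureReal_nonneg
  · have h1 : volume (Metric.ball x₀ ((1 - s) * r)) =
        ENNReal.ofReal ((1 - s) ^ 2) * volume (Metric.ball x₀ r) := by
      rw [Measure.addHaar_ball_mul_of_pos (volume : Measure Plane) x₀ (by linarith : 0 < 1 - s) r,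
        finrank_euclideanSpace_fin, Measure.addHaar_ball_center volume x₀ r]
    have h2 : volume.real (Metric.ball x₀ ((1 - s) * r)) =
        (1 - s) ^ 2 * volume.real (Metric.closedBall x₀ r) := by
      rw [Measure.real, h1, ENNReal.toReal_mul, ENNReal.toReal_ofReal (by positivity),
        Measure.real, Measure.addHaar_closedBall_eq_addHaar_ball]
    rw [h2]
    have : 0 ≤ volume.real (Metric.closedBall x₀ r) := measureReal_nonneg
    have : 1 - 2 * s ≤ (1 - s) ^ 2 := by nlinarith
    gcongr

set_option maxHeartbeats 1600000 in
/-- A smooth function can be perturbed inside any small ball around `x₀` so that on most of the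
ball its second derivatives take only the two values `A + x q` and `A - y q`, where `A` is the
value at `x₀` and `q` a rank one direction, with the volume fractions required by the mean. -/
theorem exists_local_lamination (m : ℝ) {w : Plane → ℝ} (hw : Smooth w) (x₀ : Plane)
    {n : Fin 2 → ℝ} (hn : ∀ i, |n i| ≤ 1) (hq : rankOne m n ≠ 0) {x y : ℝ} (hxy : 0 < x * y)
    {η : ℝ} (hη : 0 < η) :
    ∃ r₀ > 0, ∀ r, 0 < r → r < r₀ → ∃ h : Plane → ℝ, Smooth h ∧ tsupport h ⊆ Metric.ball x₀ r ∧
      (∀ z, |pd 0 h z| ≤ η) ∧ (∀ z, ‖hess m h z‖ ≤ max |x| |y| * ‖rankOne m n‖ + η) ∧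
      ∃ E E' : Set Plane, MeasurableSet E ∧ MeasurableSet E' ∧ Disjoint E E' ∧
        E ⊆ Metric.closedBall x₀ r ∧ E' ⊆ Metric.closedBall x₀ r ∧
        (∀ z ∈ E, hess m w z + hess m h z = hess m w x₀ + x • rankOne m n) ∧
        (∀ z ∈ E', hess m w z + hess m h z = hess m w x₀ - y • rankOne m n) ∧
        (y / (x + y) - η) * volume.real (Metric.closedBall x₀ r) ≤ volume.real E ∧
        (x / (x + y) - η) * volume.real (Metric.closedBall x₀ r) ≤ volume.real E' := by
  have hb : x + y ≠ 0 := by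
    intro h
    have : y = -x := by linarith
    rw [this] at hxy
    nlinarith [sq_nonneg x]
  set q := rankOne m n with hqdef
  have hqpos : 0 < ‖q‖ := norm_pos_iff.2 hq
  set L := max |x| |y| * ‖q‖ + 1 with hL
  have hL0 : 0 < L := by positivity
  set D := ‖q‖ * |x + y| with hD
  have hDpos : 0 < D := mul_pos hqpos (abs_pos.2 hb)
  -- With both errors in `fraction_le_of_mean_zero` equal to `e`, the total loss in the volume
  -- fraction is `e + (e + L * e) / D ≤ η`.
  set e := min η 1 / (1 + (1 + L) / D) with he
  have hden : 1 ≤ 1 + (1 + L) / D := by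
    have : 0 ≤ (1 + L) / D := by positivity
    linarith
  have hmin : 0 < min η 1 := lt_min hη one_pos
  have epos : 0 < e := by positivity
  have e_le : e ≤ min η 1 := div_le_self hmin.le hden
  have eη : e ≤ η := e_le.trans (min_le_left _ _)
  have e1 : e ≤ 1 := e_le.trans (min_le_right _ _)
  have eD : e + (e + L * e) / D ≤ η := by
    have : e + (e + L * e) / D = e * (1 + (1 + L) / D) := by field_simp
    rw [this, he, div_mul_cancel₀ _ (by positivity)]
    exact min_le_left _ _
  -- The shell where the cutoff is not known to be one then takes at most the fraction `e / 2` of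
  -- the ball. The other `e / 2` is left for the transition zone of the oscillation.
  obtain ⟨C, hC0, hcut⟩ := exists_cutoff (s := 1 - e / 4) (by linarith) (by linarith)
  -- Small enough to absorb the Taylor remainder together with the terms in which a derivative falls
  -- on the cutoff, which contribute `6 * C * ε₀`.
  set ε₀ := e / ((1 + |m|) * (2 + 6 * C)) with hε₀
  have hm0 : 0 ≤ |m| := abs_nonneg m
  have ε₀pos : 0 < ε₀ := by positivity
  have ε₀e : (1 + |m|) * (ε₀ + 6 * C * ε₀) ≤ e := by
    have : (1 + |m|) * (2 * ε₀ + 6 * C * ε₀) = e := by rw [hε₀]; field_simp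
    nlinarith
  have ε₀e' : (2 * C + 2) * ε₀ ≤ η := by
    have : (1 + |m|) * (2 * ε₀ + 6 * C * ε₀) = e := by rw [hε₀]; field_simp
    have h3 : 2 * ε₀ + 6 * C * ε₀ ≤ (1 + |m|) * (2 * ε₀ + 6 * C * ε₀) :=
      le_mul_of_one_le_left (by positivity) (by linarith)
    nlinarith [mul_nonneg hC0 ε₀pos.le]
  have ε₀e'' : (1 + |m|) * ε₀ ≤ e := by
    have : 0 ≤ (1 + |m|) * (6 * C * ε₀) := by positivity
    nlinarith
  obtain ⟨r₁, hr₁, htay⟩ := exists_radius_taylor hw x₀ ε₀pos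
  -- A radius below `1 / 2` keeps the linear form within `[-1, 1]`, where the oscillation is
  -- controlled, and gives `r ^ 2 ≤ r`.
  refine ⟨min r₁ (1 / 2), by positivity, fun r hr hrr => ?_⟩
  have hrr1 : r < r₁ := hrr.trans_le (min_le_left _ _)
  have hr2 : r < 1 / 2 := hrr.trans_le (min_le_right _ _)
  specialize htay r hr hrr1
  obtain ⟨χ, hχ, χ0, χ1, χin, χsupp, χd1, χd2⟩ := hcut x₀ r hr
  set Q := Metric.closedBall x₀ r with hQ
  set V := volume.real Q with hV
  have hQfin : volume Q ≠ ∞ := measure_closedBall_lt_top.ne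
  have hVpos : 0 < V := ENNReal.toReal_pos (Metric.measure_closedBall_pos volume x₀ hr).ne' hQfin
  let lin : Plane → ℝ := fun z => n 0 * (z 0 - x₀ 0) + n 1 * (z 1 - x₀ 1)
  have hlin : Smooth lin := by
    have h0 := smooth_coord 0
    have h1 := smooth_coord 1
    simp only [lin]
    unfold Smooth
    fun_prop
  -- The push-forward turns the smallness of the transition zone on the line into smallness of its
  -- area in the ball.
  let ν : Measure ℝ := (volume.restrict Q).map lin
  have : IsFiniteMeasure (volume.restrict Q) := ⟨by simpa using measure_closedBall_lt_top⟩
  obtain ⟨g, hg, hg0, hg1, hg2, hgν⟩ := exists_oscillation ν hxy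
    (ε := min (ε₀ * r ^ 2) (e / 2 * V)) (by positivity)
  have hlinb : ∀ z ∈ Metric.ball x₀ r, |lin z| ≤ 1 := by
    intro z hz
    have hd : ‖z - x₀‖ < r := by rw [← dist_eq_norm]; exact hz
    have h0 : |z 0 - x₀ 0| ≤ ‖z - x₀‖ := by simpa using PiLp.norm_apply_le (z - x₀) 0
    have h1 : |z 1 - x₀ 1| ≤ ‖z - x₀‖ := by simpa using PiLp.norm_apply_le (z - x₀) 1
    calc |lin z| ≤ |n 0| * |z 0 - x₀ 0| + |n 1| * |z 1 - x₀ 1| := by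
          rw [← abs_mul, ← abs_mul]; exact abs_add_le _ _
      _ ≤ 1 * ‖z - x₀‖ + 1 * ‖z - x₀‖ := by
          gcongr
          · exact hn 0
          · exact hn 1
      _ ≤ 1 := by linarith
  set f : Plane → ℝ := fun z => taylor w x₀ z - w z with hf
  have hfs : Smooth f := (smooth_taylor w x₀).sub hw
  let o : Plane → ℝ := fun z => g (lin z)
  have hos : Smooth o := hg.comp hlin
  have ho1 : ∀ i, pd i o = fun z => n i * deriv g (lin z) := fun i =>
    pd_comp_linear (contDiff_infty_iff_deriv.1 hg).1 n x₀ i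
  have ho2 : ∀ i j, pd i (pd j o) = fun z => n j * (n i * deriv (deriv g) (lin z)) := fun i j =>
    pd_pd_comp_linear hg n x₀ i j
  have hoH : ∀ z, hess m o z = deriv (deriv g) (lin z) • q := by
    intro z
    simp only [hess, ho2, hqdef, rankOne, Prod.smul_mk, smul_eq_mul]
    refine Prod.ext ?_ (Prod.ext ?_ ?_) <;> simp <;> ring
  let k : Plane → ℝ := fun z => f z + o z
  have hks : Smooth k := hfs.add hos
  have hkH : ∀ z, hess m k z = hess m f z + deriv (deriv g) (lin z) • q := by
    intro z
    rw [← hoH z]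
    exact congrFun (hess_add hfs hos) z
  have hk0 : ∀ z ∈ Metric.ball x₀ r, |k z| ≤ 2 * ε₀ * r ^ 2 := by
    intro z hz
    have h1 := (htay z hz).1
    have h2 := (hg0 (lin z) (hlinb z hz)).trans (min_le_left _ _)
    calc |k z| ≤ |f z| + |o z| := abs_add_le _ _
      _ ≤ ε₀ * r ^ 2 + ε₀ * r ^ 2 := add_le_add h1 h2
      _ = _ := by ring
  have hk1 : ∀ z ∈ Metric.ball x₀ r, ∀ i, |pd i k z| ≤ 2 * ε₀ * r := by
    intro z hz i
    have h1 := (htay z hz).2.1 i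
    have h2 : |pd i o z| ≤ ε₀ * r := by
      rw [ho1 i]
      simp only [abs_mul]
      have h3 := (hg1 (lin z) (hlinb z hz)).trans (min_le_left _ _)
      calc |n i| * |deriv g (lin z)| ≤ 1 * (ε₀ * r ^ 2) := by
            gcongr
            exact hn i
        _ ≤ ε₀ * r := by nlinarith [mul_pos ε₀pos hr]
    have h3 : pd i k z = pd i f z + pd i o z :=
      congrFun (pd_add hfs.differentiable hos.differentiable i) z
    rw [h3]
    calc _ ≤ |pd i f z| + |pd i o z| := abs_add_le _ _
      _ ≤ ε₀ * r + ε₀ * r := add_le_add h1 h2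
      _ = _ := by ring
  -- Where `χ` is one, `w + h` is the Taylor polynomial of `w` at `x₀` plus the oscillation `o`.
  -- Replacing `w` by a polynomial with constant second derivatives is what makes the two values
  -- exact.
  let h : Plane → ℝ := fun z => χ z * k z
  have hhs : Smooth h := hχ.mul hks
  have hsupp : tsupport h ⊆ Metric.ball x₀ r := (tsupport_mul_subset_left).trans χsupp
  have hcomp : HasCompactSupport h :=
    HasCompactSupport.of_support_subset_isCompact (isCompact_closedBall x₀ r)
      ((subset_tsupport h).trans (hsupp.trans Metric.ball_subset_closedBall))
  have hfH : ∀ z ∈ Metric.ball x₀ r, ‖hess m f z‖ ≤ (1 + |m|) * ε₀ := by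
    intro z hz
    have h2 := (htay z hz).2.2
    exact norm_triple_le m ε₀pos.le (h2 0 0) (h2 1 0) (h2 1 1)
  have hhH : ∀ z, ‖hess m h z‖ ≤ max |x| |y| * ‖q‖ + e := by
    intro z
    by_cases hz : z ∈ Metric.ball x₀ r
    · have key := abs_pd_pd_mul_sub_le hχ hks hr (fun i => χd1 i z) (fun i j => χd2 i j z)
        (hk0 z hz) (hk1 z hz)
      have h1 : ‖hess m h z - χ z • hess m k z‖ ≤ (1 + |m|) * (3 * C * (2 * ε₀)) := by
        have : hess m h z - χ z • hess m k z =
            (pd 0 (pd 0 h) z - χ z * pd 0 (pd 0 k) z, pd 1 (pd 0 h) z - χ z * pd 1 (pd 0 k) z,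
              m * (pd 1 (pd 1 h) z - χ z * pd 1 (pd 1 k) z)) := by
          simp only [hess, Prod.smul_mk, Prod.mk_sub_mk, smul_eq_mul]
          ring_nf
        rw [this]
        exact norm_triple_le m (by positivity) (key 0 0) (key 1 0) (key 1 1)
      have h2 : ‖χ z • hess m k z‖ ≤ (1 + |m|) * ε₀ + max |x| |y| * ‖q‖ := by
        rw [norm_smul, Real.norm_eq_abs, abs_of_nonneg (χ0 z)]
        refine (mul_le_of_le_one_left (norm_nonneg _) (χ1 z)).trans ?_
        rw [hkH z]
        refine (norm_add_le _ _).trans (add_le_add (hfH z hz) ?_)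
        rw [norm_smul]
        have := hg2 (lin z)
        gcongr
        exact this
      calc ‖hess m h z‖ = ‖(hess m h z - χ z • hess m k z) + χ z • hess m k z‖ := by
            rw [sub_add_cancel]
        _ ≤ _ := norm_add_le _ _
        _ ≤ _ := add_le_add h1 h2
        _ ≤ _ := by nlinarith
    · rw [hess_eq_zero_of_notMem (fun hz' => hz (hsupp hz')), norm_zero]
      positivity
  -- where the cutoff function is one
  have hin : ∀ z ∈ Metric.ball x₀ ((1 - e / 4) * r), hess m h z = hess m k z := by
    intro z hz
    have hev : ∀ᶠ z' in 𝓝 z, h z' = k z' := by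
      filter_upwards [Metric.isOpen_ball.mem_nhds hz] with z' hz'
      simp only [h]
      rw [χin z' (Metric.ball_subset_closedBall hz'), one_mul]
    have hpd : ∀ (a b : Plane → ℝ) (z : Plane), a =ᶠ[𝓝 z] b → ∀ i, pd i a =ᶠ[𝓝 z] pd i b := by
      intro a b z hab i
      filter_upwards [hab.fderiv (𝕜 := ℝ)] with y hy
      simp only [pd, hy]
    have h00 := (hpd _ _ z (hpd _ _ z hev 0) 0).eq_of_nhds
    have h10 := (hpd _ _ z (hpd _ _ z hev 0) 1).eq_of_nhds
    have h11 := (hpd _ _ z (hpd _ _ z hev 1) 1).eq_of_nhds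
    simp only [hess, h00, h10, h11]
  have hwf : ∀ z, hess m w z + hess m f z = hess m w x₀ := by
    intro z
    rw [← hess_taylor m w x₀ z]
    have : taylor w x₀ = fun z => w z + f z := by ext z; simp [hf]
    rw [this]
    exact (congrFun (hess_add hw hfs) z).symm
  have hsum : ∀ z ∈ Metric.ball x₀ ((1 - e / 4) * r),
      hess m w z + hess m h z = hess m w x₀ + deriv (deriv g) (lin z) • q := by
    intro z hz
    rw [hin z hz, hkH z, ← hwf z, add_assoc]
  have hgc : Continuous fun z => deriv (deriv g) (lin z) := by
    have := (contDiff_infty_iff_deriv.1 (contDiff_infty_iff_deriv.1 hg).2).2.continuous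
    exact this.comp hlin.continuous
  have hsubQ : Metric.ball x₀ ((1 - e / 4) * r) ⊆ Metric.ball x₀ r :=
    Metric.ball_subset_ball (by nlinarith)
  set E := Metric.ball x₀ ((1 - e / 4) * r) ∩ {z | deriv (deriv g) (lin z) = x} with hE
  set E' := Metric.ball x₀ ((1 - e / 4) * r) ∩ {z | deriv (deriv g) (lin z) = -y} with hE'
  have hEm : MeasurableSet E :=
    measurableSet_ball.inter (isClosed_eq hgc continuous_const).measurableSet
  have hEm' : MeasurableSet E' :=
    measurableSet_ball.inter (isClosed_eq hgc continuous_const).measurableSet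
  have hdisj : Disjoint E E' := by
    rw [Set.disjoint_left]
    rintro z ⟨-, hz⟩ ⟨-, hz'⟩
    have h1 : deriv (deriv g) (lin z) = x := hz
    have h2 : deriv (deriv g) (lin z) = -y := hz'
    exact hb (by linarith)
  have hEQ : E ⊆ Q := Set.inter_subset_left.trans (hsubQ.trans Metric.ball_subset_closedBall)
  have hEQ' : E' ⊆ Q := Set.inter_subset_left.trans (hsubQ.trans Metric.ball_subset_closedBall)
  have hbad : volume.real (Q \ (E ∪ E')) ≤ e * V := by
    set N := Q ∩ lin ⁻¹' {t | deriv (deriv g) t ≠ x ∧ deriv (deriv g) t ≠ -y} with hN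
    have hcov : Q \ (E ∪ E') ⊆ (Q \ Metric.ball x₀ ((1 - e / 4) * r)) ∪ N := by
      rintro z ⟨hzQ, hz⟩
      by_cases hzb : z ∈ Metric.ball x₀ ((1 - e / 4) * r)
      · right
        refine ⟨hzQ, fun hx => hz (Or.inl ⟨hzb, hx⟩), fun hx => hz (Or.inr ⟨hzb, hx⟩)⟩
      · exact Or.inl ⟨hzQ, hzb⟩
    have hNm : MeasurableSet {t | deriv (deriv g) t ≠ x ∧ deriv (deriv g) t ≠ -y} := by
      have := (contDiff_infty_iff_deriv.1 (contDiff_infty_iff_deriv.1 hg).2).2.continuous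
      exact ((isOpen_ne_fun this continuous_const).inter
        (isOpen_ne_fun this continuous_const)).measurableSet
    have hNv : volume.real N ≤ e / 2 * V := by
      have h1 : ν {t | deriv (deriv g) t ≠ x ∧ deriv (deriv g) t ≠ -y} = volume N := by
        rw [Measure.map_apply hlin.continuous.measurable hNm, Measure.restrict_apply
          (hlin.continuous.measurable hNm), Set.inter_comm]
      rw [h1] at hgν
      exact (ENNReal.toReal_le_of_le_ofReal (by positivity) hgν).trans (min_le_right _ _)
    have hA : volume.real (Q \ Metric.ball x₀ ((1 - e / 4) * r)) ≤ e / 2 * V := by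
      have h1 := measureReal_sdiff_add_inter (μ := volume) (s := Q)
        (t := Metric.ball x₀ ((1 - e / 4) * r)) measurableSet_ball hQfin
      rw [Set.inter_eq_right.2 (hsubQ.trans Metric.ball_subset_closedBall)] at h1
      have h2 := volume_real_ball_ge x₀ (r := r) (s := e / 4) (by positivity)
      change (1 - 2 * (e / 4)) * V ≤ _ at h2
      have : volume.real Q = V := rfl
      linarith
    have hfinU : volume ((Q \ Metric.ball x₀ ((1 - e / 4) * r)) ∪ N) ≠ ∞ :=
      ne_top_of_le_ne_top hQfin
        (measure_mono (Set.union_subset Set.sdiff_subset Set.inter_subset_left))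
    calc volume.real (Q \ (E ∪ E')) ≤ volume.real ((Q \ Metric.ball x₀ ((1 - e / 4) * r)) ∪ N) :=
          measureReal_mono hcov hfinU
      _ ≤ _ := measureReal_union_le _ _
      _ ≤ e / 2 * V + e / 2 * V := add_le_add hA hNv
      _ = _ := by ring
  have hEv : ∀ z ∈ E, hess m w z + hess m h z = hess m w x₀ + x • q := by
    rintro z ⟨hz, hx⟩
    rw [hsum z hz, show deriv (deriv g) (lin z) = x from hx]
  have hEv' : ∀ z ∈ E', hess m w z + hess m h z = hess m w x₀ - y • q := by
    rintro z ⟨hz, hx⟩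
    rw [hsum z hz, show deriv (deriv g) (lin z) = -y from hx, neg_smul, sub_eq_add_neg]
  have hint : IntegrableOn (hess m h) Q :=
    ((continuous_hess hhs).continuousOn).integrableOn_compact (isCompact_closedBall x₀ r)
  have hmean : ∫ z in Q, hess m h z = 0 := by
    rw [setIntegral_eq_integral_of_forall_compl_eq_zero, integral_hess_eq_zero hhs hcomp]
    intro z hz
    exact hess_eq_zero_of_notMem (fun hz' => hz (Metric.ball_subset_closedBall (hsupp hz')))
  have hFE : ∀ z ∈ E, ‖hess m h z - x • q‖ ≤ e := by
    intro z hz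
    have h1 : hess m h z - x • q = hess m f z := by
      have h2 := hEv z hz
      rw [← hwf z, add_assoc] at h2
      rw [add_left_cancel h2, add_sub_cancel_right]
    rw [h1]
    exact (hfH z (hsubQ hz.1)).trans ε₀e''
  have hFE' : ∀ z ∈ E', ‖hess m h z + y • q‖ ≤ e := by
    intro z hz
    have h1 : hess m h z + y • q = hess m f z := by
      have h2 := hEv' z hz
      rw [← hwf z, add_sub_assoc] at h2
      rw [add_left_cancel h2, sub_add_cancel]
    rw [h1]
    exact (hfH z (hsubQ hz.1)).trans ε₀e''
  have hLb : ∀ z ∈ Q, ‖hess m h z‖ ≤ L := fun z _ => (hhH z).trans (by linarith)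
  refine ⟨h, hhs, hsupp, ?_, fun z => (hhH z).trans (by linarith), E, E', hEm, hEm', hdisj, hEQ,
    hEQ', hEv, hEv', ?_, ?_⟩
  · intro z
    by_cases hz : z ∈ Metric.ball x₀ r
    · have e1 : pd 0 h z = pd 0 χ z * k z + χ z * pd 0 k z :=
        congrFun (pd_mul hχ.differentiable hks.differentiable 0) z
      rw [e1]
      calc _ ≤ |pd 0 χ z| * |k z| + |χ z| * |pd 0 k z| := by
            rw [← abs_mul, ← abs_mul]; exact abs_add_le _ _
        _ ≤ C / r * (2 * ε₀ * r ^ 2) + 1 * (2 * ε₀ * r) := by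
            gcongr
            · exact χd1 0 z
            · exact hk0 z hz
            · rw [abs_of_nonneg (χ0 z)]; exact χ1 z
            · exact hk1 z hz 0
        _ = (2 * C + 2) * ε₀ * r := by field_simp
        _ ≤ (2 * C + 2) * ε₀ * 1 := by gcongr; linarith
        _ ≤ η := by linarith
    · rw [pd_eq_zero_of_notMem (fun hz' => hz (hsupp hz')), abs_zero]
      exact hη.le
  · have := fraction_le_of_mean_zero measurableSet_closedBall hEm hEm' hEQ hEQ' hdisj hQfin hint
      hmean hxy hq hLb epos.le hFE hFE' hbad hL0.le
    refine le_trans ?_ this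
    gcongr
  -- The same estimate with the two sets exchanged, that is, with `x` and `y` exchanged and `q`
  -- replaced by `-q`.
  · have := fraction_le_of_mean_zero measurableSet_closedBall hEm' hEm hEQ' hEQ hdisj.symm hQfin
      hint hmean (x := y) (y := x) (by linarith) (q := -q) (neg_ne_zero.2 hq) hLb epos.le
      (by simpa [smul_neg] using hFE') (by simpa [smul_neg, ← sub_eq_add_neg] using hFE)
      (by rwa [Set.union_comm]) hL0.le
    refine le_trans ?_ this
    rw [norm_neg, add_comm y x]
    gcongr

/-! ### The staircase laminate -/

/-- The second derivatives for which the equation holds with one of the two phases. -/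
def phaseSet (K : ℝ) : Set (ℝ × ℝ × ℝ) :=
  {A | A.2.2 = -(K * A.1) ∨ (K * A.2.2 = -A.1 ∧ A.2.1 = 0)}

/-- The two rays along which the staircase laminate climbs. -/
def stairSet (ρ : ℝ) : Set (ℝ × ℝ × ℝ) :=
  {A | A.2.1 = 0 ∧ (A.2.2 = ρ * A.1 ∨ A.1 = ρ * A.2.2)}

open Classical in
/-- A functional that decreases on average along the splittings of `exists_split`. -/
def cost (K ρ p M N : ℝ) (A : ℝ × ℝ × ℝ) : ℝ :=
  if A ∈ phaseSet K then 0 else if A ∈ stairSet ρ then ‖A‖ ^ p else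
    if A.2.1 = 0 then M * ‖A‖ ^ p else N * ‖A‖ ^ p

open Classical in
/-- A functional that increases on average along the splittings of `exists_split`. -/
def gain (K ρ q : ℝ) (A : ℝ × ℝ × ℝ) : ℝ :=
  if A ∈ phaseSet K then 0 else if A ∈ stairSet ρ then ‖A‖ ^ q else 0

/-- The volume fraction kept in one step of the staircase. -/
def keep (K ρ : ℝ) : ℝ := (K + ρ) / (ρ * (K * ρ + 1))

lemma norm_triple (a b d : ℝ) : ‖((a, b, d) : ℝ × ℝ × ℝ)‖ = max |a| (max |b| |d|) := rfl

/-- Only the product is assumed positive, so both numbers may be negative. This lets one formula for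
a splitting serve both signs of the entries of `A`. -/
lemma weight_mem {x y : ℝ} (h : 0 < x * y) : 0 < x / (x + y) ∧ x / (x + y) ≤ 1 := by
  have hb : x + y ≠ 0 := by
    intro h'
    have : y = -x := by linarith
    rw [this] at h
    nlinarith [sq_nonneg x]
  have h1 : x / (x + y) = (x * y + x ^ 2) / (x + y) ^ 2 := by field_simp; ring
  have h2 : 1 - x / (x + y) = (x * y + y ^ 2) / (x + y) ^ 2 := by field_simp; ring
  have h3 : 0 ≤ 1 - x / (x + y) := by rw [h2]; positivity
  exact ⟨by rw [h1]; positivity, by linarith⟩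

/-- The constants for which the staircase construction works. -/
structure StairParams (K m ρ p q κ κ' M N C : ℝ) : Prop where
  hK : 1 < K
  hm : 0 < m
  hρ : 1 < ρ
  hp : 1 ≤ p
  hκ0 : 0 < κ
  hκ : κ < 1
  hκ' : 1 < κ'
  keep_p : keep K ρ * ρ ^ p ≤ κ
  keep_q : κ' ≤ keep K ρ * ρ ^ q
  hM1 : 1 ≤ M
  hM : ρ ^ p ≤ κ * M
  hN1 : 1 ≤ N
  hN : M * (2 + m) ^ p ≤ κ * N
  hC : K + ρ ^ 2 + 1 + m ≤ C
  hC' : (1 + K) * (1 + m) ≤ C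

lemma phase_of_fst {K a b d : ℝ} (h : d = -(K * a)) : (a, b, d) ∈ phaseSet K := Or.inl h

lemma phase_of_snd {K a d : ℝ} (h : K * d = -a) : (a, 0, d) ∈ phaseSet K := Or.inr ⟨h, rfl⟩

lemma cost_nonneg {K ρ p M N : ℝ} (hM : 0 ≤ M) (hN : 0 ≤ N) (A : ℝ × ℝ × ℝ) :
    0 ≤ cost K ρ p M N A := by
  unfold cost
  split_ifs <;> positivity

lemma gain_nonneg (K ρ q : ℝ) (A : ℝ × ℝ × ℝ) : 0 ≤ gain K ρ q A := by
  unfold gain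
  split_ifs <;> positivity

/-- Off `phaseSet K` the cost dominates the `p`-th power of the norm, so it controls both the size
of the next perturbation and the distance to `phaseSet K`. -/
lemma le_cost {K ρ p M N : ℝ} (hM : 1 ≤ M) (hN : 1 ≤ N) {A : ℝ × ℝ × ℝ} (hA : A ∉ phaseSet K) :
    ‖A‖ ^ p ≤ cost K ρ p M N A := by
  have h : 0 ≤ ‖A‖ ^ p := by positivity
  simp only [cost, if_neg hA]
  split_ifs <;> nlinarith

lemma cost_le_of_diag {K ρ p M N : ℝ} (hM : 1 ≤ M) {A : ℝ × ℝ × ℝ} (hA : A.2.1 = 0) :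
    cost K ρ p M N A ≤ M * ‖A‖ ^ p := by
  have h : 0 ≤ ‖A‖ ^ p := by positivity
  simp only [cost, if_pos hA]
  split_ifs <;> nlinarith

lemma cost_le_of_stair {K ρ p M N : ℝ} {A : ℝ × ℝ × ℝ} (hA : A ∈ stairSet ρ) :
    cost K ρ p M N A ≤ ‖A‖ ^ p := by
  have h : 0 ≤ ‖A‖ ^ p := by positivity
  simp only [cost, if_pos hA]
  split_ifs <;> nlinarith

lemma cost_phase {K ρ p M N : ℝ} {A : ℝ × ℝ × ℝ} (hA : A ∈ phaseSet K) : cost K ρ p M N A = 0 := by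
  simp [cost, hA]

lemma gain_of_stair {K ρ q : ℝ} {A : ℝ × ℝ × ℝ} (hA : A ∈ stairSet ρ) (hA' : A ∉ phaseSet K) :
    gain K ρ q A = ‖A‖ ^ q := by simp [gain, hA, hA']

lemma gain_eq_zero {K ρ q : ℝ} {A : ℝ × ℝ × ℝ} (hA : A ∉ stairSet ρ) : gain K ρ q A = 0 := by
  simp [gain, hA]

/-- On the two rays the diagonal entries differ by the factor `ρ`, so the first entry alone controls
the norm. Growth of `gain` therefore forces growth of the energy of `∂₁u`. -/
lemma gain_le {K ρ q : ℝ} (hρ : 1 < ρ) (hq : 0 ≤ q) (A : ℝ × ℝ × ℝ) :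
    gain K ρ q A ≤ ρ ^ q * |A.1| ^ q := by
  have h0 : 0 ≤ ρ ^ q * |A.1| ^ q := by positivity
  unfold gain
  split_ifs with h1 h2
  · exact h0
  · rw [← Real.mul_rpow (by linarith) (abs_nonneg _)]
    refine Real.rpow_le_rpow (norm_nonneg _) ?_ hq
    obtain ⟨a, b, d⟩ := A
    obtain ⟨hb, h⟩ := h2
    simp only at hb h ⊢
    subst hb
    have ha := abs_nonneg a
    have hd := abs_nonneg d
    rw [norm_triple, abs_zero]
    rcases h with h | h
    · rw [h, abs_mul, abs_of_pos (by linarith : 0 < ρ)]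
      refine max_le (by nlinarith) (max_le (by positivity) le_rfl)
    · have : |a| = ρ * |d| := by rw [h, abs_mul, abs_of_pos (by linarith : 0 < ρ)]
      refine max_le (by nlinarith) (max_le (by positivity) (by nlinarith))
  · exact h0

lemma gain_phase {K ρ q : ℝ} {A : ℝ × ℝ × ℝ} (hA : A ∈ phaseSet K) : gain K ρ q A = 0 := by
  simp [gain, hA]

/-- `A` splits along a rank one line so that `cost` decreases and `gain` increases on average by
fixed factors. -/
def CanSplit (K m ρ p q κ κ' M N C : ℝ) (A : ℝ × ℝ × ℝ) : Prop :=
  ∃ (n : Fin 2 → ℝ) (x y : ℝ), (∀ i, |n i| ≤ 1) ∧ rankOne m n ≠ 0 ∧ 0 < x * y ∧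
    max |x| |y| * ‖rankOne m n‖ ≤ C * ‖A‖ ∧
    y / (x + y) * cost K ρ p M N (A + x • rankOne m n)
      + x / (x + y) * cost K ρ p M N (A - y • rankOne m n) ≤ κ * cost K ρ p M N A ∧
    κ' * gain K ρ q A ≤ y / (x + y) * gain K ρ q (A + x • rankOne m n)
      + x / (x + y) * gain K ρ q (A - y • rankOne m n)

lemma rankOne_fst (m : ℝ) : rankOne m ![1, 0] = (1, 0, 0) := by simp [rankOne]

lemma rankOne_snd (m : ℝ) : rankOne m ![0, 1] = (0, 0, m) := by simp [rankOne]

lemma abs_fst_le (i : Fin 2) : |(![1, 0] : Fin 2 → ℝ) i| ≤ 1 := by fin_cases i <;> simp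

lemma abs_snd_le (i : Fin 2) : |(![0, 1] : Fin 2 → ℝ) i| ≤ 1 := by fin_cases i <;> simp

lemma norm_fst : ‖((1, 0, 0) : ℝ × ℝ × ℝ)‖ = 1 := by simp

lemma norm_snd {m : ℝ} (hm : 0 < m) : ‖((0, 0, m) : ℝ × ℝ × ℝ)‖ = m := by
  simp [abs_of_pos hm, hm.le]

lemma keep_eq_weight {K ρ : ℝ} (hK : 0 < K) (hρ : 0 < ρ) {a : ℝ} (ha : a ≠ 0) :
    (-(ρ / K + 1) * a) / (-(ρ / K + 1) * a + -(ρ ^ 2 - 1) * a) = keep K ρ := by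
  have h1 : -(ρ / K + 1) * a + -(ρ ^ 2 - 1) * a = -(ρ * (K * ρ + 1) / K) * a := by
    field_simp; ring
  rw [h1, keep]
  have : K * ρ + 1 ≠ 0 := by positivity
  field_simp
  ring

lemma keep_nonneg {K ρ : ℝ} (hK : 0 < K) (hρ : 0 < ρ) : 0 ≤ keep K ρ := by
  unfold keep; positivity

lemma StairParams.climb {K m ρ p q κ κ' M N C : ℝ} (P : StairParams K m ρ p q κ κ' M N C) {t : ℝ}
    (ht : 0 ≤ t) : keep K ρ * (ρ * t) ^ p ≤ κ * t ^ p ∧ κ' * t ^ q ≤ keep K ρ * (ρ * t) ^ q := by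
  have hρ0 : 0 ≤ ρ := by linarith [P.hρ]
  rw [Real.mul_rpow hρ0 ht, Real.mul_rpow hρ0 ht, ← mul_assoc, ← mul_assoc]
  have h1 : 0 ≤ t ^ p := by positivity
  have h2 : 0 ≤ t ^ q := by positivity
  have h3 := P.keep_p
  have h4 := P.keep_q
  exact ⟨by gcongr, by gcongr⟩

/-- Moving the first entry reaches `-(ρ / K) * a`, where the triple lies in the `σ₂` part of
`phaseSet K`, on one side, and `ρ ^ 2 * a`, on the other ray, on the other side. The second end has
weight `keep K ρ` and a norm larger by the factor `ρ`, so `climb` gives both inequalities. -/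
lemma canSplit_stair_fst {K m ρ p q κ κ' M N C : ℝ} (P : StairParams K m ρ p q κ κ' M N C) {a : ℝ} (ha : a ≠ 0)
    (hA : (a, 0, ρ * a) ∉ phaseSet K) : CanSplit K m ρ p q κ κ' M N C (a, 0, ρ * a) := by
  have hK := P.hK
  have hm := P.hm
  have hρ := P.hρ
  have hM1 := P.hM1
  have hN1 := P.hN1
  have hC := P.hC
  have hK0 : 0 < K := by linarith
  have hρ0 : 0 < ρ := by linarith
  have hN0 : (0 : ℝ) ≤ N := by linarith
  have hM0 : (0 : ℝ) ≤ M := by linarith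
  have hkeep0 := keep_nonneg hK0 hρ0
  have hκ0 := P.hκ0.le
  have hapos : 0 < |a| := abs_pos.2 ha
  have hst : ((a, 0, ρ * a) : ℝ × ℝ × ℝ) ∈ stairSet ρ := ⟨rfl, Or.inl rfl⟩
  have hnA : ‖((a, 0, ρ * a) : ℝ × ℝ × ℝ)‖ = ρ * |a| := by
    rw [norm_triple, abs_zero, abs_mul, abs_of_pos hρ0, max_eq_right (by positivity : 0 ≤ ρ * |a|),
      max_eq_right (by nlinarith)]
  have e1 : ((a, 0, ρ * a) : ℝ × ℝ × ℝ) + (-(ρ / K + 1) * a) • ((1, 0, 0) : ℝ × ℝ × ℝ)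
      = (-(ρ / K) * a, 0, ρ * a) := by
    simp; ring
  have e2 : ((a, 0, ρ * a) : ℝ × ℝ × ℝ) - (-(ρ ^ 2 - 1) * a) • ((1, 0, 0) : ℝ × ℝ × ℝ)
      = (ρ ^ 2 * a, 0, ρ * a) := by
    simp; ring
  have hB : ((-(ρ / K) * a, 0, ρ * a) : ℝ × ℝ × ℝ) ∈ phaseSet K :=
    phase_of_fst (by field_simp)
  have hCs : ((ρ ^ 2 * a, 0, ρ * a) : ℝ × ℝ × ℝ) ∈ stairSet ρ := ⟨rfl, Or.inr (by simp; ring)⟩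
  have hCp : ((ρ ^ 2 * a, 0, ρ * a) : ℝ × ℝ × ℝ) ∉ phaseSet K := by
    have hρa : ρ * a ≠ 0 := mul_ne_zero hρ0.ne' ha
    rintro (h | ⟨h, -⟩)
    · have : ρ * a * (1 + K * ρ) = 0 := by simp only at h; linarith
      rcases mul_eq_zero.1 this with h | h
      · exact hρa h
      · nlinarith
    · have : ρ * a * (K + ρ) = 0 := by simp only at h; linarith
      rcases mul_eq_zero.1 this with h | h
      · exact hρa h
      · linarith
  have hnC : ‖((ρ ^ 2 * a, 0, ρ * a) : ℝ × ℝ × ℝ)‖ = ρ * (ρ * |a|) := by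
    rw [norm_triple, abs_zero, abs_mul, abs_mul, abs_of_pos hρ0, abs_of_pos (by positivity),
      max_eq_right (by positivity : 0 ≤ ρ * |a|), max_eq_left (by nlinarith [mul_pos hρ0 hapos])]
    ring
  refine ⟨![1, 0], -(ρ / K + 1) * a, -(ρ ^ 2 - 1) * a, abs_fst_le, by simp [rankOne_fst], ?_, ?_, ?_, ?_⟩
  · have h1 : 0 < ρ ^ 2 - 1 := by nlinarith
    have h2 : 0 < ρ / K + 1 := by positivity
    have : -(ρ / K + 1) * a * (-(ρ ^ 2 - 1) * a) = (ρ / K + 1) * (ρ ^ 2 - 1) * a ^ 2 := by ring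
    rw [this]; positivity
  · rw [rankOne_fst, norm_fst, mul_one, hnA]
    have h1 : |-(ρ / K + 1) * a| = (ρ / K + 1) * |a| := by
      rw [abs_mul, abs_neg, abs_of_pos (by positivity)]
    have h2 : |-(ρ ^ 2 - 1) * a| = (ρ ^ 2 - 1) * |a| := by
      rw [abs_mul, abs_neg, abs_of_pos (by nlinarith)]
    have h3 : ρ / K ≤ ρ := div_le_self hρ0.le hK.le
    have h4 : ρ + 1 ≤ C * ρ := by nlinarith
    have h5 : ρ ^ 2 - 1 ≤ C * ρ := by nlinarith
    rw [h1, h2]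
    refine max_le ?_ ?_ <;> nlinarith
  · rw [rankOne_fst, e1, e2, cost_phase hB, mul_zero, zero_add, keep_eq_weight hK0 hρ0 ha]
    have hc := (P.climb (t := ρ * |a|) (by positivity)).1
    have h1 := cost_le_of_stair (K := K) (p := p) (M := M) (N := N) hCs
    rw [hnC] at h1
    have h2 := le_cost (ρ := ρ) (p := p) hM1 hN1 hA
    rw [hnA] at h2
    calc _ ≤ keep K ρ * (ρ * (ρ * |a|)) ^ p := by gcongr
      _ ≤ _ := hc
      _ ≤ _ := by gcongr
  · rw [rankOne_fst, e1, e2, keep_eq_weight hK0 hρ0 ha, gain_of_stair hst hA, gain_of_stair hCs hCp, hnA, hnC]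
    have := (P.climb (t := ρ * |a|) (by positivity)).2
    have h0 : 0 ≤ -(ρ ^ 2 - 1) * a / (-(ρ / K + 1) * a + -(ρ ^ 2 - 1) * a) *
        gain K ρ q (-(ρ / K) * a, 0, ρ * a) := by
      rw [gain_phase hB, mul_zero]
    linarith

/-- The mirror image: the last entry moves, the solved end lies in the `σ₁` part of `phaseSet K`,
and the other end returns to the first ray. The two steps alternate along the staircase. The
division by `m` compensates for the factor `m` in the direction `(0, 0, m)`. -/
lemma canSplit_stair_snd {K m ρ p q κ κ' M N C : ℝ} (P : StairParams K m ρ p q κ κ' M N C) {d : ℝ} (hd : d ≠ 0)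
    (hA : (ρ * d, 0, d) ∉ phaseSet K) : CanSplit K m ρ p q κ κ' M N C (ρ * d, 0, d) := by
  have hK := P.hK
  have hm := P.hm
  have hρ := P.hρ
  have hM1 := P.hM1
  have hN1 := P.hN1
  have hC := P.hC
  have hK0 : 0 < K := by linarith
  have hρ0 : 0 < ρ := by linarith
  have hN0 : (0 : ℝ) ≤ N := by linarith
  have hM0 : (0 : ℝ) ≤ M := by linarith
  have hkeep0 := keep_nonneg hK0 hρ0
  have hκ0 := P.hκ0.le
  have hdpos : 0 < |d| := abs_pos.2 hd
  have hst : ((ρ * d, 0, d) : ℝ × ℝ × ℝ) ∈ stairSet ρ := ⟨rfl, Or.inr rfl⟩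
  have hnA : ‖((ρ * d, 0, d) : ℝ × ℝ × ℝ)‖ = ρ * |d| := by
    rw [norm_triple, abs_zero, abs_mul, abs_of_pos hρ0, max_eq_right (by positivity : 0 ≤ |d|),
      max_eq_left (by nlinarith)]
  have e1 : ((ρ * d, 0, d) : ℝ × ℝ × ℝ) + (-(ρ / K + 1) * (d / m)) • ((0, 0, m) : ℝ × ℝ × ℝ)
      = (ρ * d, 0, -(ρ / K) * d) := by
    simp; field_simp; ring
  have e2 : ((ρ * d, 0, d) : ℝ × ℝ × ℝ) - (-(ρ ^ 2 - 1) * (d / m)) • ((0, 0, m) : ℝ × ℝ × ℝ)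
      = (ρ * d, 0, ρ ^ 2 * d) := by
    simp; field_simp; ring
  have hB : ((ρ * d, 0, -(ρ / K) * d) : ℝ × ℝ × ℝ) ∈ phaseSet K :=
    phase_of_snd (by field_simp)
  have hCs : ((ρ * d, 0, ρ ^ 2 * d) : ℝ × ℝ × ℝ) ∈ stairSet ρ := ⟨rfl, Or.inl (by simp; ring)⟩
  have hCp : ((ρ * d, 0, ρ ^ 2 * d) : ℝ × ℝ × ℝ) ∉ phaseSet K := by
    have hρd : ρ * d ≠ 0 := mul_ne_zero hρ0.ne' hd
    rintro (h | ⟨h, -⟩)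
    · have : ρ * d * (K + ρ) = 0 := by simp only at h; linarith
      rcases mul_eq_zero.1 this with h | h
      · exact hρd h
      · linarith
    · have : ρ * d * (1 + K * ρ) = 0 := by simp only at h; linarith
      rcases mul_eq_zero.1 this with h | h
      · exact hρd h
      · nlinarith
  have hnC : ‖((ρ * d, 0, ρ ^ 2 * d) : ℝ × ℝ × ℝ)‖ = ρ * (ρ * |d|) := by
    rw [norm_triple, abs_zero, abs_mul, abs_mul, abs_of_pos hρ0, abs_of_pos (by positivity : 0 < ρ ^ 2),
      max_eq_right (by positivity : 0 ≤ ρ ^ 2 * |d|), max_eq_right (by nlinarith [mul_pos hρ0 hdpos])]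
    ring
  have hdm : d / m ≠ 0 := div_ne_zero hd hm.ne'
  refine ⟨![0, 1], -(ρ / K + 1) * (d / m), -(ρ ^ 2 - 1) * (d / m), abs_snd_le, by simp [rankOne_snd, hm.ne'],
    ?_, ?_, ?_, ?_⟩
  · have h1 : 0 < ρ ^ 2 - 1 := by nlinarith
    have h2 : 0 < ρ / K + 1 := by positivity
    have : -(ρ / K + 1) * (d / m) * (-(ρ ^ 2 - 1) * (d / m)) =
      (ρ / K + 1) * (ρ ^ 2 - 1) * (d / m) ^ 2 := by ring
    rw [this]; positivity
  · rw [rankOne_snd, norm_snd hm, hnA]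
    have h1 : |-(ρ / K + 1) * (d / m)| * m = (ρ / K + 1) * |d| := by
      rw [abs_mul, abs_neg, abs_of_pos (by positivity), abs_div, abs_of_pos hm]
      field_simp
    have h2 : |-(ρ ^ 2 - 1) * (d / m)| * m = (ρ ^ 2 - 1) * |d| := by
      rw [abs_mul, abs_neg, abs_of_pos (by nlinarith : 0 < ρ ^ 2 - 1), abs_div, abs_of_pos hm]
      field_simp
    have h3 : ρ / K ≤ ρ := div_le_self hρ0.le hK.le
    have h4 : ρ + 1 ≤ C * ρ := by nlinarith
    have h5 : ρ ^ 2 - 1 ≤ C * ρ := by nlinarith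
    rw [max_mul_of_nonneg _ _ hm.le, h1, h2]
    refine max_le ?_ ?_ <;> nlinarith
  · rw [rankOne_snd, e1, e2, cost_phase hB, mul_zero, zero_add, keep_eq_weight hK0 hρ0 hdm]
    have hc := (P.climb (t := ρ * |d|) (by positivity)).1
    have h1 := cost_le_of_stair (K := K) (p := p) (M := M) (N := N) hCs
    rw [hnC] at h1
    have h2 := le_cost (ρ := ρ) (p := p) hM1 hN1 hA
    rw [hnA] at h2
    calc _ ≤ keep K ρ * (ρ * (ρ * |d|)) ^ p := by gcongr
      _ ≤ _ := hc
      _ ≤ _ := by gcongr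
  · rw [rankOne_snd, e1, e2, keep_eq_weight hK0 hρ0 hdm, gain_of_stair hst hA, gain_of_stair hCs hCp, hnA, hnC]
    have := (P.climb (t := ρ * |d|) (by positivity)).2
    have h0 : 0 ≤ -(ρ ^ 2 - 1) * (d / m) / (-(ρ / K + 1) * (d / m) + -(ρ ^ 2 - 1) * (d / m)) *
        gain K ρ q (ρ * d, 0, -(ρ / K) * d) := by
      rw [gain_phase hB, mul_zero]
    linarith

/-- Moving the entry of smaller modulus leads in one direction to `phaseSet K` and in the other to a
ray of the staircase, without the norm growing by more than `ρ`. -/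
lemma canSplit_diag {K m ρ p q κ κ' M N C : ℝ} (P : StairParams K m ρ p q κ κ' M N C) {a d : ℝ}
    (hA : (a, 0, d) ∉ phaseSet K) (hst : (a, 0, d) ∉ stairSet ρ) :
    CanSplit K m ρ p q κ κ' M N C (a, 0, d) := by
  have hK := P.hK
  have hm := P.hm
  have hρ := P.hρ
  have hM1 := P.hM1
  have hN1 := P.hN1
  have hC := P.hC
  have hK0 : 0 < K := by linarith
  have hρ0 : 0 < ρ := by linarith
  have hN0 : (0 : ℝ) ≤ N := by linarith
  have hM0 : (0 : ℝ) ≤ M := by linarith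
  have hM := P.hM
  have hp := P.hp
  have hne : ¬ (a = 0 ∧ d = 0) := by
    rintro ⟨rfl, rfl⟩
    exact hA (phase_of_fst (by simp))
  have hcA : cost K ρ p M N (a, 0, d) = M * ‖((a, 0, d) : ℝ × ℝ × ℝ)‖ ^ p := by
    simp [cost, hA, hst]
  -- Common to both cases. The weight `M` pays for the factor `ρ ^ p` on arriving at the staircase,
  -- and since `gain` vanishes at `A` it only has to be nonnegative at the ends.
  have fin : ∀ {x y : ℝ} {q' : ℝ × ℝ × ℝ}, 0 < x * y → (a, 0, d) + x • q' ∈ phaseSet K →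
      (a, 0, d) - y • q' ∈ stairSet ρ →
      ‖((a, 0, d) : ℝ × ℝ × ℝ) - y • q'‖ ≤ ρ * ‖((a, 0, d) : ℝ × ℝ × ℝ)‖ →
      y / (x + y) * cost K ρ p M N ((a, 0, d) + x • q')
        + x / (x + y) * cost K ρ p M N ((a, 0, d) - y • q') ≤ κ * cost K ρ p M N (a, 0, d) ∧
      κ' * gain K ρ q (a, 0, d) ≤ y / (x + y) * gain K ρ q ((a, 0, d) + x • q')
        + x / (x + y) * gain K ρ q ((a, 0, d) - y • q') := by
    intro x y q' hxy hB hCs hn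
    have hw := weight_mem hxy
    have hw' := weight_mem (x := y) (y := x) (by linarith)
    rw [add_comm y x] at hw'
    constructor
    · rw [cost_phase hB, mul_zero, zero_add, hcA]
      have h1 := cost_le_of_stair (K := K) (p := p) (M := M) (N := N) hCs
      have h2 : cost K ρ p M N ((a, 0, d) - y • q') ≤ κ * M * ‖((a, 0, d) : ℝ × ℝ × ℝ)‖ ^ p := by
        calc _ ≤ _ := h1
          _ ≤ (ρ * ‖((a, 0, d) : ℝ × ℝ × ℝ)‖) ^ p := by gcongr
          _ = ρ ^ p * ‖((a, 0, d) : ℝ × ℝ × ℝ)‖ ^ p := Real.mul_rpow hρ0.le (norm_nonneg _)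
          _ ≤ _ := by gcongr
      have h3 := cost_nonneg (K := K) (ρ := ρ) (p := p) hM0 hN0 ((a, 0, d) - y • q')
      nlinarith
    · rw [gain_eq_zero hst, mul_zero]
      exact add_nonneg (mul_nonneg hw'.1.le (gain_nonneg _ _ _ _))
        (mul_nonneg hw.1.le (gain_nonneg _ _ _ _))
  have hnorm : ‖((a, 0, d) : ℝ × ℝ × ℝ)‖ = max |a| |d| := by
    rw [norm_triple, abs_zero, max_eq_right (abs_nonneg d)]
  rcases le_total |a| |d| with had | had
  · have hd : d ≠ 0 := fun h => hne ⟨by simpa [h] using had, h⟩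
    have hd2 : 0 < |d| := abs_pos.2 hd
    have hnA : ‖((a, 0, d) : ℝ × ℝ × ℝ)‖ = |d| := by rw [hnorm, max_eq_right had]
    -- Since `|a| ≤ |d|` and `K`, `ρ` exceed one, `a` lies strictly between `-(K * d)` and `ρ * d`.
    have hxy : 0 < (-(K * d) - a) * (a - ρ * d) := by
      have h1 : -(a * d) ≤ d ^ 2 := by
        rw [← sq_abs d]
        nlinarith [neg_abs_le (a * d), abs_mul a d]
      have h2 : a * d ≤ d ^ 2 := by
        rw [← sq_abs d]
        nlinarith [le_abs_self (a * d), abs_mul a d]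
      have h3 : 0 < d ^ 2 := by positivity
      have h4 : 0 < (K * d + a) * d := by nlinarith
      have h5 : 0 < (ρ * d - a) * d := by nlinarith
      have h6 : (-(K * d) - a) * (a - ρ * d) * d ^ 2 = ((K * d + a) * d) * ((ρ * d - a) * d) := by
        ring
      have h7 := mul_pos h4 h5
      rw [← h6] at h7
      exact pos_of_mul_pos_left h7 h3.le
    have e1 : ((a, 0, d) : ℝ × ℝ × ℝ) + (-(K * d) - a) • ((1, 0, 0) : ℝ × ℝ × ℝ)
        = (-(K * d), 0, d) := by simp
    have e2 : ((a, 0, d) : ℝ × ℝ × ℝ) - (a - ρ * d) • ((1, 0, 0) : ℝ × ℝ × ℝ)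
        = (ρ * d, 0, d) := by simp
    refine ⟨![1, 0], -(K * d) - a, a - ρ * d, abs_fst_le, by simp [rankOne_fst], hxy, ?_, ?_⟩
    · rw [rankOne_fst, norm_fst, mul_one, hnA]
      refine max_le ?_ ?_
      · calc |-(K * d) - a| ≤ |-(K * d)| + |a| := abs_sub _ _
          _ = K * |d| + |a| := by rw [abs_neg, abs_mul, abs_of_pos hK0]
          _ ≤ _ := by nlinarith
      · calc |a - ρ * d| ≤ |a| + |ρ * d| := abs_sub _ _
          _ = |a| + ρ * |d| := by rw [abs_mul, abs_of_pos hρ0]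
          _ ≤ (1 + ρ) * |d| := by linarith
          _ ≤ _ := by gcongr; nlinarith
    · rw [rankOne_fst]
      refine fin hxy ?_ ?_ ?_
      · rw [e1]; exact phase_of_snd (by ring)
      · rw [e2]; exact ⟨rfl, Or.inr rfl⟩
      · rw [e2, hnA, norm_triple, abs_zero, abs_mul, abs_of_pos hρ0]
        refine max_le le_rfl (max_le (by positivity) (by nlinarith))
  · have ha : a ≠ 0 := fun h => hne ⟨h, by simpa [h] using had⟩
    have ha2 : 0 < |a| := abs_pos.2 ha
    have hnA : ‖((a, 0, d) : ℝ × ℝ × ℝ)‖ = |a| := by rw [hnorm, max_eq_left had]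
    have hxy : 0 < ((-(K * a) - d) / m) * ((d - ρ * a) / m) := by
      have h1 : -(d * a) ≤ a ^ 2 := by
        rw [← sq_abs a]
        nlinarith [neg_abs_le (d * a), abs_mul d a]
      have h2 : d * a ≤ a ^ 2 := by
        rw [← sq_abs a]
        nlinarith [le_abs_self (d * a), abs_mul d a]
      have h3 : 0 < a ^ 2 := by positivity
      have h4 : 0 < (K * a + d) * a := by nlinarith
      have h5 : 0 < (ρ * a - d) * a := by nlinarith
      have h6 : ((-(K * a) - d) / m) * ((d - ρ * a) / m) * (m ^ 2 * a ^ 2) =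
          ((K * a + d) * a) * ((ρ * a - d) * a) := by
        field_simp; ring
      have h7 := mul_pos h4 h5
      rw [← h6] at h7
      exact pos_of_mul_pos_left h7 (by positivity)
    have e1 : ((a, 0, d) : ℝ × ℝ × ℝ) + ((-(K * a) - d) / m) • ((0, 0, m) : ℝ × ℝ × ℝ)
        = (a, 0, -(K * a)) := by simp; field_simp; ring
    have e2 : ((a, 0, d) : ℝ × ℝ × ℝ) - ((d - ρ * a) / m) • ((0, 0, m) : ℝ × ℝ × ℝ)
        = (a, 0, ρ * a) := by simp; field_simp; ring
    refine ⟨![0, 1], (-(K * a) - d) / m, (d - ρ * a) / m, abs_snd_le, by simp [rankOne_snd, hm.ne'], hxy, ?_, ?_⟩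
    · rw [rankOne_snd, norm_snd hm, hnA, max_mul_of_nonneg _ _ hm.le, abs_div, abs_div, abs_of_pos hm,
        div_mul_cancel₀ _ hm.ne', div_mul_cancel₀ _ hm.ne']
      refine max_le ?_ ?_
      · calc |-(K * a) - d| ≤ |-(K * a)| + |d| := abs_sub _ _
          _ = K * |a| + |d| := by rw [abs_neg, abs_mul, abs_of_pos hK0]
          _ ≤ _ := by nlinarith
      · calc |d - ρ * a| ≤ |d| + |ρ * a| := abs_sub _ _
          _ = |d| + ρ * |a| := by rw [abs_mul, abs_of_pos hρ0]
          _ ≤ (1 + ρ) * |a| := by linarith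
          _ ≤ _ := by gcongr; nlinarith
    · rw [rankOne_snd]
      refine fin hxy ?_ ?_ ?_
      · rw [e1]; exact phase_of_fst rfl
      · rw [e2]; exact ⟨rfl, Or.inl rfl⟩
      · rw [e2, hnA, norm_triple, abs_zero, abs_mul, abs_of_pos hρ0]
        refine max_le (by nlinarith) (max_le (by positivity) le_rfl)

/-- The `σ₂` part of `phaseSet K` is a hyperplane that leaves the mixed entry free, and the diagonal
directions `(1, ±1)` cross it. Going one way along such a direction meets this hyperplane, going the
other way removes the mixed entry; the weight `N` pays for the increase of the norm. -/
lemma canSplit_offDiag {K m ρ p q κ κ' M N C : ℝ} (P : StairParams K m ρ p q κ κ' M N C) {a b d : ℝ} (hb : b ≠ 0)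
    (hA : (a, b, d) ∉ phaseSet K) : CanSplit K m ρ p q κ κ' M N C (a, b, d) := by
  have hK := P.hK
  have hm := P.hm
  have hρ := P.hρ
  have hM1 := P.hM1
  have hN1 := P.hN1
  have hC := P.hC
  have hK0 : 0 < K := by linarith
  have hρ0 : 0 < ρ := by linarith
  have hN0 : (0 : ℝ) ≤ N := by linarith
  have hM0 : (0 : ℝ) ≤ M := by linarith
  have hN := P.hN
  have hp := P.hp
  have hC' := P.hC'
  have hst : ((a, b, d) : ℝ × ℝ × ℝ) ∉ stairSet ρ := fun h => hb h.1
  have hcA : cost K ρ p M N (a, b, d) = N * ‖((a, b, d) : ℝ × ℝ × ℝ)‖ ^ p := by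
    simp [cost, hA, hst, hb]
  set S := ‖((a, b, d) : ℝ × ℝ × ℝ)‖ with hS
  have hSa : |a| ≤ S := le_max_left _ _
  have hSb : |b| ≤ S := (le_max_left _ _).trans (le_max_right _ _)
  have hSd : |d| ≤ S := (le_max_right _ _).trans (le_max_right _ _)
  have hS0 : 0 ≤ S := norm_nonneg _
  set x := -(d + K * a) / (K + m) with hx
  have hKm : 0 < K + m := by linarith
  have hx0 : x ≠ 0 := by
    intro h
    rw [hx, div_eq_zero_iff] at h
    rcases h with h | h
    · exact hA (phase_of_fst (by linarith))
    · linarith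
  -- The length `x` needed to reach the hyperplane does not depend on the sign `s`, because `s ^ 2 =
  -- 1`. So `s` can be chosen to put the diagonal target on the opposite side of `A`.
  obtain ⟨s, hs, hs2⟩ : ∃ s : ℝ, |s| = 1 ∧ 0 < x * (s * b) := by
    rcases lt_or_gt_of_ne (mul_ne_zero hx0 hb) with h | h
    · exact ⟨-1, by simp, by linarith⟩
    · exact ⟨1, by simp, by linarith⟩
  have hss : s * s = 1 := by rw [← abs_mul_abs_self, hs, one_mul]
  have q3 : rankOne m ![1, s] = (1, s, m) := by
    simp only [rankOne, Matrix.cons_val_zero, Matrix.cons_val_one]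
    rw [sq s, hss]; simp
  have nq3 : ‖((1, s, m) : ℝ × ℝ × ℝ)‖ ≤ 1 + m := by
    rw [norm_triple, hs, abs_one, abs_of_pos hm]
    exact max_le (by linarith) (max_le (by linarith) (by linarith))
  have e2 : ((a, b, d) : ℝ × ℝ × ℝ) - (s * b) • ((1, s, m) : ℝ × ℝ × ℝ)
      = (a - s * b, 0, d - s * b * m) := by
    simp only [Prod.smul_mk, Prod.mk_sub_mk, smul_eq_mul, mul_one]
    have : b - s * b * s = 0 := by linear_combination (-b) * hss
    rw [this]
  have hB : ((a, b, d) : ℝ × ℝ × ℝ) + x • ((1, s, m) : ℝ × ℝ × ℝ) ∈ phaseSet K := by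
    simp only [Prod.smul_mk, Prod.mk_add_mk, smul_eq_mul, mul_one]
    refine phase_of_fst ?_
    have : x * (K + m) = -(d + K * a) := by rw [hx]; field_simp
    linarith
  have hw := weight_mem hs2
  have hw' := weight_mem (x := s * b) (y := x) (by linarith)
  rw [add_comm (s * b) x] at hw'
  have hsb : |s * b| ≤ S := by rw [abs_mul, hs, one_mul]; exact hSb
  have hxS : |x| ≤ (1 + K) * S := by
    rw [hx, abs_div, abs_neg, abs_of_pos hKm, div_le_iff₀ hKm]
    have h1 : |d + K * a| ≤ S + K * S := by
      refine (abs_add_le _ _).trans (add_le_add hSd ?_)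
      rw [abs_mul, abs_of_pos hK0]; gcongr
    have h2 : (1 + K) * S ≤ (1 + K) * S * (K + m) :=
      le_mul_of_one_le_right (by positivity) (by linarith)
    linarith
  refine ⟨![1, s], x, s * b, ?_, ?_, hs2, ?_, ?_, ?_⟩
  · intro i; fin_cases i <;> simp [hs]
  · rw [q3]; simp
  · rw [q3]
    have h1 : max |x| |s * b| ≤ (1 + K) * S := max_le hxS (hsb.trans (by nlinarith))
    calc _ ≤ (1 + K) * S * (1 + m) := by gcongr
      _ ≤ _ := by nlinarith
  · rw [q3, cost_phase hB, mul_zero, zero_add, hcA, e2]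
    have h1 := cost_le_of_diag (K := K) (ρ := ρ) (p := p) (N := N) hM1
      (A := (a - s * b, 0, d - s * b * m)) rfl
    have h2 : ‖((a - s * b, 0, d - s * b * m) : ℝ × ℝ × ℝ)‖ ≤ (2 + m) * S := by
      rw [norm_triple, abs_zero]
      refine max_le ?_ (max_le (by positivity) ?_)
      · refine (abs_sub _ _).trans ?_
        nlinarith
      · refine (abs_sub _ _).trans ?_
        rw [abs_mul (s * b), abs_of_pos hm]
        nlinarith
    have h3 : cost K ρ p M N (a - s * b, 0, d - s * b * m) ≤ κ * N * S ^ p := by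
      calc _ ≤ _ := h1
        _ ≤ M * ((2 + m) * S) ^ p := by gcongr
        _ = M * (2 + m) ^ p * S ^ p := by rw [Real.mul_rpow (by linarith) hS0, mul_assoc]
        _ ≤ _ := by gcongr
    have h4 := cost_nonneg (K := K) (ρ := ρ) (p := p) hM0 hN0 (a - s * b, 0, d - s * b * m)
    nlinarith
  · rw [gain_eq_zero hst, mul_zero]
    exact add_nonneg (mul_nonneg hw'.1.le (gain_nonneg _ _ _ _))
      (mul_nonneg hw.1.le (gain_nonneg _ _ _ _))

/-- Every value outside `phaseSet` can be split along a rank one line so that `cost` decreases and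
`gain` increases by fixed factors. -/
theorem exists_split {K m ρ p q κ κ' M N C : ℝ} (P : StairParams K m ρ p q κ κ' M N C)
    {A : ℝ × ℝ × ℝ} (hA : A ∉ phaseSet K) : CanSplit K m ρ p q κ κ' M N C A := by
  obtain ⟨a, b, d⟩ := A
  by_cases hb : b = 0
  · subst hb
    have hne : ¬ (a = 0 ∧ d = 0) := by
      rintro ⟨rfl, rfl⟩
      exact hA (phase_of_fst (by simp))
    by_cases hs1 : d = ρ * a
    · subst hs1
      exact canSplit_stair_fst P (fun h => hne ⟨h, by simp [h]⟩) hA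
    by_cases hs2 : a = ρ * d
    · subst hs2
      exact canSplit_stair_snd P (fun h => hne ⟨by simp [h], h⟩) hA
    refine canSplit_diag P hA ?_
    rintro ⟨-, h | h⟩
    · exact hs1 h
    · exact hs2 h
  · exact canSplit_offDiag P hb hA

/-! ### The critical exponent -/

/-- The logarithm of `keep K ρ * ρ ^ s`. -/
def logKeep (K s ρ : ℝ) : ℝ := (s - 1) * Real.log ρ + Real.log (K + ρ) - Real.log (K * ρ + 1)

lemma exp_logKeep {K s ρ : ℝ} (hK : 1 < K) (hρ : 0 < ρ) :
    Real.exp (logKeep K s ρ) = keep K ρ * ρ ^ s := by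
  have h1 : 0 < K + ρ := by linarith
  have h2 : 0 < K * ρ + 1 := by nlinarith
  rw [logKeep, Real.exp_sub, Real.exp_add, Real.exp_log h1, Real.exp_log h2, mul_comm (s - 1),
    ← Real.rpow_def_of_pos hρ, Real.rpow_sub_one hρ.ne', keep]
  field_simp

lemma hasDerivAt_logKeep {K s ρ : ℝ} (hK : 1 < K) (hρ : 0 < ρ) :
    HasDerivAt (logKeep K s) ((s - 1) / ρ + 1 / (K + ρ) - K / (K * ρ + 1)) ρ := by
  have h1 : 0 < K + ρ := by linarith
  have h2 : 0 < K * ρ + 1 := by nlinarith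
  have e1 := (Real.hasDerivAt_log hρ.ne').const_mul (s - 1)
  have e2 := ((hasDerivAt_id ρ).const_add K).log h1.ne'
  have e3 := (((hasDerivAt_id ρ).const_mul K).add_const 1).log h2.ne'
  have := (e1.add e2).sub e3
  refine this.congr_deriv ?_
  simp [div_eq_mul_inv]

lemma logKeep_one (K s : ℝ) : logKeep K s 1 = 0 := by simp [logKeep]

/-- At the critical exponent the derivative is a positive multiple of `(t - 1) ^ 2`: first order
growth and decay cancel at `1`, but the remainder is strictly favourable. So each step of fixed
ratio gains critical energy. -/
lemma logKeep_critical_pos {K ρ : ℝ} (hK : 1 < K) (hρ : 1 < ρ) :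
    0 < logKeep K (2 * K / (K + 1)) ρ := by
  have hmono : StrictMonoOn (logKeep K (2 * K / (K + 1))) (Set.Ici 1) := by
    refine strictMonoOn_of_deriv_pos (convex_Ici 1) ?_ ?_
    · intro t ht
      exact (hasDerivAt_logKeep hK (lt_of_lt_of_le one_pos ht)).continuousAt.continuousWithinAt
    · intro t ht
      rw [interior_Ici] at ht
      have ht1 : 1 < t := ht
      have ht0 : 0 < t := by linarith
      rw [(hasDerivAt_logKeep hK ht0).deriv]
      have e : (2 * K / (K + 1) - 1) / t + 1 / (K + t) - K / (K * t + 1) =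
          K * (K - 1) * (t - 1) ^ 2 / (t * (K + 1) * (K + t) * (K * t + 1)) := by
        have h1 : K + 1 ≠ 0 := by positivity
        have h2 : K + t ≠ 0 := by positivity
        have h3 : K * t + 1 ≠ 0 := by positivity
        field_simp
        ring
      rw [e]
      have : 0 < K - 1 := by linarith
      have : 0 < t - 1 := by linarith
      positivity
  have := hmono (Set.mem_Ici.2 le_rfl) (Set.mem_Ici.2 hρ.le) hρ
  rwa [logKeep_one] at this

/-- The function vanishes at `1` with derivative `p - 2 * K / (K + 1) < 0`, so it is negative just
to the right of `1`. -/
lemma exists_logKeep_neg {K p : ℝ} (hK : 1 < K) (hp : p < 2 * K / (K + 1)) :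
    ∃ ρ, 1 < ρ ∧ logKeep K p ρ < 0 := by
  have hd := hasDerivAt_logKeep (s := p) hK one_pos
  have hneg : (p - 1) / 1 + 1 / (K + 1) - K / (K * 1 + 1) < 0 := by
    have h1 : (p - 1) / 1 + 1 / (K + 1) - K / (K * 1 + 1) = p - 2 * K / (K + 1) := by
      have : K + 1 ≠ 0 := by positivity
      field_simp
      ring
    rw [h1]; linarith
  have ht := hasDerivAt_iff_tendsto_slope.1 hd
  have hev := (ht.mono_left (nhdsWithin_mono 1 (fun t (ht : t ∈ Set.Ioi (1 : ℝ)) => ne_of_gt ht)))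
    |>.eventually_lt_const hneg
  obtain ⟨ρ, hs, hρ⟩ := (hev.and self_mem_nhdsWithin).exists
  have hρ1 : 1 < ρ := hρ
  refine ⟨ρ, hρ1, ?_⟩
  rw [slope_def_field, logKeep_one, sub_zero] at hs
  by_contra hc
  exact absurd hs (not_lt.2 (div_nonneg (not_lt.1 hc) (by linarith)))

/-- The ratio `ρ` is fixed by the subcritical exponent, and `κ`, `κ'` are the two resulting factors.
Then `M` and `N` are taken in this order, each large enough for the preliminary splittings to reduce
the cost by the same `κ`. -/
lemma exists_stairParams {K m p : ℝ} (hK : 1 < K) (hm : 0 < m) (hp : 1 ≤ p)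
    (hpq : p < 2 * K / (K + 1)) :
    ∃ ρ κ κ' M N C, StairParams K m ρ p (2 * K / (K + 1)) κ κ' M N C := by
  obtain ⟨ρ, hρ, hneg⟩ := exists_logKeep_neg hK hpq
  have hρ0 : 0 < ρ := by linarith
  have h1 : keep K ρ * ρ ^ p < 1 := by
    rw [← exp_logKeep hK hρ0]; exact Real.exp_lt_one_iff.2 hneg
  have h2 : 1 < keep K ρ * ρ ^ (2 * K / (K + 1)) := by
    rw [← exp_logKeep hK hρ0, Real.one_lt_exp_iff]; exact logKeep_critical_pos hK hρ
  have h0 : 0 < keep K ρ * ρ ^ p := by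
    rw [← exp_logKeep hK hρ0]; exact Real.exp_pos _
  set κ := keep K ρ * ρ ^ p with hκ
  have hρp : 0 < ρ ^ p := by positivity
  set M := 1 + ρ ^ p / κ with hM
  have hM1 : 1 ≤ M := le_add_of_nonneg_right (by positivity)
  have hmp : 0 < (2 + m) ^ p := by positivity
  refine ⟨ρ, κ, _, M, 1 + M * (2 + m) ^ p / κ, max (K + ρ ^ 2 + 1 + m) ((1 + K) * (1 + m)),
    hK, hm, hρ, hp, h0, h1, h2, le_rfl, le_rfl, hM1, ?_, le_add_of_nonneg_right (by positivity),
    ?_, le_max_left _ _, le_max_right _ _⟩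
  · rw [hM, mul_add, mul_div_cancel₀ _ h0.ne']; linarith
  · rw [mul_add, mul_div_cancel₀ _ h0.ne']; linarith

/-! ### One step: from a single ball to all of the domain -/

lemma add_rpow_le_two_rpow {u v p : ℝ} (hu : 0 ≤ u) (hv : 0 ≤ v) (hp : 0 ≤ p) :
    (u + v) ^ p ≤ 2 ^ p * (u ^ p + v ^ p) := by
  have h1 : u + v ≤ 2 * max u v := by
    linarith [le_max_left u v, le_max_right u v]
  have h2 : (max u v) ^ p ≤ u ^ p + v ^ p := by
    have hu' : 0 ≤ u ^ p := by positivity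
    have hv' : 0 ≤ v ^ p := by positivity
    rcases max_choice u v with h | h <;> rw [h] <;> linarith
  calc (u + v) ^ p ≤ (2 * max u v) ^ p := by gcongr
    _ = 2 ^ p * (max u v) ^ p := Real.mul_rpow (by norm_num) (hu.trans (le_max_left _ _))
    _ ≤ _ := by gcongr

lemma measurableSet_phaseSet (K : ℝ) : MeasurableSet (phaseSet K) := by
  unfold phaseSet
  refine MeasurableSet.union ?_ (MeasurableSet.inter ?_ ?_)
  · exact (isClosed_eq (by fun_prop) (by fun_prop)).measurableSet
  · exact (isClosed_eq (by fun_prop) (by fun_prop)).measurableSet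
  · exact (isClosed_eq (by fun_prop) (by fun_prop)).measurableSet

lemma isClosed_phaseSet (K : ℝ) : IsClosed (phaseSet K) := by
  unfold phaseSet
  refine IsClosed.union ?_ (IsClosed.inter ?_ ?_)
  · exact isClosed_eq (by fun_prop) (by fun_prop)
  · exact isClosed_eq (by fun_prop) (by fun_prop)
  · exact isClosed_eq (by fun_prop) (by fun_prop)

lemma measurableSet_stairSet (ρ : ℝ) : MeasurableSet (stairSet ρ) := by
  unfold stairSet
  refine MeasurableSet.inter ?_ (MeasurableSet.union ?_ ?_)
  · exact (isClosed_eq (by fun_prop) (by fun_prop)).measurableSet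
  · exact (isClosed_eq (by fun_prop) (by fun_prop)).measurableSet
  · exact (isClosed_eq (by fun_prop) (by fun_prop)).measurableSet

lemma measurable_cost (K ρ p M N : ℝ) : Measurable (cost K ρ p M N) := by
  classical
  unfold cost
  have h : Measurable fun A : ℝ × ℝ × ℝ => ‖A‖ ^ p := measurable_norm.pow_const p
  refine Measurable.ite (measurableSet_phaseSet K) measurable_const
    (Measurable.ite (measurableSet_stairSet ρ) h (Measurable.ite ?_ (h.const_mul M) (h.const_mul N)))
  exact (isClosed_eq (by fun_prop) (by fun_prop)).measurableSet

lemma measurable_gain (K ρ q : ℝ) : Measurable (gain K ρ q) := by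
  classical
  unfold gain
  have h : Measurable fun A : ℝ × ℝ × ℝ => ‖A‖ ^ q := measurable_norm.pow_const q
  exact Measurable.ite (measurableSet_phaseSet K) measurable_const
    (Measurable.ite (measurableSet_stairSet ρ) h measurable_const)

lemma cost_le {K ρ p M N R : ℝ} (hM : 1 ≤ M) (hN : 1 ≤ N) (hp : 0 ≤ p) {A : ℝ × ℝ × ℝ}
    (hA : ‖A‖ ≤ R) : cost K ρ p M N A ≤ (M + N) * R ^ p := by
  have h1 : ‖A‖ ^ p ≤ R ^ p := by gcongr
  have h0 : 0 ≤ ‖A‖ ^ p := by positivity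
  unfold cost
  split_ifs <;> nlinarith

lemma gain_le_norm {K ρ q R : ℝ} (hq : 0 ≤ q) {A : ℝ × ℝ × ℝ} (hA : ‖A‖ ≤ R) :
    gain K ρ q A ≤ R ^ q := by
  have h1 : ‖A‖ ^ q ≤ R ^ q := by gcongr
  have h0 : 0 ≤ ‖A‖ ^ q := by positivity
  unfold gain
  split_ifs <;> linarith

lemma integrableOn_of_bounded {f : Plane → ℝ} {S : Set Plane} (hf : Measurable f)
    (hS : volume S ≠ ∞) {b : ℝ} (h0 : ∀ z, 0 ≤ f z) (hb : ∀ z, f z ≤ b) : IntegrableOn f S := by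
  have : IsFiniteMeasure (volume.restrict S) := ⟨by simpa using hS.lt_top⟩
  exact Integrable.of_bound hf.aestronglyMeasurable b
    (Eventually.of_forall fun z => by rw [Real.norm_eq_abs, abs_of_nonneg (h0 z)]; exact hb z)

/-- Integral of a function which takes two values on sets that nearly fill `Q`. -/
lemma setIntegral_two_values {f : Plane → ℝ} {Q E E' : Set Plane} (hQ : MeasurableSet Q)
    (hE : MeasurableSet E) (hE' : MeasurableSet E') (hEQ : E ⊆ Q) (hEQ' : E' ⊆ Q)
    (hd : Disjoint E E') (hfin : volume Q ≠ ∞) (hf : Measurable f) {b u v α β η : ℝ}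
    (h0 : ∀ z, 0 ≤ f z) (hb : ∀ z, f z ≤ b) (hu : ∀ z ∈ E, f z = u) (hv : ∀ z ∈ E', f z = v)
    (hu0 : 0 ≤ u) (hub : u ≤ b) (hv0 : 0 ≤ v) (hvb : v ≤ b) (hαβ : α + β = 1) (hη : 0 ≤ η)
    (hα : (α - η) * volume.real Q ≤ volume.real E)
    (hβ : (β - η) * volume.real Q ≤ volume.real E') :
    (α * u + β * v - 4 * η * b) * volume.real Q ≤ ∫ z in Q, f z ∧
      ∫ z in Q, f z ≤ (α * u + β * v + 4 * η * b) * volume.real Q := by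
  have finE : volume E ≠ ∞ := ne_top_of_le_ne_top hfin (measure_mono hEQ)
  have finE' : volume E' ≠ ∞ := ne_top_of_le_ne_top hfin (measure_mono hEQ')
  have hF : IntegrableOn f Q := integrableOn_of_bounded hf hfin h0 hb
  set R := Q \ (E ∪ E') with hR
  have hRm : MeasurableSet R := hQ.diff (hE.union hE')
  have finR : volume R ≠ ∞ := ne_top_of_le_ne_top hfin (measure_mono Set.sdiff_subset)
  have hsum : volume.real E + volume.real E' + volume.real R = volume.real Q := by
    have h1 : volume.real (E ∪ E') = volume.real E + volume.real E' :=
      measureReal_union hd hE' finE finE'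
    have h2 := measureReal_sdiff_add_inter (μ := volume) (s := Q) (t := E ∪ E') (hE.union hE') hfin
    rw [Set.inter_eq_right.2 (Set.union_subset hEQ hEQ'), h1] at h2
    linarith
  have hint : ∫ z in Q, f z = (∫ z in E, f z) + (∫ z in E', f z) + ∫ z in R, f z := by
    have hQe : Q = (E ∪ E') ∪ R := by
      rw [hR, Set.union_sdiff_cancel (Set.union_subset hEQ hEQ')]
    have hdR : Disjoint (E ∪ E') R := Set.disjoint_sdiff_right
    rw [hQe] at hF ⊢
    rw [setIntegral_union hdR hRm (hF.mono_set Set.subset_union_left)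
      (hF.mono_set Set.subset_union_right), setIntegral_union hd hE'
      (hF.mono_set (Set.subset_union_left.trans Set.subset_union_left))
      (hF.mono_set (Set.subset_union_right.trans Set.subset_union_left))]
  have i1 : ∫ z in E, f z = volume.real E * u := by
    rw [setIntegral_congr_fun hE hu]; simp
  have i2 : ∫ z in E', f z = volume.real E' * v := by
    rw [setIntegral_congr_fun hE' hv]; simp
  have i3 : ∫ z in R, f z ≤ volume.real R * b := by
    have := setIntegral_mono_on (hF.mono_set Set.sdiff_subset)
      (integrableOn_const (C := b) finR) hRm (fun z _ => hb z)
    simpa using this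
  have i4 : 0 ≤ ∫ z in R, f z := setIntegral_nonneg hRm fun z _ => h0 z
  have hR0 : 0 ≤ volume.real R := measureReal_nonneg
  rw [hint, i1, i2]
  have hV0 : 0 ≤ volume.real Q := measureReal_nonneg
  have hηV : 0 ≤ η * volume.real Q := by positivity
  have hβ' : β = 1 - α := by linarith
  subst hβ'
  set V := volume.real Q
  -- Upper bounds for either set follow from the lower bound for the other, since the fractions add
  -- up to one.
  have hEup : volume.real E ≤ (α + η) * V := by linarith
  have hEup' : volume.real E' ≤ (1 - α + η) * V := by linarith
  have hRup : volume.real R ≤ 2 * η * V := by linarith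
  have k1 : η * V * u ≤ η * V * b := by gcongr
  have k2 : η * V * v ≤ η * V * b := by gcongr
  have k0 : 0 ≤ η * V * u := by positivity
  have k0' : 0 ≤ η * V * v := by positivity
  constructor
  · have a1 : (α - η) * V * u ≤ volume.real E * u := by gcongr
    have a2 : (1 - α - η) * V * v ≤ volume.real E' * v := by gcongr
    linarith
  · have a1 : volume.real E * u ≤ (α + η) * V * u := by gcongr
    have a2 : volume.real E' * v ≤ (1 - α + η) * V * v := by gcongr
    have hb0 : 0 ≤ b := hu0.trans hub
    have a3 : volume.real R * b ≤ 2 * η * V * b := by gcongr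
    linarith

/-- `cost` and `gain` jump across `phaseSet K` and the rays, so continuity of the second derivatives
does not compare their means on balls with the value at the centre. Lebesgue differentiation does so
at almost every centre. -/
lemma ae_lebesgue_point {f : Plane → ℝ} (hf : Measurable f) {b : ℝ} (h0 : ∀ z, 0 ≤ f z)
    (hb : ∀ z, f z ≤ b) : ∀ᵐ x₀ : Plane, ∀ η > 0, ∃ r₀ > 0, ∀ r, 0 < r → r < r₀ →
      |(∫ z in Metric.closedBall x₀ r, f z) - f x₀ * volume.real (Metric.closedBall x₀ r)| ≤
        η * volume.real (Metric.closedBall x₀ r) := by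
  have hloc : LocallyIntegrable f := by
    intro z
    exact ⟨Metric.closedBall z 1, Metric.closedBall_mem_nhds z one_pos,
      integrableOn_of_bounded hf measure_closedBall_lt_top.ne h0 hb⟩
  filter_upwards [(Besicovitch.vitaliFamily (volume : Measure Plane)).ae_tendsto_average hloc]
    with x₀ hx η hη
  have ht := hx.comp (Besicovitch.tendsto_filterAt volume x₀)
  have hev := (Metric.tendsto_nhds.1 ht) η hη
  obtain ⟨r₀, hr₀, hsub⟩ := mem_nhdsGT_iff_exists_Ioo_subset.1 hev
  refine ⟨r₀, hr₀, fun r hr hrr => ?_⟩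
  have h := hsub ⟨hr, hrr⟩
  simp only [Set.mem_ofPred_eq, Function.comp, Real.dist_eq, setAverage_eq, smul_eq_mul] at h
  have hV : 0 < volume.real (Metric.closedBall x₀ r) :=
    ENNReal.toReal_pos (Metric.measure_closedBall_pos volume x₀ hr).ne'
      measure_closedBall_lt_top.ne
  set V := volume.real (Metric.closedBall x₀ r)
  set I := ∫ z in Metric.closedBall x₀ r, f z
  have e : I - f x₀ * V = (V⁻¹ * I - f x₀) * V := by field_simp
  rw [e, abs_mul, abs_of_pos hV]
  gcongr

/-- The perturbation inside a small ball centred at a point where the equation fails. -/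
lemma exists_local_step {K m ρ p q κ κ' M N C : ℝ} (P : StairParams K m ρ p q κ κ' M N C)
    (hq : 0 ≤ q) {w : Plane → ℝ} (hw : Smooth w) {R : ℝ} (hR : ∀ z, ‖hess m w z‖ ≤ R)
    {x₀ : Plane} (hx₀ : hess m w x₀ ∉ phaseSet K) {η : ℝ} (hη : 0 < η) :
    ∃ r₀ > 0, ∀ r, 0 < r → r < r₀ → ∃ h : Plane → ℝ, Smooth h ∧ tsupport h ⊆ Metric.ball x₀ r ∧
      (∀ z, |pd 0 h z| ≤ η) ∧
      ∫ z in Metric.closedBall x₀ r, cost K ρ p M N (hess m w z + hess m h z) ≤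
        (κ * cost K ρ p M N (hess m w x₀) + η) * volume.real (Metric.closedBall x₀ r) ∧
      (κ' * gain K ρ q (hess m w x₀) - η) * volume.real (Metric.closedBall x₀ r) ≤
        ∫ z in Metric.closedBall x₀ r, gain K ρ q (hess m w z + hess m h z) ∧
      ∀ z, ‖hess m h z‖ ^ p ≤ 2 ^ p * C ^ p * cost K ρ p M N (hess m w x₀) + η := by
  obtain ⟨n, x, y, hn, hqn, hxy, hmax, hcost, hgain⟩ := exists_split P hx₀
  set A := hess m w x₀ with hA
  have hR0 : 0 ≤ R := (norm_nonneg _).trans (hR x₀)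
  have hm0 := P.hm
  have hC0 : 0 ≤ C := by
    have := P.hC; have := P.hK; have := sq_nonneg ρ; linarith
  have hp0 : 0 ≤ p := by linarith [P.hp]
  set R' := R + C * R + 1 with hR'
  have hR'0 : 0 ≤ R' := by positivity
  -- A common bound for `cost` and `gain` at every value met below. It depends only on `w` through
  -- `R`, so `η₁` can be chosen before the ball.
  set b := (M + N) * R' ^ p + R' ^ q with hb
  have hM1 := P.hM1
  have hN1 := P.hN1
  have hbc : ∀ B : ℝ × ℝ × ℝ, ‖B‖ ≤ R' → cost K ρ p M N B ≤ b := fun B hB =>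
    (cost_le hM1 hN1 hp0 hB).trans (le_add_of_nonneg_right (by positivity))
  have hbg : ∀ B : ℝ × ℝ × ℝ, ‖B‖ ≤ R' → gain K ρ q B ≤ b := fun B hB =>
    (gain_le_norm hq hB).trans (le_add_of_nonneg_left (by positivity))
  have hb0 : 0 ≤ b := by positivity
  set η₁ := min (min η 1) (min (η / (4 * b + 1)) (η / 2 ^ p)) with hη₁
  have hη₁pos : 0 < η₁ := by positivity
  have hη₁η : η₁ ≤ η := (min_le_left _ _).trans (min_le_left _ _)
  have hη₁1 : η₁ ≤ 1 := (min_le_left _ _).trans (min_le_right _ _)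
  have hη₁b : 4 * η₁ * b ≤ η := by
    have h1 : η₁ ≤ η / (4 * b + 1) := (min_le_right _ _).trans (min_le_left _ _)
    rw [le_div_iff₀ (by positivity)] at h1
    linarith
  have hη₁p : 2 ^ p * η₁ ≤ η := by
    have h1 : η₁ ≤ η / 2 ^ p := (min_le_right _ _).trans (min_le_right _ _)
    rwa [le_div_iff₀ (by positivity), mul_comm] at h1
  obtain ⟨r₀, hr₀, hloc⟩ := exists_local_lamination m hw x₀ hn hqn hxy hη₁pos
  refine ⟨r₀, hr₀, fun r hr hrr => ?_⟩
  obtain ⟨h, hh, hsupp, hpd, hhess, E, E', hE, hE', hd, hEQ, hEQ', hEv, hEv', hfr, hfr'⟩ :=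
    hloc r hr hrr
  have hAR : ‖A‖ ≤ R := hR x₀
  have hCA : C * ‖A‖ ≤ C * R := by gcongr
  have hnew : ∀ z, ‖hess m w z + hess m h z‖ ≤ R' := by
    intro z
    refine (norm_add_le _ _).trans ?_
    have := hR z
    have := hhess z
    linarith
  have hB : ‖A + x • rankOne m n‖ ≤ R' := by
    refine (norm_add_le _ _).trans ?_
    have : ‖x • rankOne m n‖ ≤ max |x| |y| * ‖rankOne m n‖ := by
      rw [norm_smul]; gcongr; exact le_max_left _ _
    linarith
  have hB' : ‖A - y • rankOne m n‖ ≤ R' := by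
    refine (norm_sub_le _ _).trans ?_
    have : ‖y • rankOne m n‖ ≤ max |x| |y| * ‖rankOne m n‖ := by
      rw [norm_smul]; gcongr; exact le_max_right _ _
    linarith
  have hmeas : Measurable fun z => hess m w z + hess m h z :=
    ((continuous_hess hw).add (continuous_hess hh)).measurable
  have hM0 : 0 ≤ M := by linarith
  have hN0 : 0 ≤ N := by linarith
  have hab : y / (x + y) + x / (x + y) = 1 := by
    have hb : x + y ≠ 0 := by
      intro h'
      have : y = -x := by linarith
      rw [this] at hxy
      nlinarith [sq_nonneg x]
    field_simp
    ring
  have hV0 : 0 ≤ volume.real (Metric.closedBall x₀ r) := measureReal_nonneg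
  have key1 := setIntegral_two_values (f := fun z => cost K ρ p M N (hess m w z + hess m h z))
    measurableSet_closedBall hE hE' hEQ hEQ' hd measure_closedBall_lt_top.ne
    ((measurable_cost K ρ p M N).comp hmeas) (fun z => cost_nonneg hM0 hN0 _)
    (fun z => hbc _ (hnew z)) (fun z hz => by rw [hEv z hz]) (fun z hz => by rw [hEv' z hz])
    (cost_nonneg hM0 hN0 _) (hbc _ hB) (cost_nonneg hM0 hN0 _) (hbc _ hB') hab hη₁pos.le hfr hfr'
  have key2 := setIntegral_two_values (f := fun z => gain K ρ q (hess m w z + hess m h z))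
    measurableSet_closedBall hE hE' hEQ hEQ' hd measure_closedBall_lt_top.ne
    ((measurable_gain K ρ q).comp hmeas) (fun z => gain_nonneg _ _ _ _)
    (fun z => hbg _ (hnew z)) (fun z hz => by rw [hEv z hz]) (fun z hz => by rw [hEv' z hz])
    (gain_nonneg _ _ _ _) (hbg _ hB) (gain_nonneg _ _ _ _) (hbg _ hB') hab hη₁pos.le hfr hfr'
  refine ⟨h, hh, hsupp, fun z => (hpd z).trans hη₁η, ?_, ?_, ?_⟩
  · refine key1.2.trans ?_
    gcongr
  · refine le_trans ?_ key2.1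
    gcongr
  · intro z
    have h1 : ‖hess m h z‖ ≤ C * ‖A‖ + η₁ := (hhess z).trans (by linarith)
    calc ‖hess m h z‖ ^ p ≤ (C * ‖A‖ + η₁) ^ p := by gcongr
      _ ≤ 2 ^ p * ((C * ‖A‖) ^ p + η₁ ^ p) :=
          add_rpow_le_two_rpow (by positivity) hη₁pos.le hp0
      _ = 2 ^ p * C ^ p * ‖A‖ ^ p + 2 ^ p * η₁ ^ p := by
          rw [Real.mul_rpow hC0 (norm_nonneg _)]; ring
      _ ≤ 2 ^ p * C ^ p * cost K ρ p M N A + 2 ^ p * η₁ := by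
          have h2 := le_cost (ρ := ρ) (p := p) hM1 hN1 hx₀
          have h3 : η₁ ^ p ≤ η₁ := by
            simpa using Real.rpow_le_rpow_of_exponent_ge hη₁pos hη₁1 P.hp
          gcongr
      _ ≤ _ := by linarith

/-- The perturbation in a small ball centred at a typical point. -/
lemma ae_exists_step {K m ρ p q κ κ' M N C : ℝ} (P : StairParams K m ρ p q κ κ' M N C)
    (hq : 0 ≤ q) {w : Plane → ℝ} (hw : Smooth w) {R : ℝ} (hR : ∀ z, ‖hess m w z‖ ≤ R)
    {η : ℝ} (hη : 0 < η) :
    ∀ᵐ x₀ : Plane, ∃ r₀ > 0, ∀ r, 0 < r → r < r₀ → ∃ h : Plane → ℝ, Smooth h ∧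
      tsupport h ⊆ Metric.ball x₀ r ∧ (∀ z, |pd 0 h z| ≤ η) ∧
      ∫ z in Metric.closedBall x₀ r, cost K ρ p M N (hess m w z + hess m h z) ≤
        κ * (∫ z in Metric.closedBall x₀ r, cost K ρ p M N (hess m w z)) +
          η * volume.real (Metric.closedBall x₀ r) ∧
      κ' * (∫ z in Metric.closedBall x₀ r, gain K ρ q (hess m w z)) -
          η * volume.real (Metric.closedBall x₀ r) ≤
        ∫ z in Metric.closedBall x₀ r, gain K ρ q (hess m w z + hess m h z) ∧
      ∫ z in Metric.closedBall x₀ r, ‖hess m h z‖ ^ p ≤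
        2 ^ p * C ^ p * (∫ z in Metric.closedBall x₀ r, cost K ρ p M N (hess m w z)) +
          η * volume.real (Metric.closedBall x₀ r) := by
  have hM0 : 0 ≤ M := by linarith [P.hM1]
  have hN0 : 0 ≤ N := by linarith [P.hN1]
  have hp0 : 0 ≤ p := by linarith [P.hp]
  have hC0 : 0 ≤ C := by
    have := P.hC; have := P.hK; have := P.hm; have := sq_nonneg ρ; linarith
  have hm1 : Measurable fun z => cost K ρ p M N (hess m w z) :=
    (measurable_cost K ρ p M N).comp (continuous_hess hw).measurable
  have hm2 : Measurable fun z => gain K ρ q (hess m w z) :=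
    (measurable_gain K ρ q).comp (continuous_hess hw).measurable
  set D := 2 ^ p * C ^ p with hD
  have hD0 : 0 ≤ D := by positivity
  have hκ0 := P.hκ0
  have hκ1 := P.hκ
  have hκ' := P.hκ'
  set η₁ := η / (2 + D + κ') with hη₁
  have hη₁pos : 0 < η₁ := by positivity
  have hη₁e : η₁ * (2 + D + κ') = η := by rw [hη₁]; field_simp
  have hη₁D : 0 ≤ η₁ * D := by positivity
  have hη₁κ : 0 ≤ η₁ * κ' := by positivity
  filter_upwards [ae_lebesgue_point hm1 (fun z => cost_nonneg hM0 hN0 _)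
      (fun z => cost_le P.hM1 P.hN1 hp0 (hR z)),
    ae_lebesgue_point hm2 (fun z => gain_nonneg _ _ _ _) (fun z => gain_le_norm hq (hR z))]
    with x₀ hL1 hL2
  obtain ⟨r₁, hr₁, hL1⟩ := hL1 η₁ hη₁pos
  obtain ⟨r₂, hr₂, hL2⟩ := hL2 η₁ hη₁pos
  -- If the inclusion already holds at the centre, no perturbation is made: `cost` and `gain` vanish
  -- there, so their means on small balls are negligible.
  by_cases hx₀ : hess m w x₀ ∈ phaseSet K
  · refine ⟨min r₁ r₂, lt_min hr₁ hr₂, fun r hr hrr => ?_⟩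
    specialize hL1 r hr (hrr.trans_le (min_le_left _ _))
    specialize hL2 r hr (hrr.trans_le (min_le_right _ _))
    simp only [cost_phase hx₀, gain_phase hx₀, zero_mul, sub_zero] at hL1 hL2
    have hV0 : 0 ≤ volume.real (Metric.closedBall x₀ r) := measureReal_nonneg
    have hz : ∀ z, hess m (fun _ => (0 : ℝ)) z = 0 := fun z =>
      hess_eq_zero_of_notMem (by simp [tsupport])
    have i1 : 0 ≤ ∫ z in Metric.closedBall x₀ r, cost K ρ p M N (hess m w z) :=
      setIntegral_nonneg measurableSet_closedBall fun z _ => cost_nonneg hM0 hN0 _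
    have i2 : 0 ≤ ∫ z in Metric.closedBall x₀ r, gain K ρ q (hess m w z) :=
      setIntegral_nonneg measurableSet_closedBall fun z _ => gain_nonneg _ _ _ _
    rw [abs_of_nonneg i1] at hL1
    rw [abs_of_nonneg i2] at hL2
    refine ⟨fun _ => 0, contDiff_const, by simp [tsupport], fun z => by simp [pd_const, hη.le],
      ?_, ?_, ?_⟩
    · simp only [hz, add_zero]
      have : η₁ * volume.real (Metric.closedBall x₀ r) ≤ η * volume.real (Metric.closedBall x₀ r) := by
        gcongr; linarith
      have : 0 ≤ κ * ∫ z in Metric.closedBall x₀ r, cost K ρ p M N (hess m w z) := by positivity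
      linarith
    · simp only [hz, add_zero]
      have h1 : κ' * (∫ z in Metric.closedBall x₀ r, gain K ρ q (hess m w z)) ≤
          κ' * (η₁ * volume.real (Metric.closedBall x₀ r)) := by gcongr
      have h2 : κ' * η₁ * volume.real (Metric.closedBall x₀ r) ≤
          η * volume.real (Metric.closedBall x₀ r) := by
        gcongr; linarith
      linarith
    · simp only [hz, norm_zero]
      rw [Real.zero_rpow (by linarith [P.hp])]
      simp only [integral_zero]
      positivity
  · obtain ⟨r₃, hr₃, hstep⟩ := exists_local_step P hq hw hR hx₀ hη₁pos
    refine ⟨min (min r₁ r₂) r₃, by positivity, fun r hr hrr => ?_⟩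
    specialize hL1 r hr (hrr.trans_le ((min_le_left _ _).trans (min_le_left _ _)))
    specialize hL2 r hr (hrr.trans_le ((min_le_left _ _).trans (min_le_right _ _)))
    obtain ⟨h, hh, hsupp, hpd, hc, hg, hs⟩ := hstep r hr (hrr.trans_le (min_le_right _ _))
    have hV0 : 0 ≤ volume.real (Metric.closedBall x₀ r) := measureReal_nonneg
    set V := volume.real (Metric.closedBall x₀ r)
    have hηV : η * V = 2 * (η₁ * V) + η₁ * D * V + η₁ * κ' * V := by rw [← hη₁e]; ring
    have p1 : 0 ≤ η₁ * V := by positivity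
    have p2 : 0 ≤ η₁ * D * V := by positivity
    have p3 : 0 ≤ η₁ * κ' * V := by positivity
    set I := ∫ z in Metric.closedBall x₀ r, cost K ρ p M N (hess m w z)
    set J := ∫ z in Metric.closedBall x₀ r, gain K ρ q (hess m w z)
    have hcA : cost K ρ p M N (hess m w x₀) * V ≤ I + η₁ * V := by linarith [(abs_le.1 hL1).1]
    have hgA : J - η₁ * V ≤ gain K ρ q (hess m w x₀) * V := by linarith [(abs_le.1 hL2).2]
    refine ⟨h, hh, hsupp, fun z => (hpd z).trans (by linarith), ?_, ?_, ?_⟩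
    · have h1 : κ * (cost K ρ p M N (hess m w x₀) * V) ≤ κ * (I + η₁ * V) := by gcongr
      have h2 : κ * (η₁ * V) ≤ 1 * (η₁ * V) := by gcongr
      linarith
    · have h1 : κ' * (J - η₁ * V) ≤ κ' * (gain K ρ q (hess m w x₀) * V) := by gcongr
      linarith
    · have h1 : ∫ z in Metric.closedBall x₀ r, ‖hess m h z‖ ^ p ≤
          (D * cost K ρ p M N (hess m w x₀) + η₁) * V := by
        have hc : Continuous fun z => ‖hess m h z‖ ^ p :=
          (continuous_hess hh).norm.rpow_const fun z => Or.inr hp0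
        have hi : IntegrableOn (fun z => ‖hess m h z‖ ^ p) (Metric.closedBall x₀ r) :=
          hc.continuousOn.integrableOn_compact (isCompact_closedBall x₀ r)
        have := setIntegral_mono_on hi (integrableOn_const
          (C := D * cost K ρ p M N (hess m w x₀) + η₁) measure_closedBall_lt_top.ne)
          measurableSet_closedBall (fun z _ => hs z)
        rw [setIntegral_const, smul_eq_mul] at this
        linarith
      have h2 : D * (cost K ρ p M N (hess m w x₀) * V) ≤ D * (I + η₁ * V) := by gcongr
      linarith

/-- Almost all of an open set is filled by finitely many disjoint small balls with a given
property that holds for all small balls around almost every point. -/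
lemma exists_finite_ball_packing {Ω : Set Plane} (hΩ : IsOpen Ω) (hfin : volume Ω ≠ ∞)
    {good : Plane → ℝ → Prop}
    (hgood : ∀ᵐ x₀ : Plane, ∃ r₀ > 0, ∀ r, 0 < r → r < r₀ → good x₀ r) {ε : ℝ} (hε : 0 < ε) :
    ∃ (t : Finset Plane) (r : Plane → ℝ), (∀ x ∈ t, good x (r x)) ∧
      (∀ x ∈ t, Metric.closedBall x (r x) ⊆ Ω) ∧
      (t : Set Plane).PairwiseDisjoint (fun x => Metric.closedBall x (r x)) ∧
      volume.real (Ω \ ⋃ x ∈ t, Metric.closedBall x (r x)) ≤ ε := by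
  let G : Set Plane := {x | x ∈ Ω ∧ ∃ r₀ > 0, ∀ r, 0 < r → r < r₀ → good x r}
  have hGΩ : G ⊆ Ω := fun x hx => hx.1
  have hnull : volume (Ω \ G) = 0 := by
    refine measure_mono_null ?_ hgood
    intro x hx hx'
    exact hx.2 ⟨hx.1, hx'⟩
  have hball : ∀ x : Plane, ∃ ρ > 0, x ∈ Ω → Metric.closedBall x ρ ⊆ Ω := by
    intro x
    by_cases hx : x ∈ Ω
    · obtain ⟨ρ, hρ, h⟩ := Metric.nhds_basis_closedBall.mem_iff.1 (hΩ.mem_nhds hx)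
      exact ⟨ρ, hρ, fun _ => h⟩
    · exact ⟨1, one_pos, fun h => absurd h hx⟩
  choose Rb hRb hRbΩ using hball
  obtain ⟨t, r, htc, htG, hr, hcov, hdisj⟩ :=
    Besicovitch.exists_disjoint_closedBall_covering_ae (volume : Measure Plane)
      (fun x => {r | good x r}) G (by
        rintro x ⟨-, r₀, hr₀, h⟩ δ hδ
        refine ⟨min r₀ δ / 2, h _ (by positivity) ?_, by positivity, ?_⟩
        · have := min_le_left r₀ δ
          have : 0 < min r₀ δ := lt_min hr₀ hδ
          linarith
        · have := min_le_right r₀ δ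
          have : 0 < min r₀ δ := lt_min hr₀ hδ
          linarith) Rb (fun x _ => hRb x)
  have htΩ : ∀ x ∈ t, Metric.closedBall x (r x) ⊆ Ω := fun x hx =>
    (Metric.closedBall_subset_closedBall (hr x hx).2.2.le).trans (hRbΩ x (hGΩ (htG hx)))
  have : Countable t := htc.to_subtype
  have hUΩ : (⋃ x : t, Metric.closedBall (x : Plane) (r x)) ⊆ Ω :=
    Set.iUnion_subset fun x => htΩ x x.2
  have hmeasU : volume Ω ≤ volume (⋃ x : t, Metric.closedBall (x : Plane) (r x)) := by
    have h1 : Ω ⊆ (⋃ x : t, Metric.closedBall (x : Plane) (r x)) ∪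
        ((G \ ⋃ x ∈ t, Metric.closedBall x (r x)) ∪ (Ω \ G)) := by
      intro x hx
      by_cases hxU : x ∈ ⋃ x : t, Metric.closedBall (x : Plane) (r x)
      · exact Or.inl hxU
      · right
        by_cases hxG : x ∈ G
        · left
          refine ⟨hxG, fun h => hxU ?_⟩
          simpa [Set.mem_iUnion] using h
        · exact Or.inr ⟨hx, hxG⟩
    refine (measure_mono h1).trans ((measure_union_le _ _).trans ?_)
    have h2 : volume ((G \ ⋃ x ∈ t, Metric.closedBall x (r x)) ∪ (Ω \ G)) = 0 :=
      measure_union_null hcov hnull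
    rw [h2, add_zero]
  have hsum : volume (⋃ x : t, Metric.closedBall (x : Plane) (r x)) =
      ∑' x : t, volume (Metric.closedBall (x : Plane) (r x)) := by
    refine measure_iUnion ?_ fun x => measurableSet_closedBall
    intro x y hxy
    exact hdisj x.2 y.2 (fun h => hxy (Subtype.ext h))
  have hUfin : volume (⋃ x : t, Metric.closedBall (x : Plane) (r x)) ≠ ∞ :=
    ne_top_of_le_ne_top hfin (measure_mono hUΩ)
  -- A finite part of the covering loses only the tail of a convergent series. Finiteness keeps the
  -- sum of the perturbations smooth with compact support in `Ω`.
  obtain ⟨u, hu⟩ : ∃ u : Finset t, volume (⋃ x : t, Metric.closedBall (x : Plane) (r x)) <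
      ∑ x ∈ u, volume (Metric.closedBall (x : Plane) (r x)) + ENNReal.ofReal ε := by
    have ht : Tendsto (fun u : Finset t => ∑ x ∈ u, volume (Metric.closedBall (x : Plane) (r x))
        + ENNReal.ofReal ε) atTop (𝓝 (volume (⋃ x : t, Metric.closedBall (x : Plane) (r x))
        + ENNReal.ofReal ε)) := by
      rw [hsum]
      exact Tendsto.add (by simpa [HasSum] using ENNReal.summable.hasSum) tendsto_const_nhds
    exact (ht.eventually_const_lt (ENNReal.lt_add_right hUfin (by simpa using hε))).exists
  classical
  let s : Finset Plane := u.map (Function.Embedding.subtype _)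
  have hst : ∀ x ∈ s, x ∈ t := by
    intro x hx
    simp only [s, Finset.mem_map, Function.Embedding.subtype_apply] at hx
    obtain ⟨y, -, rfl⟩ := hx
    exact y.2
  refine ⟨s, r, fun x hx => (hr x (hst x hx)).1, fun x hx => htΩ x (hst x hx),
    fun x hx y hy hxy => hdisj (hst x hx) (hst y hy) hxy, ?_⟩
  have hsv : volume (⋃ x ∈ s, Metric.closedBall x (r x)) =
      ∑ x ∈ u, volume (Metric.closedBall (x : Plane) (r x)) := by
    rw [measure_biUnion_finset (fun x hx y hy hxy => hdisj (hst x hx) (hst y hy) hxy)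
      (fun x _ => measurableSet_closedBall)]
    simp [s]
  have hsub : (⋃ x ∈ s, Metric.closedBall x (r x)) ⊆ Ω :=
    Set.iUnion₂_subset fun x hx => htΩ x (hst x hx)
  have hsm : MeasurableSet (⋃ x ∈ s, Metric.closedBall x (r x)) :=
    s.measurableSet_biUnion fun x _ => measurableSet_closedBall
  refine ENNReal.toReal_le_of_le_ofReal hε.le ?_
  rw [measure_sdiff hsub hsm.nullMeasurableSet (ne_top_of_le_ne_top hfin (measure_mono hsub)), hsv,
    tsub_le_iff_left]
  exact hmeasU.trans hu.le

lemma setIntegral_eq_sum_add {Ω : Set Plane} (hΩ : MeasurableSet Ω) {f : Plane → ℝ}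
    (hf : IntegrableOn f Ω) {t : Finset Plane} {Q : Plane → Set Plane}
    (hQm : ∀ x ∈ t, MeasurableSet (Q x)) (hQ : ∀ x ∈ t, Q x ⊆ Ω)
    (hd : (t : Set Plane).PairwiseDisjoint Q) :
    ∫ z in Ω, f z = ∑ x ∈ t, (∫ z in Q x, f z) + ∫ z in Ω \ ⋃ x ∈ t, Q x, f z := by
  have hm : MeasurableSet (⋃ x ∈ t, Q x) := t.measurableSet_biUnion hQm
  have hsub : (⋃ x ∈ t, Q x) ⊆ Ω := Set.iUnion₂_subset hQ
  rw [← integral_biUnion_finset t hQm hd (fun x hx => hf.mono_set (hQ x hx))]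
  rw [← setIntegral_union Set.disjoint_sdiff_right (hΩ.diff hm) (hf.mono_set hsub)
    (hf.mono_set Set.sdiff_subset), Set.union_sdiff_cancel hsub]

/-- One step of the construction. -/
theorem exists_step {K m ρ p q κ κ' M N C : ℝ} (P : StairParams K m ρ p q κ κ' M N C)
    (hq : 0 ≤ q) {Ω : Set Plane} (hΩ : IsOpen Ω) (hfin : volume Ω ≠ ∞) {w : Plane → ℝ}
    (hw : Smooth w) {R : ℝ} (hR : ∀ z, ‖hess m w z‖ ≤ R) {η : ℝ} (hη : 0 < η) :
    ∃ h : Plane → ℝ, IsTestFunction Ω h ∧ (∀ z, |pd 0 h z| ≤ η) ∧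
      ∫ z in Ω, cost K ρ p M N (hess m w z + hess m h z) ≤
        κ * (∫ z in Ω, cost K ρ p M N (hess m w z)) + η ∧
      κ' * (∫ z in Ω, gain K ρ q (hess m w z)) - η ≤
        ∫ z in Ω, gain K ρ q (hess m w z + hess m h z) ∧
      ∫ z in Ω, ‖hess m h z‖ ^ p ≤
        2 ^ p * C ^ p * (∫ z in Ω, cost K ρ p M N (hess m w z)) + η := by
  have hM0 : 0 ≤ M := by linarith [P.hM1]
  have hN0 : 0 ≤ N := by linarith [P.hN1]
  have hp0 : 0 ≤ p := by linarith [P.hp]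
  have hC0 : 0 ≤ C := by
    have := P.hC; have := P.hK; have := P.hm; have := sq_nonneg ρ; linarith
  have hR0 : 0 ≤ R := (norm_nonneg _).trans (hR 0)
  have hκ0 := P.hκ0
  have hκ'0 : 0 < κ' := by linarith [P.hκ']
  set b := (M + N) * R ^ p with hb
  set b' := R ^ q with hb'
  have hb0 : 0 ≤ b := by positivity
  have hb'0 : 0 ≤ b' := by positivity
  set v := volume.real Ω with hv
  have hv0 : 0 ≤ v := measureReal_nonneg
  -- The budget: `η₁ * v` for the errors in the balls, `η₁ * b` and `η₁ * (κ' * b')` for the cost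
  -- kept and the gain lost on the uncovered set.
  set η₁ := η / (1 + v + b + κ' * b') with hη₁
  have hden : 1 ≤ 1 + v + b + κ' * b' := by
    have : 0 ≤ κ' * b' := by positivity
    linarith
  have hη₁pos : 0 < η₁ := by positivity
  have hη₁η : η₁ ≤ η := div_le_self hη.le hden
  have hη₁e : η = η₁ + η₁ * v + η₁ * b + η₁ * (κ' * b') := by
    rw [hη₁]; field_simp
  have n1 : 0 ≤ η₁ * v := by positivity
  have n2 : 0 ≤ η₁ * b := by positivity
  have n3 : 0 ≤ η₁ * (κ' * b') := by positivity
  obtain ⟨t, r, hgood, htΩ, hdisj, hrest⟩ :=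
    exists_finite_ball_packing hΩ hfin (ae_exists_step P hq hw hR hη₁pos) hη₁pos
  choose! h hhs hsupp hpd hcost hgain hpow using hgood
  set Q : Plane → Set Plane := fun x => Metric.closedBall x (r x) with hQ
  set D := Ω \ ⋃ x ∈ t, Q x with hD
  have hDm : MeasurableSet D :=
    hΩ.measurableSet.diff (t.measurableSet_biUnion fun x _ => measurableSet_closedBall)
  have hDfin : volume D ≠ ∞ := ne_top_of_le_ne_top hfin (measure_mono Set.sdiff_subset)
  have htest : ∀ x ∈ t, IsTestFunction Ω (h x) := by
    intro x hx
    have hs : tsupport (h x) ⊆ Q x := (hsupp x hx).trans Metric.ball_subset_closedBall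
    exact ⟨hhs x hx, HasCompactSupport.of_support_subset_isCompact (isCompact_closedBall x (r x))
      ((subset_tsupport _).trans hs), hs.trans (htΩ x hx)⟩
  have hnot : ∀ x ∈ t, ∀ y ∈ t, x ≠ y → ∀ z ∈ Q x, z ∉ tsupport (h y) := by
    intro x hx y hy hxy z hz hz'
    exact Set.disjoint_left.1 (hdisj hx hy hxy) hz
      (Metric.ball_subset_closedBall (hsupp y hy hz'))
  have hnotD : ∀ z, z ∉ ⋃ x ∈ t, Q x → ∀ y ∈ t, z ∉ tsupport (h y) := by
    intro z hz y hy hz'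
    exact hz (Set.mem_biUnion hy (Metric.ball_subset_closedBall (hsupp y hy hz')))
  set H : Plane → ℝ := fun z => ∑ x ∈ t, h x z with hH
  have hHt : IsTestFunction Ω H := IsTestFunction.sum t htest
  have hHh : ∀ z, hess m H z = ∑ x ∈ t, hess m (h x) z :=
    fun z => congrFun (hess_sum t hhs) z
  have hHp : ∀ z, pd 0 H z = ∑ x ∈ t, pd 0 (h x) z :=
    fun z => congrFun (pd_sum t (fun x hx => (hhs x hx).differentiable) 0) z
  have hHQ : ∀ x ∈ t, ∀ z ∈ Q x, hess m H z = hess m (h x) z := by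
    intro x hx z hz
    rw [hHh z]
    exact Finset.sum_eq_single_of_mem x hx fun y hy hyx =>
      hess_eq_zero_of_notMem (hnot x hx y hy hyx.symm z hz)
  have hHD : ∀ z, z ∉ ⋃ x ∈ t, Q x → hess m H z = 0 := by
    intro z hz
    rw [hHh z]
    exact Finset.sum_eq_zero fun y hy => hess_eq_zero_of_notMem (hnotD z hz y hy)
  have hQm : ∀ x ∈ t, MeasurableSet (Q x) := fun x _ => measurableSet_closedBall
  have hsumV : ∑ x ∈ t, volume.real (Q x) ≤ v := by
    rw [← measureReal_biUnion_finset hdisj hQm (fun x _ => measure_closedBall_lt_top.ne)]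
    exact measureReal_mono (Set.iUnion₂_subset htΩ) hfin
  -- boundedness and integrability
  have hHc : Continuous (hess m H) := continuous_hess hHt.1
  have hwc : Continuous (hess m w) := continuous_hess hw
  obtain ⟨L, hL⟩ : ∃ L, ∀ z, ‖hess m H z‖ ≤ L := by
    have hc : HasCompactSupport (hess m H) := by
      refine HasCompactSupport.of_support_subset_isCompact hHt.2.1 ?_
      intro z hz
      by_contra h'
      exact hz (hess_eq_zero_of_notMem h')
    exact hHc.bounded_above_of_compact_support hc
  have hnew : ∀ z, ‖hess m w z + hess m H z‖ ≤ R + L := fun z =>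
    (norm_add_le _ _).trans (add_le_add (hR z) (hL z))
  have hnm : Measurable fun z => hess m w z + hess m H z := (hwc.add hHc).measurable
  have I1 : IntegrableOn (fun z => cost K ρ p M N (hess m w z)) Ω :=
    integrableOn_of_bounded ((measurable_cost K ρ p M N).comp hwc.measurable) hfin
      (fun z => cost_nonneg hM0 hN0 _) (fun z => cost_le P.hM1 P.hN1 hp0 (hR z))
  have I2 : IntegrableOn (fun z => gain K ρ q (hess m w z)) Ω :=
    integrableOn_of_bounded ((measurable_gain K ρ q).comp hwc.measurable) hfin
      (fun z => gain_nonneg _ _ _ _) (fun z => gain_le_norm hq (hR z))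
  have I3 : IntegrableOn (fun z => cost K ρ p M N (hess m w z + hess m H z)) Ω :=
    integrableOn_of_bounded ((measurable_cost K ρ p M N).comp hnm) hfin
      (fun z => cost_nonneg hM0 hN0 _) (fun z => cost_le P.hM1 P.hN1 hp0 (hnew z))
  have I4 : IntegrableOn (fun z => gain K ρ q (hess m w z + hess m H z)) Ω :=
    integrableOn_of_bounded ((measurable_gain K ρ q).comp hnm) hfin
      (fun z => gain_nonneg _ _ _ _) (fun z => gain_le_norm hq (hnew z))
  have I5 : IntegrableOn (fun z => ‖hess m H z‖ ^ p) Ω :=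
    integrableOn_of_bounded (hHc.measurable.norm.pow_const p) hfin
      (fun z => by positivity) (b := L ^ p)
      (fun z => Real.rpow_le_rpow (norm_nonneg _) (hL z) hp0)
  have s1 := setIntegral_eq_sum_add hΩ.measurableSet I1 hQm htΩ hdisj
  have s2 := setIntegral_eq_sum_add hΩ.measurableSet I2 hQm htΩ hdisj
  have s3 := setIntegral_eq_sum_add hΩ.measurableSet I3 hQm htΩ hdisj
  have s4 := setIntegral_eq_sum_add hΩ.measurableSet I4 hQm htΩ hdisj
  have s5 := setIntegral_eq_sum_add hΩ.measurableSet I5 hQm htΩ hdisj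
  rw [← hD] at s1 s2 s3 s4 s5
  have hD1 : 0 ≤ ∫ z in D, cost K ρ p M N (hess m w z) :=
    setIntegral_nonneg hDm fun z _ => cost_nonneg hM0 hN0 _
  have q3 : ∫ z in D, cost K ρ p M N (hess m w z + hess m H z) ≤ η₁ * b := by
    have h1 := setIntegral_mono_on (I3.mono_set Set.sdiff_subset)
      (integrableOn_const (C := b) hDfin) hDm (fun z hz => by
        rw [hHD z hz.2, add_zero]; exact cost_le P.hM1 P.hN1 hp0 (hR z))
    rw [setIntegral_const, smul_eq_mul] at h1
    refine h1.trans ?_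
    gcongr
  have q2 : ∫ z in D, gain K ρ q (hess m w z) ≤ η₁ * b' := by
    have h1 := setIntegral_mono_on (I2.mono_set Set.sdiff_subset)
      (integrableOn_const (C := b') hDfin) hDm (fun z hz => gain_le_norm hq (hR z))
    rw [setIntegral_const, smul_eq_mul] at h1
    refine h1.trans ?_
    gcongr
  have q4 : 0 ≤ ∫ z in D, gain K ρ q (hess m w z + hess m H z) :=
    setIntegral_nonneg hDm fun z _ => gain_nonneg _ _ _ _
  have q5 : ∫ z in D, ‖hess m H z‖ ^ p = 0 := by
    rw [setIntegral_congr_fun hDm (g := fun _ => 0)]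
    · simp
    · intro z hz
      simp only [hHD z hz.2, norm_zero]
      exact Real.zero_rpow (by linarith [P.hp])
  have c3 : ∑ x ∈ t, (∫ z in Q x, cost K ρ p M N (hess m w z + hess m H z)) ≤
      κ * ∑ x ∈ t, (∫ z in Q x, cost K ρ p M N (hess m w z)) + η₁ * v := by
    calc _ ≤ ∑ x ∈ t, (κ * (∫ z in Q x, cost K ρ p M N (hess m w z)) + η₁ * volume.real (Q x)) := by
          refine Finset.sum_le_sum fun x hx => ?_
          rw [setIntegral_congr_fun (hQm x hx)
            (g := fun z => cost K ρ p M N (hess m w z + hess m (h x) z))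
            (fun z hz => by simp only [hHQ x hx z hz])]
          exact hcost x hx
      _ = κ * ∑ x ∈ t, (∫ z in Q x, cost K ρ p M N (hess m w z)) +
            η₁ * ∑ x ∈ t, volume.real (Q x) := by
          rw [Finset.sum_add_distrib, Finset.mul_sum, Finset.mul_sum]
      _ ≤ _ := by gcongr
  have c4 : κ' * ∑ x ∈ t, (∫ z in Q x, gain K ρ q (hess m w z)) - η₁ * v ≤
      ∑ x ∈ t, (∫ z in Q x, gain K ρ q (hess m w z + hess m H z)) := by
    calc _ ≤ κ' * ∑ x ∈ t, (∫ z in Q x, gain K ρ q (hess m w z)) -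
            η₁ * ∑ x ∈ t, volume.real (Q x) := by gcongr
      _ = ∑ x ∈ t, (κ' * (∫ z in Q x, gain K ρ q (hess m w z)) - η₁ * volume.real (Q x)) := by
          rw [Finset.sum_sub_distrib, Finset.mul_sum, Finset.mul_sum]
      _ ≤ _ := by
          refine Finset.sum_le_sum fun x hx => ?_
          rw [setIntegral_congr_fun (hQm x hx)
            (f := fun z => gain K ρ q (hess m w z + hess m H z))
            (g := fun z => gain K ρ q (hess m w z + hess m (h x) z))
            (fun z hz => by simp only [hHQ x hx z hz])]
          exact hgain x hx
  have c5 : ∑ x ∈ t, (∫ z in Q x, ‖hess m H z‖ ^ p) ≤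
      2 ^ p * C ^ p * ∑ x ∈ t, (∫ z in Q x, cost K ρ p M N (hess m w z)) + η₁ * v := by
    calc _ ≤ ∑ x ∈ t, (2 ^ p * C ^ p * (∫ z in Q x, cost K ρ p M N (hess m w z)) +
            η₁ * volume.real (Q x)) := by
          refine Finset.sum_le_sum fun x hx => ?_
          rw [setIntegral_congr_fun (hQm x hx) (g := fun z => ‖hess m (h x) z‖ ^ p)
            (fun z hz => by simp only [hHQ x hx z hz])]
          exact hpow x hx
      _ = 2 ^ p * C ^ p * ∑ x ∈ t, (∫ z in Q x, cost K ρ p M N (hess m w z)) +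
            η₁ * ∑ x ∈ t, volume.real (Q x) := by
          rw [Finset.sum_add_distrib, Finset.mul_sum, Finset.mul_sum]
      _ ≤ _ := by gcongr
  refine ⟨H, hHt, ?_, ?_, ?_, ?_⟩
  · intro z
    rw [hHp z]
    by_cases hz : z ∈ ⋃ x ∈ t, Q x
    · obtain ⟨x, hx, hzx⟩ := Set.mem_iUnion₂.1 hz
      rw [Finset.sum_eq_single_of_mem x hx fun y hy hyx =>
        pd_eq_zero_of_notMem (hnot x hx y hy hyx.symm z hzx) 0]
      exact (hpd x hx z).trans hη₁η
    · rw [Finset.sum_eq_zero fun y hy => pd_eq_zero_of_notMem (hnotD z hz y hy) 0, abs_zero]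
      exact hη.le
  · rw [s3, s1, mul_add]
    have : 0 ≤ κ * ∫ z in D, cost K ρ p M N (hess m w z) := by positivity
    linarith
  · rw [s4, s2, mul_add]
    have : κ' * ∫ z in D, gain K ρ q (hess m w z) ≤ κ' * (η₁ * b') := by gcongr
    linarith
  · rw [s5, s1, q5, mul_add]
    have : 0 ≤ 2 ^ p * C ^ p * ∫ z in D, cost K ρ p M N (hess m w z) := by positivity
    linarith

/-! ### The approximating sequence -/

lemma le_geometric_of_le_mul_add {c ε : ℕ → ℝ} {κ : ℝ} (hκ0 : 0 < κ) (hκ : κ < 1)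
    (hc0 : 0 ≤ c 0) (hc : ∀ k, c (k + 1) ≤ κ * c k + ε k) (hε : ∀ k, ε k ≤ (1 / 2) ^ k) :
    ∃ B r : ℝ, 0 ≤ B ∧ 0 < r ∧ r < 1 ∧ ∀ k, c k ≤ B * r ^ k ∧ ε k ≤ r ^ k := by
  have hmax : max κ (1 / 2) < 1 := max_lt hκ (by norm_num)
  have h1 := le_max_left κ (1 / 2)
  have h2 := le_max_right κ (1 / 2)
  have hpow : ∀ k : ℕ, (1 / 2 : ℝ) ^ k ≤ ((1 + max κ (1 / 2)) / 2) ^ k := fun k =>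
    pow_le_pow_left₀ (by norm_num) (by linarith) k
  have hdiv : 0 ≤ 2 / (1 - κ) := div_nonneg (by norm_num) (by linarith)
  refine ⟨c 0 + 2 / (1 - κ), (1 + max κ (1 / 2)) / 2, by positivity, by linarith, by linarith,
    fun k => ⟨?_, (hε k).trans (hpow k)⟩⟩
  set r := (1 + max κ (1 / 2)) / 2 with hr
  induction k with
  | zero => simpa using hdiv
  | succ k ih =>
    have h3 : ε k ≤ r ^ k := (hε k).trans (hpow k)
    have h4 : 1 ≤ (c 0 + 2 / (1 - κ)) * (r - κ) := by
      calc (1 : ℝ) = 2 / (1 - κ) * ((1 - κ) / 2) := by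
            have : 1 - κ ≠ 0 := by linarith
            field_simp
        _ ≤ (c 0 + 2 / (1 - κ)) * (r - κ) := by
            gcongr
            · linarith
            · linarith
    have h5 : 0 ≤ r ^ k := by
      have : 0 ≤ r := by linarith
      positivity
    calc c (k + 1) ≤ κ * c k + ε k := hc k
      _ ≤ κ * ((c 0 + 2 / (1 - κ)) * r ^ k) + r ^ k := by gcongr
      _ ≤ κ * ((c 0 + 2 / (1 - κ)) * r ^ k) + (c 0 + 2 / (1 - κ)) * (r - κ) * r ^ k := by
          nlinarith
      _ = (c 0 + 2 / (1 - κ)) * r ^ (k + 1) := by ring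

/-- Errors of at most half of the first increment leave geometric growth at the rate `(1 + κ) / 2`.
-/
lemma tendsto_atTop_of_mul_sub_le {g ε : ℕ → ℝ} {κ : ℝ} (hκ : 1 < κ) (hg0 : 0 < g 0)
    (hg : ∀ k, κ * g k - ε k ≤ g (k + 1)) (hε : ∀ k, ε k ≤ (κ - 1) / 2 * g 0) :
    Tendsto g atTop atTop := by
  have h : ∀ k, ((1 + κ) / 2) ^ k * g 0 ≤ g k := by
    intro k
    induction k with
    | zero => simp
    | succ k ih =>
      have h1 : 1 ≤ ((1 + κ) / 2) ^ k := one_le_pow₀ (by linarith)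
      have h2 : κ * (((1 + κ) / 2) ^ k * g 0) ≤ κ * g k := by gcongr
      have h3 : (κ - 1) / 2 * g 0 ≤ (κ - 1) / 2 * g 0 * ((1 + κ) / 2) ^ k :=
        le_mul_of_one_le_right (mul_nonneg (by linarith) hg0.le) h1
      have h4 := hg k
      have h5 := hε k
      calc ((1 + κ) / 2) ^ (k + 1) * g 0 =
            κ * (((1 + κ) / 2) ^ k * g 0) - (κ - 1) / 2 * g 0 * ((1 + κ) / 2) ^ k := by ring
        _ ≤ g (k + 1) := by linarith
  exact tendsto_atTop_mono h
    ((tendsto_pow_atTop_atTop_of_one_lt (by linarith)).atTop_mul_const hg0)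

lemma exists_norm_hess_le {Ω : Set Plane} {h : Plane → ℝ} (hh : IsTestFunction Ω h) (m : ℝ) :
    ∃ R, ∀ z, ‖hess m h z‖ ≤ R := by
  refine (continuous_hess hh.1).bounded_above_of_compact_support
    (HasCompactSupport.of_support_subset_isCompact hh.2.1 fun z hz => ?_)
  by_contra h'
  exact hz (hess_eq_zero_of_notMem h')

lemma infDist_phaseSet_rpow_le_cost {K ρ p M N : ℝ} (hM : 1 ≤ M) (hN : 1 ≤ N) (hp : 1 ≤ p)
    (A : ℝ × ℝ × ℝ) : Metric.infDist A (phaseSet K) ^ p ≤ cost K ρ p M N A := by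
  by_cases hA : A ∈ phaseSet K
  · rw [Metric.infDist_zero_of_mem hA, cost_phase hA, Real.zero_rpow (by linarith)]
  · refine le_trans ?_ (le_cost hM hN hA)
    have h0 : (0 : ℝ × ℝ × ℝ) ∈ phaseSet K := Or.inl (by simp)
    have := Metric.infDist_le_dist_of_mem (x := A) h0
    rw [dist_zero_right] at this
    exact Real.rpow_le_rpow Metric.infDist_nonneg this (by linarith)

/-- The approximating sequence: smooth functions with affine boundary values, whose second
derivatives converge geometrically and approach `phaseSet K`, while the `2K/(K+1)`-energy blows
up. The functional `F` is arbitrary; the oscillation after step `k` is small compared to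
`F (H k)`. -/
theorem exists_sequence {K m p : ℝ} (hK : 1 < K) (hm : 0 < m) (hp : 1 ≤ p)
    (hpq : p < 2 * K / (K + 1)) {Ω : Set Plane} (hΩ : IsOpen Ω) (hfin : volume Ω ≠ ∞)
    (hne : Ω.Nonempty) (F : (Plane → ℝ) → ℝ) :
    ∃ (d : ℝ) (H : ℕ → Plane → ℝ) (ε : ℕ → ℝ) (B r : ℝ), 0 ≤ B ∧ 0 < r ∧ r < 1 ∧
      (∀ k, IsTestFunction Ω (H k)) ∧ Tendsto ε atTop (𝓝 0) ∧ (∀ k, ε k * |F (H k)| ≤ 1) ∧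
      (∀ k j, k ≤ j → ∀ x, |pd 0 (H j) x - pd 0 (H k) x| ≤ 2 * ε k) ∧
      (∀ k, ∫ x in Ω, ‖hess m (H (k + 1)) x - hess m (H k) x‖ ^ p ≤ B * r ^ k) ∧
      (∀ k, ∫ x in Ω, Metric.infDist ((1, 0, d) + hess m (H k) x) (phaseSet K) ^ p ≤ B * r ^ k) ∧
      Tendsto (fun k => ∫ x in Ω, |1 + pd 0 (pd 0 (H k)) x| ^ (2 * K / (K + 1))) atTop atTop := by
  obtain ⟨ρ, κ, κ', M, N, C, P⟩ := exists_stairParams hK hm hp hpq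
  set q := 2 * K / (K + 1) with hq
  have hq0 : 0 ≤ q := by positivity
  have hρ := P.hρ
  have hM0 : 0 ≤ M := by linarith [P.hM1]
  have hN0 : 0 ≤ N := by linarith [P.hN1]
  have hC0 : 0 ≤ C := by
    have := P.hC; have := sq_nonneg ρ; linarith
  -- The starting value lies on the staircase, so the initial gain is positive. Its first two
  -- entries are the gradient of `x₁`, the prescribed boundary datum.
  set A : ℝ × ℝ × ℝ := (1, 0, ρ) with hA
  have hAstair : A ∈ stairSet ρ := ⟨rfl, Or.inl (by simp [A])⟩
  have hAphase : A ∉ phaseSet K := by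
    rintro (h | ⟨h, -⟩)
    · simp only [A] at h; linarith
    · simp only [A] at h; nlinarith
  have hbase : ∀ x, hess m (quad 0 0 0 0 1 0 (ρ / m)) x = A := by
    intro x
    rw [hess_quad, mul_div_cancel₀ _ hm.ne']
  have hsum : ∀ H, Smooth H → ∀ x,
      hess m (fun x => quad 0 0 0 0 1 0 (ρ / m) x + H x) x = A + hess m H x := by
    intro H hH x
    simp only [hess_add (smooth_quad _ _ _ _ _ _ _) hH, hbase]
  set cI : (Plane → ℝ) → ℝ := fun H => ∫ z in Ω, cost K ρ p M N (A + hess m H z) with hcI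
  set gI : (Plane → ℝ) → ℝ := fun H => ∫ z in Ω, gain K ρ q (A + hess m H z) with hgI
  have step : ∀ H η, IsTestFunction Ω H → 0 < η → ∃ h, IsTestFunction Ω h ∧
      (∀ z, |pd 0 h z| ≤ η) ∧ cI (fun x => H x + h x) ≤ κ * cI H + η ∧
      κ' * gI H - η ≤ gI (fun x => H x + h x) ∧
      ∫ z in Ω, ‖hess m h z‖ ^ p ≤ 2 ^ p * C ^ p * cI H + η := by
    intro H η hH hη
    obtain ⟨R, hR⟩ := exists_norm_hess_le hH m
    obtain ⟨h, h1, h2, h3, h4, h5⟩ := exists_step P hq0 hΩ hfin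
      (w := fun x => quad 0 0 0 0 1 0 (ρ / m) x + H x) ((smooth_quad _ _ _ _ _ _ _).add hH.1)
      (R := ‖A‖ + R) (fun z => by
        rw [hsum H hH.1]
        exact (norm_add_le _ _).trans (by linarith [hR z])) hη
    refine ⟨h, h1, h2, ?_⟩
    simp only [hsum H hH.1, add_assoc] at h3 h4 h5
    simp only [hcI, hgI, hess_add hH.1 h1.1]
    exact ⟨h3, h4, h5⟩
  choose! f hft hfp hfc hfg hfn using step
  set g₀ := gI (fun _ => 0) with hg₀
  have hg₀pos : 0 < g₀ := by
    have hz : ∀ z, hess m (fun _ : Plane => (0 : ℝ)) z = 0 := by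
      intro z
      simp [hess, pd_const]
    simp only [hg₀, hgI, hz, add_zero, gain_of_stair hAstair hAphase, setIntegral_const,
      smul_eq_mul]
    have h1 : 0 < volume.real Ω := by
      rw [measureReal_def]
      exact ENNReal.toReal_pos (hΩ.measure_pos volume hne).ne' hfin
    have h2 : 0 < ‖A‖ := by
      rw [hA, norm_triple]
      exact lt_max_of_lt_left (by simp)
    positivity
  -- The three bounds serve the geometric decay of the cost, the growth of the gain, and the
  -- condition on `F` at the zeroth stage.
  set e₀ := min (min 1 ((κ' - 1) / 2 * g₀)) (1 / (1 + |F (fun _ => 0)|)) with he₀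
  have hκ' := P.hκ'
  have he₀pos : 0 < e₀ := by
    refine lt_min (lt_min one_pos (mul_pos (by linarith) hg₀pos)) (by positivity)
  -- The function and the next tolerance are built together: the tolerance is chosen after the
  -- function it refers to, and is at most half of the previous one.
  set s : ℕ → (Plane → ℝ) × ℝ := fun k => Nat.rec (fun _ => 0, e₀) (fun _ s =>
    (fun x => s.1 x + f s.1 s.2 x,
      min (s.2 / 2) (1 / (1 + |F (fun x => s.1 x + f s.1 s.2 x)|)))) k with hs
  set H : ℕ → Plane → ℝ := fun k => (s k).1 with hH
  set ε : ℕ → ℝ := fun k => (s k).2 with hε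
  have H0 : H 0 = fun _ => 0 := rfl
  have ε0 : ε 0 = e₀ := rfl
  have Hs : ∀ k, H (k + 1) = fun x => H k x + f (H k) (ε k) x := fun k => rfl
  have εs : ∀ k, ε (k + 1) = min (ε k / 2) (1 / (1 + |F (H (k + 1))|)) := fun k => rfl
  have hinv : ∀ k, IsTestFunction Ω (H k) ∧ 0 < ε k := by
    intro k
    induction k with
    | zero => exact ⟨IsTestFunction.zero Ω, he₀pos⟩
    | succ k ih =>
      refine ⟨?_, ?_⟩
      · rw [Hs]; exact ih.1.add (hft _ _ ih.1 ih.2)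
      · rw [εs]; have := ih.2; positivity
  have hεhalf : ∀ k, ε (k + 1) ≤ ε k / 2 := fun k => by rw [εs]; exact min_le_left _ _
  have hεe : ∀ k, ε k ≤ (1 / 2) ^ k * e₀ := by
    intro k
    induction k with
    | zero => simp [ε0]
    | succ k ih => rw [pow_succ]; linarith [hεhalf k]
  have hεpow : ∀ k, ε k ≤ (1 / 2) ^ k := fun k => (hεe k).trans
    (mul_le_of_le_one_right (by positivity) ((min_le_left _ _).trans (min_le_left _ _)))
  have hεg : ∀ k, ε k ≤ (κ' - 1) / 2 * g₀ := fun k =>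
    ((hεe k).trans (mul_le_of_le_one_left he₀pos.le (pow_le_one₀ (by norm_num) (by norm_num)))).trans
      ((min_le_left _ _).trans (min_le_right _ _))
  have hεF : ∀ k, ε k ≤ 1 / (1 + |F (H k)|) := by
    intro k
    cases k with
    | zero => rw [ε0, H0]; exact min_le_right _ _
    | succ k => rw [εs]; exact min_le_right _ _
  have hcI0 : ∀ k, 0 ≤ cI (H k) := fun k =>
    setIntegral_nonneg hΩ.measurableSet fun z _ => cost_nonneg hM0 hN0 _
  obtain ⟨B, r, hB, hr0, hr1, hBr⟩ := le_geometric_of_le_mul_add (c := fun k => cI (H k)) (ε := ε)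
    P.hκ0 P.hκ (hcI0 0) (fun k => by
      simpa only [Hs] using hfc _ _ (hinv k).1 (hinv k).2) hεpow
  have hgtop : Tendsto (fun k => gI (H k)) atTop atTop :=
    tendsto_atTop_of_mul_sub_le hκ' (ε := ε) hg₀pos (fun k => by
      simpa only [Hs] using hfg _ _ (hinv k).1 (hinv k).2) hεg
  have hint : ∀ k, ∃ R, ∀ z, ‖A + hess m (H k) z‖ ≤ R := by
    intro k
    obtain ⟨R, hR⟩ := exists_norm_hess_le (hinv k).1 m
    exact ⟨‖A‖ + R, fun z => (norm_add_le _ _).trans (by linarith [hR z])⟩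
  have hmeas : ∀ k, Measurable fun z => A + hess m (H k) z := fun k =>
    (continuous_const.add (continuous_hess (hinv k).1.1)).measurable
  have hCp : 0 ≤ 2 ^ p * C ^ p := by positivity
  refine ⟨ρ, H, ε, B + 2 ^ p * C ^ p * B + 1, r, by positivity, hr0, hr1, fun k => (hinv k).1,
    ?_, ?_, ?_, ?_, ?_, ?_⟩
  · exact squeeze_zero (fun k => (hinv k).2.le) hεpow
      (tendsto_pow_atTop_nhds_zero_of_lt_one (by norm_num) (by norm_num))
  · intro k
    have h1 : 0 < 1 + |F (H k)| := by positivity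
    have h2 := (le_div_iff₀ h1).1 (hεF k)
    have := (hinv k).2
    nlinarith
  · intro k j hkj x
    -- The sharper bound makes the induction telescope, since `ε j ≤ 2 * ε j - 2 * ε (j + 1)`.
    have : |pd 0 (H j) x - pd 0 (H k) x| ≤ 2 * ε k - 2 * ε j := by
      induction j, hkj using Nat.le_induction with
      | base => simp
      | succ j hkj ih =>
        have h1 : pd 0 (H (j + 1)) x = pd 0 (H j) x + pd 0 (f (H j) (ε j)) x := by
          rw [Hs, pd_add (Smooth.differentiable (hinv j).1.1)
            (Smooth.differentiable (hft _ _ (hinv j).1 (hinv j).2).1)]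
        have h2 := hfp _ _ (hinv j).1 (hinv j).2 x
        rw [h1]
        calc _ = |(pd 0 (H j) x - pd 0 (H k) x) + pd 0 (f (H j) (ε j)) x| := by ring_nf
          _ ≤ |pd 0 (H j) x - pd 0 (H k) x| + |pd 0 (f (H j) (ε j)) x| := abs_add_le _ _
          _ ≤ 2 * ε k - 2 * ε (j + 1) := by linarith [hεhalf j]
    linarith [(hinv j).2]
  · intro k
    have h1 : ∀ x, hess m (H (k + 1)) x - hess m (H k) x = hess m (f (H k) (ε k)) x := by
      intro x
      rw [Hs, hess_add (hinv k).1.1 (hft _ _ (hinv k).1 (hinv k).2).1]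
      simp
    simp only [h1]
    have hrk : 0 ≤ r ^ k := by positivity
    have h2 := hfn _ _ (hinv k).1 (hinv k).2
    have h3 := mul_le_mul_of_nonneg_left (hBr k).1 hCp
    have h4 := (hBr k).2
    have h5 : 0 ≤ B * r ^ k := by positivity
    linarith
  · intro k
    obtain ⟨R, hR⟩ := hint k
    have hI : IntegrableOn (fun z => cost K ρ p M N (A + hess m (H k) z)) Ω :=
      integrableOn_of_bounded ((measurable_cost K ρ p M N).comp (hmeas k)) hfin
        (fun z => cost_nonneg hM0 hN0 _) (fun z => cost_le P.hM1 P.hN1 (by linarith) (hR z))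
    have h1 : ∫ x in Ω, Metric.infDist (A + hess m (H k) x) (phaseSet K) ^ p ≤ cI (H k) :=
      integral_mono_of_nonneg (Eventually.of_forall fun z => by
        have : 0 ≤ Metric.infDist (A + hess m (H k) z) (phaseSet K) := Metric.infDist_nonneg
        positivity) hI
        (Eventually.of_forall fun z => infDist_phaseSet_rpow_le_cost P.hM1 P.hN1 hp _)
    have hrk : 0 ≤ r ^ k := by positivity
    have h5 : 0 ≤ 2 ^ p * C ^ p * B * r ^ k := by positivity
    have h3 := (hBr k).1
    linarith
  · have hρq : 0 < ρ ^ q := by positivity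
    have hle : ∀ k, gI (H k) / ρ ^ q ≤ ∫ x in Ω, |1 + pd 0 (pd 0 (H k)) x| ^ q := by
      intro k
      obtain ⟨R, hR⟩ := hint k
      rw [div_le_iff₀ hρq, ← integral_mul_const]
      have hc : Continuous fun x => 1 + pd 0 (pd 0 (H k)) x :=
        continuous_const.add ((Smooth.pd (Smooth.pd (hinv k).1.1 0) 0).continuous)
      refine integral_mono_of_nonneg (Eventually.of_forall fun z => gain_nonneg _ _ _ _)
        ((integrableOn_of_bounded (b := R ^ q) (hc.abs.measurable.pow_const q) hfin
          (fun z => by positivity) fun z => ?_).mul_const _) (Eventually.of_forall fun z => ?_)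
      · exact Real.rpow_le_rpow (abs_nonneg _) ((norm_fst_le (A + hess m (H k) z)).trans (hR z)) hq0
      · have := gain_le (K := K) hρ hq0 (A + hess m (H k) z)
        rw [mul_comm] at this
        exact this
    exact tendsto_atTop_mono hle (hgtop.atTop_div_const hρq)

/-! ### The convex energy density -/

/-- Convexity of `a ↦ (1 + a ^ 2) ^ (q / 2)`. -/
lemma tangent_le_rpow_one_add_sq {q : ℝ} (hq : 1 ≤ q) (a b : ℝ) :
    (1 + a ^ 2) ^ (q / 2) + q * (1 + a ^ 2) ^ (q / 2 - 1) * a * (b - a) ≤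
      (1 + b ^ 2) ^ (q / 2) := by
  have ha : 0 < 1 + a ^ 2 := by positivity
  have hb : 0 < 1 + b ^ 2 := by positivity
  set x := √(1 + a ^ 2) with hx
  set y := √(1 + b ^ 2) with hy
  have hx0 : 0 < x := Real.sqrt_pos.2 ha
  have hy0 : 0 < y := Real.sqrt_pos.2 hb
  have hx2 : x ^ 2 = 1 + a ^ 2 := Real.sq_sqrt ha.le
  have hy2 : y ^ 2 = 1 + b ^ 2 := Real.sq_sqrt hb.le
  have hxy : 1 + a * b ≤ x * y := by
    refine le_of_sq_le_sq ?_ (by positivity)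
    rw [mul_pow, hx2, hy2]
    nlinarith [sq_nonneg (a - b)]
  have e1 : (1 + a ^ 2) ^ (q / 2) = x ^ q := by
    rw [← hx2, ← Real.rpow_natCast, ← Real.rpow_mul hx0.le]
    congr 1; push_cast; ring
  have e2 : (1 + b ^ 2) ^ (q / 2) = y ^ q := by
    rw [← hy2, ← Real.rpow_natCast, ← Real.rpow_mul hy0.le]
    congr 1; push_cast; ring
  have e3 : (1 + a ^ 2) ^ (q / 2 - 1) = x ^ q / x ^ 2 := by
    rw [Real.rpow_sub_one ha.ne', e1, hx2]
  rw [e1, e2, e3]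
  -- Bernoulli's inequality for `(y / x) ^ q` gives convexity of the power. The Cauchy–Schwarz bound
  -- `hxy` then turns the increment of the square root into `a * (b - a)`.
  have hB := one_add_mul_self_le_rpow_one_add (s := y / x - 1)
    (by have : 0 < y / x := by positivity
        linarith) hq
  rw [add_sub_cancel, Real.div_rpow hy0.le hx0.le, le_div_iff₀ (by positivity)] at hB
  refine le_trans ?_ hB
  have hxq : 0 < x ^ q := by positivity
  have h1 : a * (b - a) / x ^ 2 ≤ y / x - 1 := by
    rw [div_le_iff₀ (by positivity)]
    have : (y / x - 1) * x ^ 2 = x * y - x ^ 2 := by field_simp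
    rw [this, hx2]; nlinarith
  calc x ^ q + q * (x ^ q / x ^ 2) * a * (b - a) = (1 + q * (a * (b - a) / x ^ 2)) * x ^ q := by
        ring
    _ ≤ _ := by gcongr

lemma abs_rpow_le_rpow_one_add_sq {q : ℝ} (hq : 0 ≤ q) (a : ℝ) :
    |a| ^ q ≤ (1 + a ^ 2) ^ (q / 2) := by
  have : |a| ^ q = (a ^ 2) ^ (q / 2) := by
    rw [← sq_abs, ← Real.rpow_natCast, ← Real.rpow_mul (abs_nonneg a)]
    congr 1; push_cast; ring
  rw [this]
  exact Real.rpow_le_rpow (by positivity) (by linarith) (by positivity)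

lemma rpow_one_add_sq_le {q : ℝ} (hq : 0 ≤ q) (a : ℝ) :
    (1 + a ^ 2) ^ (q / 2) ≤ 2 ^ q * (1 + |a| ^ q) := by
  have h1 := add_rpow_le_two_rpow (zero_le_one) (abs_nonneg a) hq
  rw [Real.one_rpow] at h1
  refine le_trans ?_ h1
  have h2 : (1 + |a|) ^ q = ((1 + |a|) ^ 2) ^ (q / 2) := by
    rw [← Real.rpow_natCast, ← Real.rpow_mul (by positivity)]
    congr 1; push_cast; ring
  rw [h2]
  refine Real.rpow_le_rpow (by positivity) ?_ (by positivity)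
  nlinarith [sq_abs a, abs_nonneg a]

/-! ### Passage to the limit -/

/-- A geometrically converging sequence in `L^p` has a limit. -/
lemma exists_limit_of_geometric {E : Type*} [NormedAddCommGroup E] [CompleteSpace E]
    {μ : Measure Plane} {p : ℝ} (hp : 1 ≤ p) {f : ℕ → Plane → E}
    (hf : ∀ k, MemLp (f k) (ENNReal.ofReal p) μ) {B r : ℝ} (hB : 0 ≤ B) (hr0 : 0 < r) (hr : r < 1)
    (h : ∀ k, ∫ x, ‖f (k + 1) x - f k x‖ ^ p ∂μ ≤ B * r ^ k) :
    ∃ F : Plane → E, StronglyMeasurable F ∧ MemLp F (ENNReal.ofReal p) μ ∧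
      Tendsto (fun k => eLpNorm (f k - F) (ENNReal.ofReal p) μ) atTop (𝓝 0) := by
  have : Fact (1 ≤ ENNReal.ofReal p) := ⟨by simpa using hp⟩
  have hp0 : 0 < p := by linarith
  have hcauchy : CauchySeq fun k => (hf k).toLp (f k) := by
    refine cauchySeq_of_le_geometric (r ^ p⁻¹) (B ^ p⁻¹)
      (Real.rpow_lt_one hr0.le hr (by positivity)) fun k => ?_
    rw [dist_comm, Lp.dist_def, eLpNorm_congr_ae
      (((hf (k + 1)).coeFn_toLp).sub ((hf k).coeFn_toLp)),
      MemLp.eLpNorm_eq_integral_rpow_norm (by simpa using hp0) ENNReal.ofReal_ne_top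
        ((hf (k + 1)).sub (hf k)), ENNReal.toReal_ofReal hp0.le, ENNReal.toReal_ofReal (by positivity)]
    have e : B ^ p⁻¹ * (r ^ p⁻¹) ^ k = (B * r ^ k) ^ p⁻¹ := by
      rw [Real.mul_rpow hB (by positivity), ← Real.rpow_natCast, ← Real.rpow_natCast,
        ← Real.rpow_mul hr0.le, ← Real.rpow_mul hr0.le, mul_comm (p⁻¹)]
    rw [e]
    exact Real.rpow_le_rpow (by positivity) (h k) (by positivity)
  obtain ⟨F, hF⟩ := cauchySeq_tendsto_of_complete hcauchy
  refine ⟨F, Lp.stronglyMeasurable F, Lp.memLp F, ?_⟩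
  have := (Lp.tendsto_Lp_iff_tendsto_eLpNorm'' (fi := atTop) f hf F (Lp.memLp F)).1
  rw [Lp.toLp_coeFn] at this
  exact this hF

lemma tendsto_eLpNorm_one {E : Type*} [NormedAddCommGroup E] {μ : Measure Plane}
    [IsFiniteMeasure μ] {p : ℝ≥0∞} (hp : 1 ≤ p) {f : ℕ → Plane → E}
    (hf : ∀ k, AEStronglyMeasurable (f k) μ)
    (h : Tendsto (fun k => eLpNorm (f k) p μ) atTop (𝓝 0)) :
    Tendsto (fun k => eLpNorm (f k) 1 μ) atTop (𝓝 0) := by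
  by_cases hμ : μ = 0
  · simp [hμ]
  refine tendsto_of_tendsto_of_tendsto_of_le_of_le tendsto_const_nhds ?_ (fun k => zero_le)
    (fun k => eLpNorm_le_eLpNorm_mul_rpow_measure_univ hp (hf k))
  have := ENNReal.Tendsto.mul_const h (b := μ Set.univ ^ (1 / (1 : ℝ≥0∞).toReal - 1 / p.toReal))
    (Or.inr (ENNReal.rpow_ne_top_of_ne_zero (by simpa using hμ) (measure_ne_top _ _)))
  simpa using this

/-- Integrals against bounded weights pass to the limit in `L¹`. -/
lemma tendsto_integral_of_norm_le {E G : Type*} [NormedAddCommGroup E] [NormedAddCommGroup G]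
    [NormedSpace ℝ G] {μ : Measure Plane} {f : ℕ → Plane → E} {F : Plane → E}
    (h : Tendsto (fun k => eLpNorm (f k - F) 1 μ) atTop (𝓝 0)) {g : ℕ → Plane → G} {g' : Plane → G}
    (hg : ∀ k, Integrable (g k) μ) (hg' : Integrable g' μ) {c : ℝ}
    (hle : ∀ k, ∀ᵐ x ∂μ, ‖g k x - g' x‖ ≤ c * ‖f k x - F x‖) :
    Tendsto (fun k => ∫ x, g k x ∂μ) atTop (𝓝 (∫ x, g' x ∂μ)) := by
  refine tendsto_integral_of_L1' g' hg'.1 (Eventually.of_forall hg) ?_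
  refine tendsto_of_tendsto_of_tendsto_of_le_of_le tendsto_const_nhds ?_ (fun k => zero_le)
    (fun k => eLpNorm_le_mul_eLpNorm_of_ae_le_mul (g := f k - F) (c := c) (hle k) 1)
  simpa using ENNReal.Tendsto.const_mul h (a := ENNReal.ofReal c) (Or.inr ENNReal.ofReal_ne_top)

/-- This is Chebyshev's inequality. The constructed gradients lie in the strong space, and the weak
statement follows. -/
lemma memWeakLp_of_memLp {Ω : Set Plane} {p : ℝ} (hp : 1 ≤ p) {f : Plane → Plane}
    (hf : MemLp f (ENNReal.ofReal p) (volume.restrict Ω)) : MemWeakLp Ω p f := by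
  have hp0 : 0 < p := by linarith
  refine ⟨hf.1, ENNReal.rpow_lt_top_of_nonneg (by positivity) (ne_top_of_le_ne_top
    (ENNReal.rpow_ne_top_of_nonneg hp0.le hf.2.ne) (iSup_le fun t => ?_))⟩
  have ht : 0 < (t : ℝ) := t.2
  have h := mul_meas_ge_le_pow_eLpNorm' (volume.restrict Ω) (p := ENNReal.ofReal p)
    (by simpa using hp0) ENNReal.ofReal_ne_top hf.1 (ENNReal.ofReal t)
  rw [ENNReal.toReal_ofReal hp0.le, ENNReal.ofReal_rpow_of_pos ht] at h
  refine le_trans ?_ h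
  gcongr with x
  intro hx
  rw [← ofReal_norm]
  exact ENNReal.ofReal_le_ofReal hx.le

lemma norm_gradient_le {Ω : Set Plane} {φ : Plane → ℝ} (hφ : IsTestFunction Ω φ) :
    Continuous (gradient φ) ∧ ∃ c, ∀ x, ‖gradient φ x‖ ≤ c := by
  have hc : Continuous (gradient φ) := by
    have : Continuous (fderiv ℝ φ) := hφ.1.continuous_fderiv (by simp)
    exact (InnerProductSpace.toDual ℝ Plane).symm.continuous.comp this
  refine ⟨hc, hc.bounded_above_of_compact_support ?_⟩
  refine HasCompactSupport.of_support_subset_isCompact hφ.2.1 fun z hz => ?_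
  by_contra h'
  exact hz (by simp [gradient, fderiv_of_notMem_tsupport ℝ h'])

lemma setIntegral_test {Ω : Set Plane} {f : Plane → ℝ} (hf : tsupport f ⊆ Ω) :
    ∫ x in Ω, f x = ∫ x, f x :=
  setIntegral_eq_integral_of_forall_compl_eq_zero fun _ hx =>
    image_eq_zero_of_notMem_tsupport fun h => hx (hf h)

lemma exists_bound_on {E : Type*} [NormedAddCommGroup E] {Ω : Set Plane}
    (hb : Bornology.IsBounded Ω) {f : Plane → E} (hf : Continuous f) :
    ∃ c, ∀ x ∈ Ω, ‖f x‖ ≤ c := by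
  obtain ⟨c, hc⟩ := hb.isCompact_closure.exists_bound_of_continuousOn hf.continuousOn
  exact ⟨c, fun x hx => hc x (subset_closure hx)⟩

lemma integrableOn_of_continuous {E : Type*} [NormedAddCommGroup E] {Ω : Set Plane}
    (hb : Bornology.IsBounded Ω) {f : Plane → E} (hf : Continuous f) : IntegrableOn f Ω :=
  (hf.continuousOn.integrableOn_compact hb.isCompact_closure).mono_set subset_closure

lemma memLp_of_continuous {E : Type*} [NormedAddCommGroup E] [SecondCountableTopology E]
    {Ω : Set Plane} (hΩ : IsOpen Ω)
    (hb : Bornology.IsBounded Ω) {f : Plane → E} (hf : Continuous f) (s : ℝ≥0∞) :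
    MemLp f s (volume.restrict Ω) := by
  have : IsFiniteMeasure (volume.restrict Ω) := ⟨by simpa using hb.measure_lt_top⟩
  obtain ⟨c, hc⟩ := exists_bound_on hb hf
  exact MemLp.of_bound hf.aestronglyMeasurable c (ae_restrict_of_forall_mem hΩ.measurableSet hc)

lemma tendsto_eLpNorm_of_le {μ : Measure Plane} [IsFiniteMeasure μ] {f : ℕ → Plane → ℝ}
    {δ : ℕ → ℝ} (hδ : Tendsto δ atTop (𝓝 0)) (h : ∀ k x, |f k x| ≤ δ k) :
    Tendsto (fun k => eLpNorm (f k) 1 μ) atTop (𝓝 0) := by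
  refine tendsto_of_tendsto_of_tendsto_of_le_of_le tendsto_const_nhds ?_ (fun k => zero_le)
    (fun k => eLpNorm_le_of_ae_bound (Eventually.of_forall (h k)))
  have h1 : Tendsto (fun k => ENNReal.ofReal (δ k)) atTop (𝓝 0) := by
    simpa using ENNReal.tendsto_ofReal hδ
  have := ENNReal.Tendsto.const_mul h1 (a := μ Set.univ ^ (1 : ℝ≥0∞).toReal⁻¹)
    (Or.inr (by simp))
  simpa using this

lemma integral_smul_gradient {Ω : Set Plane} {v φ : Plane → ℝ} (hv : Smooth v)
    (hφ : IsTestFunction Ω φ) :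
    ∫ x in Ω, v x • gradient φ x = -∫ x in Ω, φ x • gradient v x := by
  have hgc : ∀ {f : Plane → ℝ}, Smooth f → Continuous (gradient f) := fun {f} hf =>
    (InnerProductSpace.toDual ℝ Plane).symm.continuous.comp (hf.continuous_fderiv (by simp))
  have hgs : HasCompactSupport (gradient φ) := by
    refine HasCompactSupport.of_support_subset_isCompact hφ.2.1 fun z hz => ?_
    by_contra h'
    exact hz (by simp [gradient, fderiv_of_notMem_tsupport ℝ h'])
  have I1 : IntegrableOn (fun x => v x • gradient φ x) Ω :=
    ((hv.continuous.smul (hgc hφ.1)).integrable_of_hasCompactSupport hgs.smul_left).integrableOn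
  have I2 : IntegrableOn (fun x => φ x • gradient v x) Ω :=
    ((hφ.1.continuous.smul (hgc hv)).integrable_of_hasCompactSupport hφ.2.1.smul_right).integrableOn
  ext i
  have e1 := (EuclideanSpace.proj i : Plane →L[ℝ] ℝ).integral_comp_comm I1
  have e2 := (EuclideanSpace.proj i : Plane →L[ℝ] ℝ).integral_comp_comm I2
  simp only [PiLp.proj_apply, PiLp.smul_apply, gradient_apply, smul_eq_mul] at e1 e2
  rw [PiLp.neg_apply, ← e1, ← e2, setIntegral_test, setIntegral_test,
    integral_mul_pd (hv.of_le (by simp)) (hφ.1.of_le (by simp)) hφ.2.1 i]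
  · simp only [mul_comm]
  · exact (tsupport_mul_subset_left).trans hφ.2.2
  · exact (tsupport_mul_subset_right).trans ((tsupport_pd_subset φ i).trans hφ.2.2)

/-- Weak gradients pass to the limit. -/
lemma hasWeakGradient_of_tendsto {Ω : Set Plane} (hb : Bornology.IsBounded Ω) (hΩ : IsOpen Ω)
    {v : ℕ → Plane → ℝ} {u : Plane → ℝ} (hv : ∀ k, Smooth (v k)) (hu : Continuous u) {δ : ℕ → ℝ}
    (hδ : Tendsto δ atTop (𝓝 0)) (hvu : ∀ k x, |v k x - u x| ≤ δ k) {g : Plane → Plane}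
    (hg : IntegrableOn g Ω)
    (ht : Tendsto (fun k => eLpNorm (gradient (v k) - g) 1 (volume.restrict Ω)) atTop (𝓝 0)) :
    HasWeakGradient Ω u g := by
  have : IsFiniteMeasure (volume.restrict Ω) := ⟨by simpa using hb.measure_lt_top⟩
  refine ⟨hu.locallyIntegrable.locallyIntegrableOn Ω, hg.locallyIntegrableOn, fun φ hφ => ?_⟩
  obtain ⟨hgc, c, hc⟩ := norm_gradient_le hφ
  obtain ⟨c', hc'⟩ := exists_bound_on hb hφ.1.continuous
  have l1 : Tendsto (fun k => ∫ x in Ω, v k x • gradient φ x) atTop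
      (𝓝 (∫ x in Ω, u x • gradient φ x)) := by
    refine tendsto_integral_of_norm_le (f := v) (F := u) (c := c)
      (tendsto_eLpNorm_of_le hδ hvu)
      (fun k => integrableOn_of_continuous hb ((hv k).continuous.smul hgc))
      (integrableOn_of_continuous hb (hu.smul hgc)) fun k => Eventually.of_forall fun x => ?_
    rw [← sub_smul, norm_smul, mul_comm]
    gcongr
    exact hc x
  have l2 : Tendsto (fun k => ∫ x in Ω, φ x • gradient (v k) x) atTop
      (𝓝 (∫ x in Ω, φ x • g x)) := by
    have hgk : ∀ k, Continuous (gradient (v k)) := fun k =>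
      (InnerProductSpace.toDual ℝ Plane).symm.continuous.comp
        ((hv k).continuous_fderiv (by simp))
    refine tendsto_integral_of_norm_le (c := c') ht
      (fun k => integrableOn_of_continuous hb (hφ.1.continuous.smul (hgk k)))
      (hg.bdd_smul c' hφ.1.continuous.aestronglyMeasurable
        (ae_restrict_of_forall_mem hΩ.measurableSet hc'))
      fun k => ae_restrict_of_forall_mem hΩ.measurableSet fun x hx => ?_
    rw [← smul_sub, norm_smul]
    gcongr
    exact hc' x hx
  simp only [fun k => integral_smul_gradient (hv k) hφ] at l1
  exact tendsto_nhds_unique l1 l2.neg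

/-! ### Infinite critical energy of the limit -/

/-- The derivative of the convex energy density `(1 + a ^ 2) ^ (q / 2)` along `1 + ∂₁∂₁ h`. -/
def energySlope (q : ℝ) (h : Plane → ℝ) (x : Plane) : ℝ :=
  q * (1 + (1 + pd 0 (pd 0 h) x) ^ 2) ^ (q / 2 - 1) * (1 + pd 0 (pd 0 h) x)

/-- Smoothness is the reason for using `(1 + a ^ 2) ^ (q / 2)` in place of `|a| ^ q`: the slope must
be differentiated once more in an integration by parts. -/
lemma smooth_energySlope (q : ℝ) {h : Plane → ℝ} (hh : Smooth h) : Smooth (energySlope q h) := by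
  have h1 : Smooth fun x => 1 + pd 0 (pd 0 h) x := contDiff_const.add ((hh.pd 0).pd 0)
  have h2 : Smooth fun x => 1 + (1 + pd 0 (pd 0 h) x) ^ 2 := contDiff_const.add (h1.pow 2)
  exact (contDiff_const.mul (h2.rpow_const_of_ne fun x => by positivity)).mul h1

/-- The limit has infinite energy if the energy along the sequence is unbounded and the
oscillations are small enough. -/
lemma lintegral_eq_top_of_tendsto {Ω : Set Plane} (hb : Bornology.IsBounded Ω) (hΩ : IsOpen Ω)
    {q : ℝ} (hq : 1 ≤ q) {H : ℕ → Plane → ℝ} (hH : ∀ k, IsTestFunction Ω (H k)) {ε : ℕ → ℝ}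
    (hε : ∀ k, ε k * |(∫ x in Ω, |pd 0 (energySlope q (H k)) x|)| ≤ 1)
    (hosc : ∀ k j, k ≤ j → ∀ x, |pd 0 (H j) x - pd 0 (H k) x| ≤ 2 * ε k)
    (htop : Tendsto (fun k => ∫ x in Ω, |1 + pd 0 (pd 0 (H k)) x| ^ q) atTop atTop)
    {a : Plane → ℝ} (ha : IntegrableOn a Ω)
    (hlim : Tendsto (fun k => eLpNorm ((fun x => 1 + pd 0 (pd 0 (H k)) x) - a) 1
      (volume.restrict Ω)) atTop (𝓝 0)) :
    ∫⁻ x in Ω, ENNReal.ofReal (|a x| ^ q) = ⊤ := by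
  have : IsFiniteMeasure (volume.restrict Ω) := ⟨by simpa using hb.measure_lt_top⟩
  have hq0 : 0 ≤ q := by linarith
  by_contra hne
  have ham : AEMeasurable a (volume.restrict Ω) := ha.1.aemeasurable
  have I1 : IntegrableOn (fun x => |a x| ^ q) Ω :=
    (lintegral_ofReal_ne_top_iff_integrable
      (ham.abs.pow_const q).aestronglyMeasurable
      (Eventually.of_forall fun x => by positivity)).1 hne
  have I2 : IntegrableOn (fun x => (1 + a x ^ 2) ^ (q / 2)) Ω := by
    refine Integrable.mono' (((integrable_const (1 : ℝ)).add I1).const_mul (2 ^ q))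
      (((ham.pow_const 2).const_add 1).pow_const (q / 2)).aestronglyMeasurable
      (Eventually.of_forall fun x => ?_)
    rw [Real.norm_of_nonneg (by positivity)]
    exact rpow_one_add_sq_le hq0 (a x)
  -- If the limit had finite energy, that energy plus the constant `2` would bound the energies of
  -- all stages, against `htop`.
  have key : ∀ k, ∫ x in Ω, |1 + pd 0 (pd 0 (H k)) x| ^ q ≤
      (∫ x in Ω, (1 + a x ^ 2) ^ (q / 2)) + 2 := by
    intro k
    set b : ℕ → Plane → ℝ := fun j x => 1 + pd 0 (pd 0 (H j)) x with hbdef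
    have hbc : ∀ j, Continuous (b j) := fun j =>
      continuous_const.add (Smooth.pd (Smooth.pd (hH j).1 0) 0).continuous
    set g := energySlope q (H k) with hg
    have hgs : Smooth g := smooth_energySlope q (hH k).1
    obtain ⟨c, hc⟩ := exists_bound_on hb hgs.continuous
    have hgd : Continuous (pd 0 g) := (hgs.pd 0).continuous
    -- The difference is `∂₁` of a test function of size at most `2 * ε k`. Moving the derivative to
    -- `g` leaves `2 * ε k` times the `L¹` norm of `∂₁g`, which `hε` bounds by `2` uniformly in `j`.
    have hbound : ∀ j, k ≤ j → -2 ≤ ∫ x in Ω, g x * (b j x - b k x) := by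
      intro j hkj
      set ψ : Plane → ℝ := fun x => pd 0 (H j) x - pd 0 (H k) x with hψ
      have s1 : Smooth (pd 0 (H j)) := Smooth.pd (hH j).1 0
      have s2 : Smooth (pd 0 (H k)) := Smooth.pd (hH k).1 0
      have sψ : Smooth ψ := s1.sub s2
      have cψ : HasCompactSupport ψ := ((hH j).pd 0).2.1.sub ((hH k).pd 0).2.1
      have tψ : tsupport ψ ⊆ Ω := (tsupport_sub _ _).trans
        (Set.union_subset ((hH j).pd 0).2.2 ((hH k).pd 0).2.2)
      have e1 : ∀ x, b j x - b k x = pd 0 ψ x := by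
        intro x
        rw [hψ, pd_sub s1.differentiable s2.differentiable]
        simp [b]
      simp only [e1]
      rw [setIntegral_test ((tsupport_mul_subset_right).trans ((tsupport_pd_subset ψ 0).trans tψ)),
        integral_mul_pd (hgs.of_le (by simp)) (sψ.of_le (by simp)) cψ,
        ← setIntegral_test ((tsupport_mul_subset_right).trans tψ)]
      have h1 : ∫ x in Ω, pd 0 g x * ψ x ≤ ∫ x in Ω, |pd 0 g x| * (2 * ε k) := by
        refine integral_mono (integrableOn_of_continuous hb (hgd.mul sψ.continuous))
          (integrableOn_of_continuous hb (hgd.abs.mul continuous_const)) fun x => ?_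
        calc pd 0 g x * ψ x ≤ |pd 0 g x * ψ x| := le_abs_self _
          _ = |pd 0 g x| * |ψ x| := abs_mul _ _
          _ ≤ |pd 0 g x| * (2 * ε k) := by gcongr; exact hosc k j hkj x
      rw [integral_mul_const] at h1
      have h2 := hε k
      rw [abs_of_nonneg (integral_nonneg fun x => abs_nonneg _)] at h2
      linarith
    have Ig : IntegrableOn (fun x => g x * (a x - b k x)) Ω :=
      (ha.sub (integrableOn_of_continuous hb (hbc k))).bdd_mul (c := c)
        hgs.continuous.aestronglyMeasurable (ae_restrict_of_forall_mem hΩ.measurableSet hc)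
    have hlimit : -2 ≤ ∫ x in Ω, g x * (a x - b k x) := by
      have ht : Tendsto (fun j => ∫ x in Ω, g x * (b j x - b k x)) atTop
          (𝓝 (∫ x in Ω, g x * (a x - b k x))) := by
        refine tendsto_integral_of_norm_le (c := c) hlim
          (fun j => integrableOn_of_continuous hb (hgs.continuous.mul ((hbc j).sub (hbc k)))) Ig
          fun j => ae_restrict_of_forall_mem hΩ.measurableSet fun x hx => ?_
        rw [← mul_sub, norm_mul, sub_sub_sub_cancel_right]
        gcongr
        exact hc x hx
      exact ge_of_tendsto ht ((eventually_ge_atTop k).mono hbound)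
    have I3 : IntegrableOn (fun x => (1 + b k x ^ 2) ^ (q / 2)) Ω :=
      integrableOn_of_continuous hb ((continuous_const.add ((hbc k).pow 2)).rpow_const
        fun x => Or.inr (by positivity))
    have h1 : ∫ x in Ω, |b k x| ^ q ≤ ∫ x in Ω, (1 + b k x ^ 2) ^ (q / 2) :=
      integral_mono_of_nonneg (Eventually.of_forall fun x => by positivity) I3
        (Eventually.of_forall fun x => abs_rpow_le_rpow_one_add_sq hq0 _)
    -- The tangent inequality at stage `k`, integrated. Its linear term has just been bounded below.
    have h2 : ∫ x in Ω, ((1 + b k x ^ 2) ^ (q / 2) + g x * (a x - b k x)) ≤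
        ∫ x in Ω, (1 + a x ^ 2) ^ (q / 2) :=
      integral_mono (I3.add Ig) I2 fun x => tangent_le_rpow_one_add_sq hq (b k x) (a x)
    rw [integral_add I3 Ig] at h2
    linarith
  obtain ⟨k, hk⟩ := (htop.eventually_gt_atTop ((∫ x in Ω, (1 + a x ^ 2) ^ (q / 2)) + 2)).exists
  exact absurd (key k) (not_le.2 hk)

/-! ### Gradient and flux as linear images of the second derivatives -/

/-- The gradient of `∂₁w` in terms of the second derivatives of `w`. -/
def gradPart : (ℝ × ℝ × ℝ) →L[ℝ] Plane :=
  LinearMap.toContinuousLinearMap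
    { toFun := fun A => !₂[A.1, A.2.1]
      map_add' := fun A B => by ext i; fin_cases i <;> simp
      map_smul' := fun c A => by ext i; fin_cases i <;> simp }

/-- The divergence free field `m(-∂₂∂₂w, ∂₁∂₂w)` in terms of the second derivatives of `w`. -/
def fluxPart (m : ℝ) : (ℝ × ℝ × ℝ) →L[ℝ] Plane :=
  LinearMap.toContinuousLinearMap
    { toFun := fun A => !₂[-A.2.2, m * A.2.1]
      map_add' := fun A B => by ext i; fin_cases i <;> simp <;> ring
      map_smul' := fun c A => by ext i; fin_cases i <;> simp; ring }

lemma gradPart_apply (A : ℝ × ℝ × ℝ) : gradPart A = !₂[A.1, A.2.1] := rfl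

lemma fluxPart_apply (m : ℝ) (A : ℝ × ℝ × ℝ) : fluxPart m A = !₂[-A.2.2, m * A.2.1] := rfl

lemma gradient_pd_zero (m : ℝ) (w : Plane → ℝ) (x : Plane) :
    gradient (pd 0 w) x = gradPart (hess m w x) := by
  ext i
  rw [gradient_apply]
  fin_cases i <;> simp [gradPart_apply, hess]

lemma abs_fst_le_norm_gradPart (A : ℝ × ℝ × ℝ) : |A.1| ≤ ‖gradPart A‖ := by
  have := PiLp.norm_apply_le (gradPart A) 0
  simpa [gradPart_apply] using this

/-- On `phaseSet K` the flux is the image of the gradient under one of the two phases. -/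
lemma flux_eq_of_mem_phaseSet {K S₁ S₂ : ℝ} (hK : 1 < K) {A : ℝ × ℝ × ℝ} (hA : A ∈ phaseSet K)
    [Decidable (A.2.2 = -(K * A.1))] :
    Matrix.toEuclideanLin (if A.2.2 = -(K * A.1) then Matrix.diagonal ![K, S₂]
      else Matrix.diagonal ![1 / K, 1 / S₁]) (gradPart A) = fluxPart S₂ A := by
  have hK0 : K ≠ 0 := by linarith
  split_ifs with h
  · ext i
    fin_cases i <;> simp [Matrix.toLpLin_apply, gradPart_apply, fluxPart_apply, h]
  · obtain ⟨h1, h2⟩ := hA.resolve_left h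
    have h3 : A.1 = -(K * A.2.2) := by linarith
    ext i
    fin_cases i
    · simp [Matrix.toLpLin_apply, gradPart_apply, fluxPart_apply, h3, hK0]
    · simp [Matrix.toLpLin_apply, gradPart_apply, fluxPart_apply, h2]

/-- The flux is `m` times the rotated gradient of `∂₂w`. After integration by parts both terms
contain the same mixed derivative of `φ` and cancel. -/
lemma integral_inner_flux {Ω : Set Plane} {w φ : Plane → ℝ} (m : ℝ) (hw : Smooth w)
    (hφ : IsTestFunction Ω φ) :
    ∫ x in Ω, inner ℝ (fluxPart m (hess m w x)) (gradient φ x) = 0 := by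
  have hpt : ∀ x, inner ℝ (fluxPart m (hess m w x)) (gradient φ x) =
      m * (pd 0 (pd 1 w) x * pd 1 φ x - pd 1 (pd 1 w) x * pd 0 φ x) := by
    intro x
    rw [PiLp.inner_apply, Fin.sum_univ_two, gradient_apply, gradient_apply, pd_comm hw 0 1]
    simp [fluxPart_apply, hess]
    ring
  simp only [hpt]
  have hs : ∀ i j, IntegrableOn (fun x => pd i (pd 1 w) x * pd j φ x) Ω ∧
      ∫ x in Ω, pd i (pd 1 w) x * pd j φ x = -∫ x, pd 1 w x * pd i (pd j φ) x := by
    intro i j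
    have hj := hφ.pd j
    refine ⟨((((hw.pd 1).pd i).continuous.mul hj.1.continuous).integrable_of_hasCompactSupport
      hj.2.1.mul_left).integrableOn, ?_⟩
    rw [setIntegral_test ((tsupport_mul_subset_right).trans hj.2.2),
      integral_mul_pd ((hw.pd 1).of_le (by simp)) (hj.1.of_le (by simp)) hj.2.1, neg_neg]
  rw [integral_const_mul, integral_sub (hs 0 1).1 (hs 1 0).1, (hs 0 1).2, (hs 1 0).2,
    pd_comm hφ.1 0 1, sub_self, mul_zero]

/-- The limit of a sequence whose second derivatives approach `phaseSet K` has values there. -/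
lemma ae_mem_phaseSet {K p : ℝ} (hp : 1 ≤ p) {Ω : Set Plane} (hΩ : IsOpen Ω)
    (hb : Bornology.IsBounded Ω) {f : ℕ → Plane → ℝ × ℝ × ℝ} (hf : ∀ k, Continuous (f k))
    {F : Plane → ℝ × ℝ × ℝ} (hF : StronglyMeasurable F) {B r : ℝ} (hr0 : 0 < r) (hr : r < 1)
    (h : ∀ k, ∫ x in Ω, Metric.infDist (f k x) (phaseSet K) ^ p ≤ B * r ^ k)
    (hlim : Tendsto (fun k => eLpNorm (f k - F) (ENNReal.ofReal p) (volume.restrict Ω)) atTop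
      (𝓝 0)) : ∀ᵐ x ∂(volume.restrict Ω), F x ∈ phaseSet K := by
  have hp0 : 0 < p := by linarith
  set D : ℝ × ℝ × ℝ → ℝ := fun A => Metric.infDist A (phaseSet K) with hD
  have hDc : Continuous D := Metric.continuous_infDist_pt _
  have hne : (phaseSet K).Nonempty := ⟨0, Or.inl (by simp)⟩
  have hbound : ∀ k, eLpNorm (D ∘ F) (ENNReal.ofReal p) (volume.restrict Ω) ≤
      eLpNorm (f k - F) (ENNReal.ofReal p) (volume.restrict Ω) +
        ENNReal.ofReal ((B * r ^ k) ^ p⁻¹) := by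
    intro k
    have hm : MemLp (D ∘ f k) (ENNReal.ofReal p) (volume.restrict Ω) :=
      memLp_of_continuous hΩ hb (hDc.comp (hf k)) _
    have e : D ∘ F = (D ∘ F - D ∘ f k) + D ∘ f k := by simp
    have hFm : AEStronglyMeasurable (D ∘ F) (volume.restrict Ω) :=
      (hDc.comp_stronglyMeasurable hF).aestronglyMeasurable
    rw [e]
    -- The distance function is 1-Lipschitz, so the distance of the limit to `phaseSet K` is bounded
    -- in `L^p` by the approximation error plus the distance at stage `k`, and both tend to zero.
    refine (eLpNorm_add_le (hFm.sub hm.1) hm.1 (by simpa using hp)).trans ?_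
    gcongr
    · refine eLpNorm_mono fun x => ?_
      rw [Pi.sub_apply, Pi.sub_apply, ← dist_eq_norm, ← dist_eq_norm, dist_comm (f k x)]
      have := (Metric.lipschitz_infDist_pt (phaseSet K)).dist_le_mul (F x) (f k x)
      simpa using this
    · rw [MemLp.eLpNorm_eq_integral_rpow_norm (by simpa using hp0) ENNReal.ofReal_ne_top hm,
        ENNReal.toReal_ofReal hp0.le]
      refine ENNReal.ofReal_le_ofReal (Real.rpow_le_rpow (by positivity) ?_ (by positivity))
      refine le_trans (le_of_eq ?_) (h k)
      refine integral_congr_ae (Eventually.of_forall fun x => ?_)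
      simp only [Function.comp_apply, hD, Real.norm_of_nonneg Metric.infDist_nonneg]
  have hz : Tendsto (fun k => eLpNorm (f k - F) (ENNReal.ofReal p) (volume.restrict Ω) +
      ENNReal.ofReal ((B * r ^ k) ^ p⁻¹)) atTop (𝓝 0) := by
    have h1 : Tendsto (fun k : ℕ => (B * r ^ k) ^ p⁻¹) atTop (𝓝 0) := by
      have h2 := (tendsto_pow_atTop_nhds_zero_of_lt_one hr0.le hr).const_mul B
      rw [mul_zero] at h2
      have h3 := h2.rpow_const (p := p⁻¹) (Or.inr (by positivity))
      rwa [Real.zero_rpow (by positivity)] at h3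
    simpa using hlim.add (ENNReal.tendsto_ofReal h1)
  have h0 : eLpNorm (D ∘ F) (ENNReal.ofReal p) (volume.restrict Ω) = 0 :=
    le_antisymm (ge_of_tendsto' hz hbound) zero_le
  have h1 := (eLpNorm_eq_zero_iff (f := D ∘ F)
    (hDc.comp_stronglyMeasurable hF).aestronglyMeasurable (by simpa using hp0)).1 h0
  filter_upwards [h1] with x hx
  exact ((isClosed_phaseSet K).mem_iff_infDist_zero hne).2 hx

/-! ### Construction of the solutions -/

/-- For each exponent below `2K/(K+1)` there is a solution whose gradient is integrable with that
exponent but not with the exponent `2K/(K+1)`. -/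
theorem exists_solution {K S₁ S₂ p : ℝ} (hK : 1 < K) (hS₂ : 0 < S₂) (hp : 1 ≤ p)
    (hpq : p < 2 * K / (K + 1)) {Ω : Set Plane} (hΩ : IsOpen Ω) (hb : Bornology.IsBounded Ω)
    (hne : Ω.Nonempty) :
    ∃ (σ : Plane → Matrix (Fin 2) (Fin 2) ℝ) (u : Plane → ℝ) (Du : Plane → Plane),
      IsTwoPhase Ω (Matrix.diagonal ![1 / K, 1 / S₁]) (Matrix.diagonal ![K, S₂]) σ ∧
      Continuous u ∧ HasWeakGradient Ω u Du ∧
      MemLp Du (ENNReal.ofReal p) (volume.restrict Ω) ∧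
      (∀ φ : Plane → ℝ, IsTestFunction Ω φ →
        Integrable (fun x => inner ℝ (Matrix.toEuclideanLin (σ x) (Du x)) (gradient φ x))
          (volume.restrict Ω) ∧
        ∫ x in Ω, inner ℝ (Matrix.toEuclideanLin (σ x) (Du x)) (gradient φ x) = 0) ∧
      MemW11Zero Ω (fun x => u x - x 0) ∧
      ∫⁻ x in Ω, ENNReal.ofReal (‖Du x‖ ^ (2 * K / (K + 1))) = ⊤ := by
  classical
  have : IsFiniteMeasure (volume.restrict Ω) := ⟨by simpa using hb.measure_lt_top⟩
  have hp1 : (1 : ℝ≥0∞) ≤ ENNReal.ofReal p := by simpa using hp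
  -- The free functional is taken to be the `L¹` norm of `∂₁` of the energy slope, as the blow-up
  -- argument requires; the parameter `m` is `S₂`.
  obtain ⟨d, H, ε, B, r, hB, hr0, hr1, hH, hε, hεF, hosc, hgeo, hphase, htop⟩ :=
    exists_sequence hK hS₂ hp hpq hΩ hb.measure_lt_top.ne hne
      (fun h => ∫ x in Ω, |pd 0 (energySlope (2 * K / (K + 1)) h) x|)
  set q := 2 * K / (K + 1) with hq
  have hq1 : 1 ≤ q := hp.trans hpq.le
  set A : ℝ × ℝ × ℝ := (1, 0, d) with hA
  set f : ℕ → Plane → ℝ × ℝ × ℝ := fun k x => A + hess S₂ (H k) x with hf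
  have hfc : ∀ k, Continuous (f k) := fun k =>
    continuous_const.add (continuous_hess (hH k).1)
  obtain ⟨F, hFm, hFp, hFlim⟩ := exists_limit_of_geometric (μ := volume.restrict Ω) hp
    (f := f) (fun k => memLp_of_continuous hΩ hb (hfc k) _) hB hr0 hr1
    (fun k => by simpa [f] using hgeo k)
  have hFphase := ae_mem_phaseSet hp hΩ hb hfc hFm hr0 hr1 hphase hFlim
  have hF1 : Integrable F (volume.restrict Ω) := hFp.integrable hp1
  have hlim1 : Tendsto (fun k => eLpNorm (f k - F) 1 (volume.restrict Ω)) atTop (𝓝 0) :=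
    tendsto_eLpNorm_one hp1
      (fun k => (hfc k).aestronglyMeasurable.sub hFm.aestronglyMeasurable) hFlim
  have hlim_of : ∀ {E : Type} [NormedAddCommGroup E] (g : ℕ → Plane → E) (c : ℝ),
      (∀ k x, ‖g k x‖ ≤ c * ‖f k x - F x‖) →
      Tendsto (fun k => eLpNorm (g k) 1 (volume.restrict Ω)) atTop (𝓝 0) := by
    intro E _ g c hg
    refine tendsto_of_tendsto_of_tendsto_of_le_of_le tendsto_const_nhds ?_ (fun k => zero_le)
      (fun k => eLpNorm_le_mul_eLpNorm_of_ae_le_mul (g := f k - F) (c := c)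
        (Eventually.of_forall (hg k)) 1)
    simpa using ENNReal.Tendsto.const_mul hlim1 (a := ENNReal.ofReal c)
      (Or.inr ENNReal.ofReal_ne_top)
  have hδ : Tendsto (fun k => 2 * ε k) atTop (𝓝 0) := by simpa using hε.const_mul 2
  -- the uniform limit
  have hcau : ∀ x, CauchySeq fun k => pd 0 (H k) x := by
    intro x
    refine cauchySeq_of_le_tendsto_0 (fun k => 2 * ε k + 2 * ε k) ?_ (by simpa using hδ.add hδ)
    intro i j k hki hkj
    refine (dist_triangle_right _ _ (pd 0 (H k) x)).trans ?_
    rw [Real.dist_eq, Real.dist_eq]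
    exact add_le_add (hosc k i hki x) (hosc k j hkj x)
  choose v hv using fun x => cauchySeq_tendsto_of_complete (hcau x)
  have hvH : ∀ k x, |pd 0 (H k) x - v x| ≤ 2 * ε k := by
    intro k x
    rw [abs_sub_comm]
    exact le_of_tendsto ((hv x).sub_const _).abs
      ((eventually_ge_atTop k).mono fun j hkj => hosc k j hkj x)
  have hvc : Continuous v := by
    refine TendstoUniformly.continuous (F := fun k => pd 0 (H k)) (p := atTop) ?_
      (Frequently.of_forall fun k => (Smooth.pd (hH k).1 0).continuous)
    rw [Metric.tendstoUniformly_iff]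
    intro e he
    filter_upwards [hδ.eventually_lt_const he] with k hk x
    rw [dist_comm, Real.dist_eq]
    exact (hvH k x).trans_lt hk
  have hx0 : Continuous fun x : Plane => x 0 := (smooth_coord 0).continuous
  have hWv : HasWeakGradient Ω v (fun x => gradPart (F x - A)) := by
    refine hasWeakGradient_of_tendsto hb hΩ (fun k => Smooth.pd (hH k).1 0) hvc hδ hvH
      (gradPart.integrable_comp (hF1.sub (integrable_const A))) ?_
    refine hlim_of _ ‖gradPart‖ fun k x => ?_
    rw [Pi.sub_apply, gradient_pd_zero S₂, ← map_sub]
    refine (gradPart.le_opNorm _).trans (le_of_eq ?_)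
    congr 2
    simp only [hf]
    abel
  set w : ℕ → Plane → ℝ := fun k x => quad 0 0 0 0 1 0 (d / S₂) x + H k x with hw
  have hws : ∀ k, Smooth (w k) := fun k => (smooth_quad _ _ _ _ _ _ _).add (hH k).1
  have hwf : ∀ k x, hess S₂ (w k) x = f k x := by
    intro k x
    simp only [hw, hess_add (smooth_quad _ _ _ _ _ _ _) (hH k).1, hess_quad, hf, hA,
      mul_div_cancel₀ _ hS₂.ne']
  have hwp : ∀ k x, pd 0 (w k) x = x 0 + pd 0 (H k) x := by
    intro k x
    simp only [hw, pd_add (smooth_quad _ _ _ _ _ _ _).differentiable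
      (Smooth.differentiable (hH k).1), pd_zero_quad]
    simp [quad]
  have hWu : HasWeakGradient Ω (fun x => x 0 + v x) (fun x => gradPart (F x)) := by
    refine hasWeakGradient_of_tendsto hb hΩ (fun k => (hws k).pd 0) (hx0.add hvc) hδ
      (fun k x => by rw [hwp, Pi.add_apply, add_sub_add_left_eq_sub]; exact hvH k x)
      (gradPart.integrable_comp hF1) ?_
    refine hlim_of _ ‖gradPart‖ fun k x => ?_
    rw [Pi.sub_apply, gradient_pd_zero S₂, ← map_sub, hwf]
    exact gradPart.le_opNorm _
  -- The phase is read off from the limit triple. Where both conditions hold the choice is `σ₂`, and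
  -- off `phaseSet K`, a null set in `Ω`, the value does not matter.
  refine ⟨fun x => if (F x).2.2 = -(K * (F x).1) then Matrix.diagonal ![K, S₂]
      else Matrix.diagonal ![1 / K, 1 / S₁], fun x => x 0 + v x, fun x => gradPart (F x),
    ⟨fun i j => ?_, ?_⟩, hx0.add hvc, hWu, hFp.continuousLinearMap_comp gradPart, ?_, ?_, ?_⟩
  · have hs : MeasurableSet {x | (F x).2.2 = -(K * (F x).1)} :=
      measurableSet_eq_fun (by have := hFm.measurable; fun_prop)
        (by have := hFm.measurable; fun_prop)
    have : (fun x => (if (F x).2.2 = -(K * (F x).1) then Matrix.diagonal ![K, S₂]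
        else Matrix.diagonal ![1 / K, 1 / S₁]) i j) = fun x => if (F x).2.2 = -(K * (F x).1) then
          (Matrix.diagonal ![K, S₂] : Matrix (Fin 2) (Fin 2) ℝ) i j
          else (Matrix.diagonal ![1 / K, 1 / S₁] : Matrix (Fin 2) (Fin 2) ℝ) i j := by
      ext x; split_ifs <;> rfl
    rw [this]
    exact (Measurable.ite hs measurable_const measurable_const).aemeasurable
  · refine Eventually.of_forall fun x => ?_
    dsimp only
    split_ifs
    · exact Or.inr rfl
    · exact Or.inl rfl
  · intro φ hφ
    obtain ⟨hgc, c, hc⟩ := norm_gradient_le hφ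
    have hT : Integrable (fun x => fluxPart S₂ (F x)) (volume.restrict Ω) :=
      (fluxPart S₂).integrable_comp hF1
    have hI : Integrable (fun x => inner ℝ (fluxPart S₂ (F x)) (gradient φ x))
        (volume.restrict Ω) := by
      refine Integrable.mono' (hT.norm.mul_const c) (hT.1.inner hgc.aestronglyMeasurable)
        (Eventually.of_forall fun x => ?_)
      exact (norm_inner_le_norm _ _).trans (by gcongr; exact hc x)
    have hae : (fun x => inner ℝ (fluxPart S₂ (F x)) (gradient φ x)) =ᵐ[volume.restrict Ω]
        fun x => inner ℝ (Matrix.toEuclideanLin (if (F x).2.2 = -(K * (F x).1) then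
          Matrix.diagonal ![K, S₂] else Matrix.diagonal ![1 / K, 1 / S₁]) (gradPart (F x)))
          (gradient φ x) := by
      filter_upwards [hFphase] with x hx
      rw [flux_eq_of_mem_phaseSet hK hx]
    refine ⟨hI.congr hae, ?_⟩
    rw [← integral_congr_ae hae]
    have ht : Tendsto (fun k => ∫ x in Ω, inner ℝ (fluxPart S₂ (hess S₂ (w k) x)) (gradient φ x))
        atTop (𝓝 (∫ x in Ω, inner ℝ (fluxPart S₂ (F x)) (gradient φ x))) := by
      simp only [hwf]
      refine tendsto_integral_of_norm_le (c := ‖fluxPart S₂‖ * c) hlim1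
        (fun k => integrableOn_of_continuous hb
          (((fluxPart S₂).continuous.comp (hfc k)).inner hgc)) hI
        fun k => Eventually.of_forall fun x => ?_
      rw [← inner_sub_left, ← map_sub]
      calc _ ≤ ‖fluxPart S₂ (f k x - F x)‖ * ‖gradient φ x‖ := norm_inner_le_norm _ _
        _ ≤ (‖fluxPart S₂‖ * ‖f k x - F x‖) * c := by
            gcongr
            · exact (fluxPart S₂).le_opNorm _
            · exact hc x
        _ = _ := by ring
    simp only [fun k => integral_inner_flux S₂ (hws k) hφ] at ht
    exact (tendsto_nhds_unique ht tendsto_const_nhds)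
  · have e : (fun x : Plane => x 0 + v x - x 0) = v := by ext x; ring
    rw [e]
    have hgi : Integrable (fun x => gradPart (F x - A)) (volume.restrict Ω) :=
      gradPart.integrable_comp (hF1.sub (integrable_const A))
    refine ⟨⟨memLp_of_continuous hΩ hb hvc _, _, hWv, by simpa using memLp_one_iff_integrable.2 hgi⟩,
      _, hWv, fun k => pd 0 (H k), fun k => (hH k).pd 0, ?_, ?_⟩
    · refine tendsto_eLpNorm_of_le hδ fun k x => ?_
      rw [abs_sub_comm]
      exact hvH k x
    · refine hlim_of _ ‖gradPart‖ fun k x => ?_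
      rw [gradient_pd_zero S₂, ← map_sub]
      refine (gradPart.le_opNorm _).trans (le_of_eq ?_)
      rw [norm_sub_rev]
      congr 2
      simp only [hf]
      abel
  · have h1 := lintegral_eq_top_of_tendsto hb hΩ hq1 hH hεF hosc htop hF1.fst
      (hlim_of _ 1 fun k x => by
        rw [one_mul]
        exact norm_fst_le (f k x - F x))
    refine top_unique (h1 ▸ lintegral_mono fun x => ?_)
    exact ENNReal.ofReal_le_ofReal (Real.rpow_le_rpow (abs_nonneg _)
      (abs_fst_le_norm_gradPart (F x)) (by linarith))

end TwoPhase

end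

theorem theorem1p2 (Ω : Set TwoPhase.Plane) (hΩo : IsOpen Ω) (hΩb : Bornology.IsBounded Ω)
    (hΩn : Ω.Nonempty) (K S₁ S₂ : ℝ) (hK : 1 < K)
    (hS₁ : S₁ ∈ Set.Icc (1 / K) K) (hS₂ : S₂ ∈ Set.Icc (1 / K) K) :
    ∃ (σ : ℕ → TwoPhase.Plane → Matrix (Fin 2) (Fin 2) ℝ) (p : ℕ → ℝ)
      (u : ℕ → TwoPhase.Plane → ℝ) (Du : ℕ → TwoPhase.Plane → TwoPhase.Plane),
      (∀ n, TwoPhase.IsTwoPhase Ω (Matrix.diagonal ![1 / K, 1 / S₁]) (Matrix.diagonal ![K, S₂])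
        (σ n)) ∧
      (∀ n, p n ∈ Set.Icc 1 (2 * K / (K + 1))) ∧
      (∀ n, TwoPhase.MemW1 Ω 1 (u n)) ∧
      (∀ n, TwoPhase.HasWeakGradient Ω (u n) (Du n)) ∧
      (∀ n, TwoPhase.IsDistributionalSolution Ω (σ n) (u n)) ∧
      (∀ n, TwoPhase.MemW11Zero Ω (fun x => u n x - x 0)) ∧
      (∀ n, TwoPhase.MemWeakLp Ω (p n) (Du n)) ∧
      Filter.Tendsto p Filter.atTop (nhds (2 * K / (K + 1))) ∧
      (∀ n, ¬ MeasureTheory.MemLp (Du n) (ENNReal.ofReal (2 * K / (K + 1)))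
        (MeasureTheory.volume.restrict Ω)) ∧
      (∀ n, ∀ q : ℝ, 1 ≤ q → q < p n → TwoPhase.MemW1 Ω q (u n)) ∧
      (∀ n, ∫⁻ x in Ω, ENNReal.ofReal (‖Du n x‖ ^ (2 * K / (K + 1))) = ⊤) := by
  have hK1 : 0 < K + 1 := by linarith
  have hS₂0 : 0 < S₂ := lt_of_lt_of_le (one_div_pos.2 (by linarith)) hS₂.1
  have : IsFiniteMeasure (volume.restrict Ω) := ⟨by simpa using hΩb.measure_lt_top⟩
  set s := 2 * K / (K + 1) with hs
  have hs1 : 1 < s := by rw [hs, lt_div_iff₀ hK1]; linarith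
  -- The sequence starts at `1` and stays strictly below the critical exponent.
  set p : ℕ → ℝ := fun n => s - (s - 1) / ((n : ℝ) + 1) with hp
  have hpos : ∀ n : ℕ, 0 < (s - 1) / ((n : ℝ) + 1) := fun n =>
    div_pos (by linarith) (by positivity)
  have hp1 : ∀ n, 1 ≤ p n := by
    intro n
    have : (s - 1) / ((n : ℝ) + 1) ≤ s - 1 :=
      div_le_self (by linarith) (by linarith [Nat.cast_nonneg (α := ℝ) n])
    simp only [hp]
    linarith
  have hps : ∀ n, p n < s := fun n => by simp only [hp]; linarith [hpos n]
  choose σ u Du hσ huc hDu hDup heq hbd htop using fun n =>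
    TwoPhase.exists_solution (S₁ := S₁) hK hS₂0 (hp1 n) (hps n) hΩo hΩb hΩn
  have hW : ∀ n q, q ≤ p n → TwoPhase.MemW1 Ω q (u n) := fun n q hq =>
    ⟨TwoPhase.memLp_of_continuous hΩo hΩb (huc n) _, Du n, hDu n,
      (hDup n).mono_exponent (ENNReal.ofReal_le_ofReal hq)⟩
  refine ⟨σ, p, u, Du, hσ, fun n => ⟨hp1 n, (hps n).le⟩, fun n => hW n 1 (hp1 n), hDu,
    fun n => ⟨hW n 1 (hp1 n), Du n, hDu n, heq n⟩, hbd,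
    fun n => TwoPhase.memWeakLp_of_memLp (hp1 n) (hDup n), ?_, fun n h => ?_,
    fun n q _ hq => hW n q hq.le, htop⟩
  · have h1 : Tendsto (fun n : ℕ => (s - 1) * (1 / ((n : ℝ) + 1))) atTop (𝓝 0) := by
      simpa using tendsto_one_div_add_atTop_nhds_zero_nat.const_mul (s - 1)
    have h2 := h1.const_sub s
    rw [sub_zero] at h2
    refine h2.congr fun n => ?_
    simp only [hp]
    ring
  · have h1 := h.integrable_norm_rpow (by simpa using by linarith) ENNReal.ofReal_ne_top
    rw [ENNReal.toReal_ofReal (by linarith)] at h1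
    exact (lintegral_ofReal_ne_top_iff_integrable h1.1
      (Eventually.of_forall fun x => by positivity)).2 h1 (htop n)
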